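/- **Proposition.** Let $Y=Y^{11}$ be a Hausdorff, second countable smooth manifold with boundary of dimension $11$, and let $\iota:W^6\hookrightarrow Y$ be a smooth embedding of a $6$-dimensional manifold with boundary, with closed image, which is neat: $\partial W=W\cap\partial Y$ and in suitable charts of the manifolds with boundary $\iota$ is a linear inclusion. Let $N=TY|_W/TW$ be the normal bundle, $\mathcal S^{10}=(N\setminus W)/\mathbb R_{>0}$ the normal sphere bundle, and $\mathcal C_+$ the half cylinder bundle of pairs $(\rho,n)$, where $\rho$ is a ray in a fibre of $N$ and $n\in\rho\cup\{0\}$. Put $X=(Y\setminus W)\sqcup\mathcal S^{10}$, and let $p:X\to Y$ be the identity on $Y\setminus W$ and the bundle projection on $\mathcal S^{10}$. A *tubular map* over an open subset $V\subseteq W$ is a diffeomorphism $T$ of an open set $U\subseteq N$ with $U\cap W=V$ onto an open set $U'\subseteq Y$ with $U'\cap W=V$, such that $T|_V$ is the inclusion and $T$ induces the identity on the normal bundle of $V$; for $V=W$ it is a tubular map of $W$. It induces a map $T'$ from the inverse image $\mathcal C_+U$ of $U$ in $\mathcal C_+$ to $X$, sending $(\rho,0)$ to $\rho\in\mathcal S^{10}$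 and $(\rho,n)$ to $T(n)$ for $n\ne0$. Call a structure of manifold with corners on $X$ (a topology and a smooth atlas with values in $[0,\infty)^{11}$) *admissible for $T$* if $Y\setminus W$ is open in $X$ with its given smooth structure and $T'$ is a diffeomorphism of $\mathcal C_+U$ onto an open subset of $X$. 1. There is one and only one structure of manifold with corners on $X$ that is admissible for all tubular maps over open subsets of $W$; it is Hausdorff and second countable. It is independent of the choice of tubular map: if $T$ is any tubular map of $W$, then every structure on $X$ that is admissible for $T$ coincides with it, i.e. the identity of $X$ is a diffeomorphism between the two. 2. With this structure $X$ is a manifold with corners of codimension two: no point has depth (number of vanishing coordinates in a chart) more than $2$, and the points of depth $2$ are those of $p^{-1}(\partial Y)\cap\mathcal S^{10}$. The pair of faces $(p^{-1}(\partial Y),\mathcal S^{10})$ makes $X$ a $\langle2\rangle$-manifold. More generally, if $\partial Y=\partial_1Y\sqcup\dots\sqcup\partial_mY$ with closed $\partial_iY$, then $X$ is a manifold with faces, the sets $p^{-1}(\partial_1Y),\dots,p^{-1}(\partial_mY),\mathcal S^{10}$ are faces of $X$ whose union is $\partial X$, and the intersection of any two of them is a face of both. 3. If the circle acts smoothly on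 $Y$ and $W$ is invariant, then the action on $Y\setminus W$ and the action $g\cdot\mathbb R_{>0}[v]=\mathbb R_{>0}[dg\,v]$ on $\mathcal S^{10}$ form a smooth circle action on $X$, for which $p$ is equivariant, $\mathcal S^{10}$ is invariant, and each $p^{-1}(\partial_iY)$ is invariant whenever all $\partial_iY$ are; so $X$ is then an $S^1$-manifold with corners. -/

import Mathlib

open Set Filter Topology Bundle Manifold
open scoped Manifold ContDiff

noncomputable section

namespace M5

/-! ### Diffeomorphisms out of a quotient of a manifold -/

/-- Let `Z` be a quotient manifold of a part `D` of the manifold `M`, with quotient map the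
submersion `q : D → Z`.  A map out of `Z` is smooth iff its composition with `q` is smooth, and a
map into `Z` is smooth iff it lifts, locally, to a smooth map into `M` with values in `D`.  With
these two rules this predicate says that `f` restricts to a diffeomorphism of `U ⊆ Z` onto an open
subset of `X`.  For `D = univ` and `Z = M` it is the usual notion. -/
structure IsDiffeoOn {E H E' H' M X Z : Type*}
    [NormedAddCommGroup E] [NormedSpace ℝ E] [TopologicalSpace H]
    [NormedAddCommGroup E'] [NormedSpace ℝ E'] [TopologicalSpace H']
    [TopologicalSpace M] [ChartedSpace H M] [TopologicalSpace X] [ChartedSpace H' X]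
    (I : ModelWithCorners ℝ E H) (J : ModelWithCorners ℝ E' H')
    {D : Set M} (q : D → Z) (f : Z → X) (U : Set Z) : Prop where
  /-- `f` is smooth on `U`: near each point, `f ∘ q` is (the restriction of) a smooth map. -/
  smooth : ∀ m : D, q m ∈ U → ∃ F : M → X,
    (∀ m' : D, q m' ∈ U → F m' = f (q m')) ∧
      ContMDiffWithinAt I J ∞ F {m' | ∃ h : m' ∈ D, q ⟨m', h⟩ ∈ U} m
  injOn : InjOn f U
  /-- The image of `U` is open and the inverse of `f` is smooth on it. -/
  smooth_inverse : ∀ z ∈ U, ∃ V ∈ 𝓝 (f z), ∃ s : X → M, ContMDiffOn J I ∞ s V ∧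
    ∀ x ∈ V, ∃ h : s x ∈ D, q ⟨s x, h⟩ ∈ U ∧ f (q ⟨s x, h⟩) = x

/-! ### The normal bundle, its sphere bundle and the half cylinder bundle -/

section Normal

variable {k d : ℕ} [NeZero k] [NeZero d]
  {W : Type*} [TopologicalSpace W] [ChartedSpace (EuclideanHalfSpace k) W]
  {Y : Type*} [TopologicalSpace Y] [ChartedSpace (EuclideanHalfSpace d) Y]
  [IsManifold (𝓡∂ d) ∞ Y]

/-- The restriction `TY|_W` of the tangent bundle of `Y` to `W`, with its smooth structure as a
pullback bundle. -/
abbrev RestrictedTangent (ι : C^∞⟮𝓡∂ k, W; 𝓡∂ d, Y⟯) : Type _ :=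
  TotalSpace (EuclideanSpace ℝ (Fin d)) (ι *ᵖ (TangentSpace (𝓡∂ d) : Y → Type))

/-- The fibre `T_w Y / T_w W` of the normal bundle. -/
abbrev NormalSpace (ι : C^∞⟮𝓡∂ k, W; 𝓡∂ d, Y⟯) (w : W) : Type :=
  TangentSpace (𝓡∂ d) (ι w) ⧸ (mfderiv (𝓡∂ k) (𝓡∂ d) ι w).range

/-- The class in the normal space of a tangent vector of `Y` at a point of `W`. -/
def normalClass (ι : C^∞⟮𝓡∂ k, W; 𝓡∂ d, Y⟯) (w : W) (v : TangentSpace (𝓡∂ d) (ι w)) :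
    NormalSpace ι w :=
  Submodule.Quotient.mk v

/-- The total space `N` of the normal bundle; its smooth structure is that of the quotient of
`TY|_W` by `TW`. -/
abbrev NormalBundle (ι : C^∞⟮𝓡∂ k, W; 𝓡∂ d, Y⟯) : Type _ := Σ w : W, NormalSpace ι w

/-- The zero section of the normal bundle, by which `W` is regarded as a subset of `N`. -/
def zeroSection (ι : C^∞⟮𝓡∂ k, W; 𝓡∂ d, Y⟯) (w : W) : NormalBundle ι := ⟨w, 0⟩

/-- The quotient map `TY|_W → N`. -/
def toNormal (ι : C^∞⟮𝓡∂ k, W; 𝓡∂ d, Y⟯) (e : RestrictedTangent ι) : NormalBundle ι :=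
  ⟨e.proj, normalClass ι e.proj e.snd⟩

/-- The half cylinder bundle `C₊`: pairs of a ray `ρ ∈ (N_w ∖ 0) / ℝ₊*` and a point `n` of the
closed half line `ρ ∪ {0}`.  The points with `n = 0` form the sphere bundle `(N ∖ W) / ℝ₊*`. -/
structure HalfCylinder (ι : C^∞⟮𝓡∂ k, W; 𝓡∂ d, Y⟯) where
  base : W
  ray : Module.Ray ℝ (NormalSpace ι base)
  point : NormalSpace ι base
  mem : ∀ h : point ≠ 0, rayOfNeZero ℝ point h = ray

/-- The canonical map `C₊ → N`. -/
def HalfCylinder.toNormalBundle {ι : C^∞⟮𝓡∂ k, W; 𝓡∂ d, Y⟯} (c : HalfCylinder ι) :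
    NormalBundle ι :=
  ⟨c.base, c.point⟩

/-- The pairs `(v, r)` with `v ∈ TY|_W` not tangent to `W` and `r ≥ 0`. -/
def cylinderDomain (ι : C^∞⟮𝓡∂ k, W; 𝓡∂ d, Y⟯) : Set (RestrictedTangent ι × ℝ) :=
  {m | normalClass ι m.1.proj m.1.snd ≠ 0 ∧ 0 ≤ m.2}

/-- The map `(v, r) ↦ (ℝ₊* [v], r [v])`, which exhibits `C₊` as a quotient manifold. -/
def toHalfCylinder (ι : C^∞⟮𝓡∂ k, W; 𝓡∂ d, Y⟯) (m : cylinderDomain ι) : HalfCylinder ι where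
  base := m.1.1.proj
  ray := rayOfNeZero ℝ (normalClass ι m.1.1.proj m.1.1.snd) m.2.1
  point := m.1.2 • normalClass ι m.1.1.proj m.1.1.snd
  mem h := by
    have hr : m.1.2 ≠ 0 := fun h0 => h (by rw [h0, zero_smul])
    rw [ray_eq_iff]
    exact SameRay.sameRay_nonneg_smul_left _ m.2.2

/-! ### Tubular maps -/

/-- `T` is a tubular map over the subset `V` of `W`: a diffeomorphism of the open subset `U` of the
normal bundle, which meets the zero section `W` in `V`, onto an open subset of `Y`, which meets `W`
in `V`, such that `T` is the inclusion on `V` and induces the identity on the normal bundle of `V`.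
For `V = univ` these are the tubular maps of `W`. -/
structure IsTubularMap (ι : C^∞⟮𝓡∂ k, W; 𝓡∂ d, Y⟯) (V : Set W) (U : Set (NormalBundle ι))
    (T : NormalBundle ι → Y) : Prop where
  isOpen : IsOpen (toNormal ι ⁻¹' U)
  diffeo : IsDiffeoOn ((𝓡∂ k).prod 𝓘(ℝ, EuclideanSpace ℝ (Fin d))) (𝓡∂ d)
    (D := univ) (fun e => toNormal ι e.1) T U
  zero_mem_iff : ∀ w, zeroSection ι w ∈ U ↔ w ∈ V
  mem_range_iff : ∀ w, ι w ∈ T '' U ↔ w ∈ V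
  map_zero : ∀ w ∈ V, T (zeroSection ι w) = ι w
  /-- The vertical derivative of `T` at the zero section in the direction `[v]` is `v`, up to
  vectors that are tangent to `W`. -/
  normal_deriv : ∀ w ∈ V, ∀ v : TangentSpace (𝓡∂ d) (ι w),
    normalClass ι w
      (mfderiv 𝓘(ℝ, ℝ) (𝓡∂ d) (fun t : ℝ => T ⟨w, t • normalClass ι w v⟩) 0 (1 : ℝ)) =
    normalClass ι w v

/-! ### The set `(Y ∖ W) ⊔ S` and structures on it -/

/-- The disjoint union of `Y ∖ W` and of the normal sphere bundle `S = (N ∖ W) / ℝ₊*`. -/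
inductive BlowUp (ι : C^∞⟮𝓡∂ k, W; 𝓡∂ d, Y⟯) : Type _
  | off (y : Y) (h : y ∉ range ι) : BlowUp ι
  | sphere (w : W) (ρ : Module.Ray ℝ (NormalSpace ι w)) : BlowUp ι

/-- The natural projection, the identity on `Y ∖ W` and the bundle projection on `S`. -/
def BlowUp.proj {ι : C^∞⟮𝓡∂ k, W; 𝓡∂ d, Y⟯} : BlowUp ι → Y
  | .off y _ => y
  | .sphere w _ => ι w

/-- The subset `S`. -/
def sphereBundle (ι : C^∞⟮𝓡∂ k, W; 𝓡∂ d, Y⟯) : Set (BlowUp ι) :=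
  {x | ∃ w ρ, x = .sphere w ρ}

open Classical in
/-- The map `T' : C₊ → (Y ∖ W) ⊔ S` induced by `T`, which sends a point of `S` to itself and any
other point `n` to `T n`. -/
def inducedMap (ι : C^∞⟮𝓡∂ k, W; 𝓡∂ d, Y⟯) (T : NormalBundle ι → Y) (c : HalfCylinder ι) :
    BlowUp ι :=
  if h : T c.toNormalBundle ∈ range ι then .sphere c.base c.ray else .off (T c.toNormalBundle) h

end Normal

/-- A structure of smooth manifold with corners of dimension `n` on a set `X`: a topology and a
smooth atlas of charts with values in `[0, ∞)ⁿ`. -/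
structure CornerStructure (n : ℕ) (X : Type*) where
  top : TopologicalSpace X
  charts : ChartedSpace (EuclideanQuadrant n) X
  smooth : IsManifold (modelWithCornersEuclideanQuadrant n) ∞ X

namespace CornerStructure

section General

variable {n : ℕ} {X : Type*}

/-- The set `X` equipped with the structure `A`. -/
def Space (_A : CornerStructure n X) : Type _ := X

instance (A : CornerStructure n X) : TopologicalSpace A.Space := A.top

instance (A : CornerStructure n X) : ChartedSpace (EuclideanQuadrant n) A.Space := A.charts

instance (A : CornerStructure n X) :
    IsManifold (modelWithCornersEuclideanQuadrant n) ∞ A.Space := A.smooth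

/-- The identity map of `X` is a diffeomorphism between the two structures. -/
def Same (A B : CornerStructure n X) : Prop :=
  ContMDiff (modelWithCornersEuclideanQuadrant n) (modelWithCornersEuclideanQuadrant n) ∞
      (fun x : A.Space => (show B.Space from x)) ∧
    ContMDiff (modelWithCornersEuclideanQuadrant n) (modelWithCornersEuclideanQuadrant n) ∞
      (fun x : B.Space => (show A.Space from x))

/-- The number of coordinates of `x` that vanish in a chart at `x`. -/
def depth (A : CornerStructure n X) (x : A.Space) : ℕ :=
  {i : Fin n | extChartAt (modelWithCornersEuclideanQuadrant n) x x i = 0}.ncard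

/-- The connected faces of `A`: the closures of the components of the points of depth one. -/
def IsConnectedFace (A : CornerStructure n X) (F : Set A.Space) : Prop :=
  ∃ x, A.depth x = 1 ∧ F = closure (connectedComponentIn {y | A.depth y = 1} x)

/-- A face is a disjoint union of connected faces. -/
def IsFace (A : CornerStructure n X) (F : Set A.Space) : Prop :=
  ∃ 𝒢 : Set (Set A.Space), (∀ G ∈ 𝒢, A.IsConnectedFace G) ∧ 𝒢.PairwiseDisjoint id ∧ F = ⋃₀ 𝒢

/-- `G` is a face of the face `F`, the latter regarded as a manifold with corners of one dimension
less: the points of depth one of `F` are the points of `F` of depth two in `X`. -/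
def IsFaceOf (A : CornerStructure n X) (G F : Set A.Space) : Prop :=
  ∃ 𝒢 : Set (Set A.Space),
    (∀ K ∈ 𝒢, ∃ x ∈ F, A.depth x = 2 ∧
      K = closure (connectedComponentIn (F ∩ {y | A.depth y = 2}) x)) ∧
    𝒢.PairwiseDisjoint id ∧ G = ⋃₀ 𝒢

/-- `A` is a manifold with faces: every point `x` lies in exactly `depth x` connected faces. -/
def IsManifoldWithFaces (A : CornerStructure n X) : Prop :=
  ∀ x, {F | A.IsConnectedFace F ∧ x ∈ F}.encard = A.depth x

/-- `A` together with the tuple `F 0, …, F (m - 1)` is an `⟨m⟩`-manifold. -/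
structure IsAngleManifold (A : CornerStructure n X) {m : ℕ} (F : Fin m → Set A.Space) : Prop where
  withFaces : A.IsManifoldWithFaces
  isFace : ∀ i, A.IsFace (F i)
  boundary : (modelWithCornersEuclideanQuadrant n).boundary A.Space = ⋃ i, F i
  inter : ∀ i j, i ≠ j → A.IsFaceOf (F i ∩ F j) (F i) ∧ A.IsFaceOf (F i ∩ F j) (F j)

end General

section OnBlowUp

variable {k d : ℕ} [NeZero k] [NeZero d]
  {W : Type*} [TopologicalSpace W] [ChartedSpace (EuclideanHalfSpace k) W]
  {Y : Type*} [TopologicalSpace Y] [ChartedSpace (EuclideanHalfSpace d) Y]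
  [IsManifold (𝓡∂ d) ∞ Y] {ι : C^∞⟮𝓡∂ k, W; 𝓡∂ d, Y⟯}

/-- The projection to `Y`, as a map on `(Y ∖ W) ⊔ S` with the structure `A`. -/
def proj (A : CornerStructure d (BlowUp ι)) (x : A.Space) : Y := BlowUp.proj x

/-- The sphere bundle, as a subset of `(Y ∖ W) ⊔ S` with the structure `A`. -/
def sphere (A : CornerStructure d (BlowUp ι)) : Set A.Space := sphereBundle ι

/-- `A` induces the given structure on `Y ∖ W`: this is an open subset of `A`, on which the
projection to `Y` is a diffeomorphism onto the open subset `Y ∖ W` of `Y`. -/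
def ExtendsComplement (A : CornerStructure d (BlowUp ι)) : Prop :=
  IsOpen A.sphereᶜ ∧
    IsDiffeoOn (modelWithCornersEuclideanQuadrant d) (𝓡∂ d) (D := univ)
      (fun x => (x.1 : A.Space)) A.proj A.sphereᶜ

/-- The map `T' : C₊U → (Y ∖ W) ⊔ S` induced by `T` is a diffeomorphism onto an open subset of
`A`; here `C₊U` is the inverse image of `U` in `C₊`. -/
def Adapted (A : CornerStructure d (BlowUp ι)) (U : Set (NormalBundle ι))
    (T : NormalBundle ι → Y) : Prop :=
  IsDiffeoOn (((𝓡∂ k).prod 𝓘(ℝ, EuclideanSpace ℝ (Fin d))).prod 𝓘(ℝ, ℝ))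
    (modelWithCornersEuclideanQuadrant d) (D := cylinderDomain ι) (toHalfCylinder ι)
    (fun c => (show A.Space from inducedMap ι T c)) (HalfCylinder.toNormalBundle ⁻¹' U)

/-- A smooth action of the circle on `A` that is the given action on `Y ∖ W` and on `S` is the
action `g • ℝ₊*[v] = ℝ₊*[dg v]` of the differentials on normal rays. -/
structure IsLiftedAction [MulAction Circle Y] (A : CornerStructure d (BlowUp ι))
    [MulAction Circle A.Space] : Prop where
  smooth : ContMDiff ((𝓡 1).prod (modelWithCornersEuclideanQuadrant d))
    (modelWithCornersEuclideanQuadrant d) ∞ (fun z : Circle × A.Space => z.1 • z.2)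
  proj_smul : ∀ (g : Circle) (x : A.Space), A.proj (g • x) = g • A.proj x
  smul_sphere : ∀ (g : Circle) (w w' : W) (_ : ι w' = g • ι w) (v : TangentSpace (𝓡∂ d) (ι w))
    (hv : normalClass ι w v ≠ 0),
    ∃ hv' : normalClass ι w'
        (mfderiv (𝓡∂ d) (𝓡∂ d) (fun y : Y => g • y) (ι w) v) ≠ 0,
      g • (show A.Space from BlowUp.sphere w (rayOfNeZero ℝ _ hv)) =
        (show A.Space from BlowUp.sphere w' (rayOfNeZero ℝ _ hv'))

end OnBlowUp

end CornerStructure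

/-- The closed sets `P 0, …, P (m - 1)` decompose the boundary of `Y` into disjoint parts, each of
which is then a union of boundary components. -/
structure IsBoundaryDecomposition {d : ℕ} [NeZero d] (Y : Type*) [TopologicalSpace Y]
    [ChartedSpace (EuclideanHalfSpace d) Y] {m : ℕ} (P : Fin m → Set Y) : Prop where
  isClosed : ∀ i, IsClosed (P i)
  disjoint : Pairwise fun i j => Disjoint (P i) (P j)
  union : (𝓡∂ d).boundary Y = ⋃ i, P i

end M5

end

/-!
Why the theorem holds.

Since `W` is neat, every point of `W` has a *slice chart* `e` of `Y`: a chart in which `W` is the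
set of points whose last `d - k` coordinates, the normal coordinates, vanish, while the coordinate
that bounds the half space is not one of them (`exists_isSliceChart`).  The differential of the
normal coordinates identifies the fibres of the normal bundle with `ℝ^(d - k)`.  Hence each point of
the blow-up over such a chart has a *direction*, a nonzero vector up to positive factors: the normal
coordinates off `W`, and the coordinates of the normal ray on the sphere bundle.  A point is
determined by its projection and its direction (`eq_of_direction`).

The structure is found by first saying which maps into the blow-up are smooth: those whose
projection to `Y` is smooth and whose direction is represented by a smooth nowhere vanishing
function (`SmoothLift`).  That the second condition does not depend on the slice chart is the one
analytic point.  If `h` represents the direction, the normal coordinates are `r • h` with a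
smooth `r ≥ 0`, and a change of charts, or more generally a smooth family of maps preserving `W`,
takes `r • h` to a function of `r` that vanishes for `r = 0`.  By Hadamard's lemma
(`contMDiffAt_dslope`) this is `r • h'` with a smooth `h'`, whose value at `r = 0` is given by the
differential, that is, by the action on normal rays (`HasSmoothDirection.map`).  The charts are
polar coordinates: on the set where the `i`-th entry of the direction has a given sign, one uses the
absolute value of the `i`-th normal coordinate, the quotients of the other ones by it, and the
tangential coordinates.  These charts and their inverses are compatible with the notion of
smoothness above, so they form a smooth atlas whose smooth maps are exactly the smooth lifts
(`contMDiffWithinAt_blowUp_of_smoothLift`, `smoothLift_id`).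

A tubular map `T` induces a smooth map from the half cylinder bundle for the same reason: in normal
coordinates `T` is divisible by the radius.  Its inverse is smooth because `T⁻¹` composed with the
normal component is divisible by the radius too (`adapted_blowUp`).  Conversely a structure that
extends the one of `Y ∖ W` and for which the induced map of a tubular map is a diffeomorphism is
determined near the image of the latter, so that two structures coincide as soon as they share
tubular maps over a neighbourhood of each point of `W` (`same_of_adapted`); slice charts give such
tubular maps (`isTubularMap_chartTubularMap`).

In the charts of the blow-up the coordinate with index zero defines the inverse image of `∂Y`, a
second one defines the sphere bundle, and no other coordinate vanishes anywhere.  This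
gives the depth.  For the faces, the points of depth one of a hypersurface form, in a chart, a
convex set near each point of that hypersurface, so that exactly one connected face inside it passes
through the point (`IsCornerSystem.existsUnique_connectedFace`).  Finally a circle action lifts by
the action of its differentials on normal rays, and `HasSmoothDirection.map` shows that the lift is
smooth (`isLiftedAction_circleAction`).
-/

set_option linter.unusedSectionVars false

noncomputable section

namespace M5

/-! ### Dividing a smooth function by a coordinate -/

section Hadamard

universe u

/-- Differentiation under the integral sign over `[0, 1]`, on a convex set with unique
derivatives instead of an open one. -/
theorem contDiffOn_integral_unitInterval {E : Type u} [NormedAddCommGroup E] [NormedSpace ℝ E]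
    {s : Set E} (hs : Convex ℝ s) (hu : UniqueDiffOn ℝ s) (n : ℕ) :
    ∀ {F : Type u} [NormedAddCommGroup F] [NormedSpace ℝ F] [CompleteSpace F] {K : E × ℝ → F},
      ContDiffOn ℝ n K (s ×ˢ Icc 0 1) →
        ContDiffOn ℝ n (fun x => ∫ t in (0 : ℝ)..1, K (x, t)) s := by
  have hint : ∀ {F : Type u} [NormedAddCommGroup F] [NormedSpace ℝ F] {K : E × ℝ → F},
      ContinuousOn K (s ×ˢ Icc 0 1) → ∀ x ∈ s,
        IntervalIntegrable (fun t => K (x, t)) MeasureTheory.volume 0 1 := by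
    intro F _ _ K hK x hx
    apply ContinuousOn.intervalIntegrable
    rw [uIcc_of_le zero_le_one]
    exact hK.comp (by fun_prop) fun t ht => ⟨hx, ht⟩
  have hclose : ∀ {F : Type u} [NormedAddCommGroup F] [NormedSpace ℝ F] {K : E × ℝ → F},
      ContinuousOn K (s ×ˢ Icc 0 1) → ∀ x ∈ s, ∀ ε > 0, ∀ᶠ y in 𝓝[s] x, ∀ t ∈ Icc (0 : ℝ) 1,
        ‖K (y, t) - K (x, t)‖ ≤ ε := by
    intro F _ _ K hK x hx ε hε
    obtain ⟨v, hv, h⟩ := isCompact_Icc.mem_uniformity_of_prod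
      (f := fun y t => K (y, t)) hK hx (Metric.dist_mem_uniformity hε)
    filter_upwards [hv] with y hy t ht
    have := h y hy t ht
    simp only [mem_ofPred_eq, dist_eq_norm] at this
    exact this.le
  induction n with
  | zero =>
    intro F _ _ _ K hK
    simp only [Nat.cast_zero, contDiffOn_zero] at hK ⊢
    intro x hx
    rw [ContinuousWithinAt, Metric.tendsto_nhds]
    intro ε hε
    filter_upwards [hclose hK x hx (ε / 2) (half_pos hε), self_mem_nhdsWithin] with y hy hys
    rw [dist_eq_norm, ← intervalIntegral.integral_sub (hint hK y hys) (hint hK x hx)]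
    refine (intervalIntegral.norm_integral_le_of_norm_le_const (C := ε / 2) fun t ht => ?_).trans_lt
      (by simpa using hε)
    rw [uIoc_of_le zero_le_one] at ht
    exact hy t ⟨ht.1.le, ht.2⟩
  | succ n ih =>
    intro F _ _ _ K hK
    have hu' : UniqueDiffOn ℝ (s ×ˢ Icc (0 : ℝ) 1) := hu.prod (uniqueDiffOn_Icc zero_lt_one)
    rw [Nat.cast_succ] at hK ⊢
    set D : E × ℝ → E →L[ℝ] F := fun z =>
      (fderivWithin ℝ K (s ×ˢ Icc 0 1) z).comp (ContinuousLinearMap.inl ℝ E ℝ) with hD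
    have hDs : ContDiffOn ℝ n D (s ×ˢ Icc 0 1) :=
      (hK.fderivWithin hu' le_rfl).clm_comp contDiffOn_const
    have hDer : ∀ t ∈ Icc (0 : ℝ) 1, ∀ x ∈ s,
        HasFDerivWithinAt (fun y => K (y, t)) (D (x, t)) s x := by
      intro t ht x hx
      have h1 := ((hK.differentiableOn (by simp)) (x, t) ⟨hx, ht⟩).hasFDerivWithinAt
      have h2 : HasFDerivWithinAt (fun y : E => (y, t)) (ContinuousLinearMap.inl ℝ E ℝ) s x :=
        (hasFDerivAt_prodMk_left x t).hasFDerivWithinAt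
      exact h1.comp (t := s ×ˢ Icc 0 1) x h2 fun y hy => ⟨hy, ht⟩
    rw [contDiffOn_succ_iff_hasFDerivWithinAt_of_uniqueDiffOn hu]
    refine ⟨by simp, fun x => ∫ t in (0 : ℝ)..1, D (x, t), ih hDs, fun x hx => ?_⟩
    rw [hasFDerivWithinAt_iff_isLittleO, Asymptotics.isLittleO_iff]
    intro ε hε
    -- The remainder is bounded by the mean value inequality, uniformly in `t` because `[0, 1]` is
    -- compact.
    obtain ⟨δ, hδ, hball⟩ := Metric.mem_nhdsWithin_iff.1
      (hclose hDs.continuousOn x hx ε hε)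
    have hmem : Metric.ball x δ ∩ s ∈ 𝓝[s] x :=
      inter_mem (mem_nhdsWithin_of_mem_nhds (Metric.ball_mem_nhds x hδ)) self_mem_nhdsWithin
    filter_upwards [hmem] with y hy
    rw [← intervalIntegral.integral_sub (hint hK.continuousOn y hy.2) (hint hK.continuousOn x hx),
      ContinuousLinearMap.intervalIntegral_apply (hint hDs.continuousOn x hx),
      ← intervalIntegral.integral_sub
        ((hint hK.continuousOn y hy.2).sub (hint hK.continuousOn x hx))
        (hint (hDs.clm_apply contDiffOn_const).continuousOn x hx)]
    refine (intervalIntegral.norm_integral_le_of_norm_le_const (C := ε * ‖y - x‖)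
      fun t ht => ?_).trans (by simp)
    rw [uIoc_of_le zero_le_one] at ht
    have ht' : t ∈ Icc (0 : ℝ) 1 := ⟨ht.1.le, ht.2⟩
    exact Convex.norm_image_sub_le_of_norm_hasFDerivWithin_le' (s := Metric.ball x δ ∩ s)
      (f := fun y => K (y, t)) (f' := fun y => D (y, t))
      (fun z hz => (hDer t ht' z hz.2).mono inter_subset_right)
      (fun z hz => hball hz t ht') ((convex_ball x δ).inter hs) ⟨Metric.mem_ball_self hδ, hx⟩ hy

/-- Hadamard's lemma on a convex set times a line: the difference quotient is the smooth function
`∫₀¹ ∂g/∂r (x, t r) dt`. -/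
theorem contDiffWithinAt_dslope {E F : Type u} [NormedAddCommGroup E] [NormedSpace ℝ E]
    [NormedAddCommGroup F] [NormedSpace ℝ F] [CompleteSpace F]
    {s : Set E} (hs : Convex ℝ s) (hu : UniqueDiffOn ℝ s) {g : E × ℝ → F} {p : E} (hp : p ∈ s)
    {n : ℕ} (hg : ContDiffWithinAt ℝ (n + 1) g (s ×ˢ univ) (p, 0)) :
    ContDiffWithinAt ℝ n (fun z : E × ℝ => dslope (fun r => g (z.1, r)) 0 z.2)
      (s ×ˢ univ) (p, 0) := by
  obtain ⟨u, huo, hpu, hgu⟩ := hg.contDiffOn' le_rfl (by simp)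
  rw [insert_eq_of_mem (show (p, (0 : ℝ)) ∈ s ×ˢ univ from ⟨hp, mem_univ _⟩)] at hgu
  obtain ⟨ε, hε, hball⟩ := Metric.mem_nhds_iff.1 (huo.mem_nhds hpu)
  set s' := s ∩ Metric.ball p ε with hs'
  have hs'c : Convex ℝ s' := hs.inter (convex_ball _ _)
  have hs'u : UniqueDiffOn ℝ s' := hu.inter Metric.isOpen_ball
  set S : Set (E × ℝ) := s' ×ˢ Metric.ball (0 : ℝ) ε with hS
  have hSc : Convex ℝ S := hs'c.prod (convex_ball _ _)
  have hSu : UniqueDiffOn ℝ S := hs'u.prod Metric.isOpen_ball.uniqueDiffOn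
  have hgS : ContDiffOn ℝ (n + 1) g S := hgu.mono fun z hz =>
    ⟨⟨hz.1.1, mem_univ _⟩, hball (by
      rw [← ball_prod_same]; exact ⟨hz.1.2, hz.2⟩)⟩
  have hpS : (p, (0 : ℝ)) ∈ S := ⟨⟨hp, Metric.mem_ball_self hε⟩, Metric.mem_ball_self hε⟩
  have hstar : ∀ z ∈ S, ∀ t ∈ Icc (0 : ℝ) 1, (z.1, t * z.2) ∈ S := by
    intro z hz t ht
    refine ⟨hz.1, ?_⟩
    have h2 := hz.2
    rw [mem_ball_zero_iff, Real.norm_eq_abs] at h2 ⊢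
    rw [abs_mul, abs_of_nonneg ht.1]
    exact (mul_le_of_le_one_left (abs_nonneg _) ht.2).trans_lt h2
  set k : E × ℝ → F := fun z => fderivWithin ℝ g S z (0, 1) with hk
  have hks : ContDiffOn ℝ n k S := (hgS.fderivWithin hSu le_rfl).clm_apply contDiffOn_const
  have hder : ∀ z ∈ S, HasDerivAt (fun r => g (z.1, r)) (k z) z.2 := by
    intro z hz
    have h1 := ((hgS.differentiableOn (by simp)) z hz).hasFDerivWithinAt
    have h2 : HasFDerivWithinAt (fun r : ℝ => (z.1, r)) (ContinuousLinearMap.inr ℝ E ℝ)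
        (Metric.ball (0 : ℝ) ε) z.2 := (hasFDerivAt_prodMk_right z.1 z.2).hasFDerivWithinAt
    have h3 := h1.comp (t := S) z.2 h2 fun r hr => ⟨hz.1, hr⟩
    have h4 := h3.hasFDerivAt (Metric.isOpen_ball.mem_nhds hz.2)
    simpa [hk] using! h4.hasDerivAt
  have hI : ContDiffOn ℝ n (fun z => ∫ t in (0 : ℝ)..1, k (z.1, t * z.2)) S := by
    refine contDiffOn_integral_unitInterval hSc hSu n (K := fun q => k (q.1.1, q.2 * q.1.2)) ?_
    exact hks.comp (by fun_prop) fun q hq => hstar q.1 hq.1 q.2 hq.2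
  have heq : EqOn (fun z : E × ℝ => dslope (fun r => g (z.1, r)) 0 z.2)
      (fun z => ∫ t in (0 : ℝ)..1, k (z.1, t * z.2)) S := by
    intro z hz
    rcases eq_or_ne z.2 0 with h0 | h0
    · have := (hder z hz).deriv
      rw [h0] at this
      have hz' : (z.1, (0 : ℝ)) = z := by rw [← h0]
      simp only [h0, dslope_same, mul_zero, hz', intervalIntegral.integral_const]
      simpa using this
    · have hint : ∫ t in (0 : ℝ)..1, z.2 • k (z.1, t * z.2) = g (z.1, z.2) - g (z.1, 0) := by
        have := intervalIntegral.integral_eq_sub_of_hasDerivAt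
          (f := fun t : ℝ => g (z.1, t * z.2)) (f' := fun t => z.2 • k (z.1, t * z.2))
          (a := 0) (b := 1) (fun t ht => ?_) ?_
        · simpa using this
        · rw [uIcc_of_le zero_le_one] at ht
          have h1 := hder _ (hstar z hz t ht)
          simpa [Function.comp_def] using! h1.scomp t ((hasDerivAt_id t).mul_const z.2)
        · apply ContinuousOn.intervalIntegrable
          rw [uIcc_of_le zero_le_one]
          refine continuousOn_const.smul (hks.continuousOn.comp (by fun_prop) ?_)
          exact fun t ht => hstar z hz t ht
      rw [intervalIntegral.integral_smul] at hint
      simp only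
      rw [dslope_of_ne _ h0, slope_def_module, sub_zero, ← hint, inv_smul_smul₀ h0]
  refine ((hI.congr heq) _ hpS).mono_of_mem_nhdsWithin ?_
  rw [mem_nhdsWithin]
  refine ⟨Metric.ball p ε ×ˢ Metric.ball 0 ε, Metric.isOpen_ball.prod Metric.isOpen_ball,
    ⟨Metric.mem_ball_self hε, Metric.mem_ball_self hε⟩, fun z hz => ?_⟩
  exact ⟨⟨hz.2.1, hz.1.1⟩, hz.1.2⟩

/-- Hadamard's lemma: if `g` is smooth near `(m, 0)`, then so is the function equal to
`(g (m', r) - g (m', 0)) / r` for `r ≠ 0` and to `∂g/∂r (m', 0)` for `r = 0`.  The manifold may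
have boundary and corners. -/
theorem contMDiffAt_dslope {E F : Type u} [NormedAddCommGroup E] [NormedSpace ℝ E]
    [NormedAddCommGroup F] [NormedSpace ℝ F] [CompleteSpace F] {H M : Type*} [TopologicalSpace H]
    [TopologicalSpace M] [ChartedSpace H M] {I : ModelWithCorners ℝ E H} {g : M × ℝ → F} {m : M}
    (hg : ContMDiffAt (I.prod 𝓘(ℝ, ℝ)) 𝓘(ℝ, F) ∞ g (m, 0)) :
    ContMDiffAt (I.prod 𝓘(ℝ, ℝ)) 𝓘(ℝ, F) ∞
      (fun z : M × ℝ => dslope (fun r => g (z.1, r)) 0 z.2) (m, 0) := by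
  have key : ContDiffWithinAt ℝ ∞
      ((fun z : M × ℝ => dslope (fun r => g (z.1, r)) 0 z.2) ∘
        (extChartAt (I.prod 𝓘(ℝ, ℝ)) (m, (0 : ℝ))).symm) (range (I.prod 𝓘(ℝ, ℝ)))
      (extChartAt (I.prod 𝓘(ℝ, ℝ)) (m, (0 : ℝ)) (m, 0)) := by
    have h := (contMDiffAt_iff.1 hg).2
    have hr : range (I.prod 𝓘(ℝ, ℝ)) = range I ×ˢ (univ : Set ℝ) := by
      rw [modelWithCorners_prod_coe, range_prodMap]; simp
    have hp : extChartAt (I.prod 𝓘(ℝ, ℝ)) (m, (0 : ℝ)) (m, 0) = (extChartAt I m m, 0) := by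
      simp [mfld_simps]; rfl
    rw [hr, hp] at h ⊢
    refine contDiffWithinAt_infty.2 fun n => ?_
    have h' := contDiffWithinAt_infty.1 h (n + 1)
    have := contDiffWithinAt_dslope I.convex_range I.uniqueDiffOn
      (mem_range_self (chartAt H m m)) (by exact_mod_cast h')
    exact this
  refine contMDiffAt_iff.2 ⟨?_, key⟩
  have hc := key.continuousWithinAt.comp (f := extChartAt (I.prod 𝓘(ℝ, ℝ)) (m, (0 : ℝ)))
    (s := univ) (continuousAt_extChartAt (I := I.prod 𝓘(ℝ, ℝ)) (m, (0 : ℝ))).continuousWithinAt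
    (fun z _ => mem_range_self _)
  rw [continuousWithinAt_univ] at hc
  refine hc.congr ?_
  filter_upwards [extChartAt_source_mem_nhds (I := I.prod 𝓘(ℝ, ℝ)) (m, (0 : ℝ))] with z hz
  simp only [Function.comp_apply]
  rw [(extChartAt (I.prod 𝓘(ℝ, ℝ)) (m, (0 : ℝ))).left_inv hz]

theorem eq_add_smul_dslope {F : Type*} [NormedAddCommGroup F] [NormedSpace ℝ F] (f : ℝ → F)
    (r : ℝ) : f r = f 0 + r • dslope f 0 r := by
  have := sub_smul_dslope f 0 r
  rw [sub_zero] at this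
  rw [this]; abel

end Hadamard

/-! ### Smooth maps into model spaces -/

section Model

variable {E H E' H' M : Type*} [NormedAddCommGroup E] [NormedSpace ℝ E] [TopologicalSpace H]
  [NormedAddCommGroup E'] [NormedSpace ℝ E'] [TopologicalSpace H'] [TopologicalSpace M]
  [ChartedSpace H M] {I : ModelWithCorners ℝ E H} {J : ModelWithCorners ℝ E' H'} {n : ℕ∞ω}

/-- Smoothness of a map into a model space is smoothness as a map into the surrounding vector
space. -/
theorem contMDiffWithinAt_model_iff {f : M → H'} {s : Set M} {x : M} :
    ContMDiffWithinAt I J n f s x ↔ ContMDiffWithinAt I 𝓘(ℝ, E') n (fun m => J (f m)) s x := by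
  rw [contMDiffWithinAt_iff, contMDiffWithinAt_iff]
  refine and_congr ⟨fun h => J.continuousAt.comp_continuousWithinAt h, fun h => ?_⟩ Iff.rfl
  have := J.continuous_symm.continuousAt.comp_continuousWithinAt h
  simpa [Function.comp_def] using this

theorem contMDiffWithinAt_euclideanSpace_iff {ι' : Type*} [Fintype ι']
    {f : M → EuclideanSpace ℝ ι'} {s : Set M} {x : M} :
    ContMDiffWithinAt I 𝓘(ℝ, EuclideanSpace ℝ ι') n f s x ↔
      ∀ i, ContMDiffWithinAt I 𝓘(ℝ, ℝ) n (fun m => f m i) s x := by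
  let L := PiLp.continuousLinearEquiv 2 ℝ (fun _ : ι' => ℝ)
  rw [← contMDiffWithinAt_pi_space (φ := fun m i => f m i)]
  constructor
  · intro h
    exact (L.contDiff.contMDiff.contMDiffAt).comp_contMDiffWithinAt x h
  · intro h
    exact (L.symm.contDiff.contMDiff.contMDiffAt).comp_contMDiffWithinAt x h

theorem contMDiffWithinAt_halfSpace_iff {d : ℕ} [NeZero d] {f : M → EuclideanHalfSpace d}
    {s : Set M} {x : M} : ContMDiffWithinAt I (𝓡∂ d) n f s x ↔
      ∀ i, ContMDiffWithinAt I 𝓘(ℝ, ℝ) n (fun m => (f m).1 i) s x :=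
  contMDiffWithinAt_model_iff.trans contMDiffWithinAt_euclideanSpace_iff

theorem contMDiffWithinAt_quadrant_iff {d : ℕ} {f : M → EuclideanQuadrant d}
    {s : Set M} {x : M} : ContMDiffWithinAt I (modelWithCornersEuclideanQuadrant d) n f s x ↔
      ∀ i, ContMDiffWithinAt I 𝓘(ℝ, ℝ) n (fun m => (f m).1 i) s x :=
  contMDiffWithinAt_model_iff.trans contMDiffWithinAt_euclideanSpace_iff

theorem contMDiff_halfSpace_apply {d : ℕ} [NeZero d] (i : Fin d) :
    ContMDiff (𝓡∂ d) 𝓘(ℝ, ℝ) n (fun z : EuclideanHalfSpace d => z.1 i) := fun _ =>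
  contMDiffWithinAt_halfSpace_iff.1 contMDiffWithinAt_id i

theorem contMDiff_quadrant_apply {d : ℕ} (i : Fin d) :
    ContMDiff (modelWithCornersEuclideanQuadrant d) 𝓘(ℝ, ℝ) n
      (fun z : EuclideanQuadrant d => z.1 i) := fun _ =>
  contMDiffWithinAt_quadrant_iff.1 contMDiffWithinAt_id i

end Model

/-! ### Normal coordinates in a chart -/

/-- The last `d - k` coordinates of `ℝᵈ`. -/
abbrev Normal (k d : ℕ) : Type := {j : Fin d // k ≤ (j : ℕ)} → ℝ

section Coordinates

variable {k d : ℕ} [NeZero k] [NeZero d]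

/-- The last `d - k` coordinates of a point of the half space. -/
def normalPart (k : ℕ) {d : ℕ} [NeZero d] (z : EuclideanHalfSpace d) : Normal k d :=
  fun j => z.1 j

theorem not_le_zero_index : ¬ k ≤ ((0 : Fin d) : ℕ) := by
  have := NeZero.pos k
  simp; omega

/-- Translation of a point of the half space in the direction of the last `d - k` coordinates. -/
def addNormal (z : EuclideanHalfSpace d) (h : Normal k d) : EuclideanHalfSpace d :=
  ⟨WithLp.toLp 2 fun j => if hj : k ≤ (j : ℕ) then z.1 j + h ⟨j, hj⟩ else z.1 j, by
    simp only [not_le_zero_index (k := k), dite_false]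
    exact z.2⟩

theorem addNormal_apply_of_le (z : EuclideanHalfSpace d) (h : Normal k d) {j : Fin d}
    (hj : k ≤ (j : ℕ)) : (addNormal z h).1 j = z.1 j + h ⟨j, hj⟩ := by
  simp [addNormal, hj]

theorem addNormal_apply_of_not_le (z : EuclideanHalfSpace d) (h : Normal k d) {j : Fin d}
    (hj : ¬ k ≤ (j : ℕ)) : (addNormal z h).1 j = z.1 j := by
  simp [addNormal, hj]

@[simp]
theorem normalPart_addNormal (z : EuclideanHalfSpace d) (h : Normal k d) :
    normalPart k (addNormal z h) = normalPart k z + h := by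
  ext j
  exact addNormal_apply_of_le z h j.2

@[simp]
theorem addNormal_zero (z : EuclideanHalfSpace d) : addNormal z (0 : Normal k d) = z := by
  ext j
  by_cases hj : k ≤ (j : ℕ)
  · simp [addNormal_apply_of_le z _ hj]
  · simp [addNormal_apply_of_not_le z _ hj]

@[simp]
theorem addNormal_addNormal (z : EuclideanHalfSpace d) (h h' : Normal k d) :
    addNormal (addNormal z h) h' = addNormal z (h + h') := by
  ext j
  by_cases hj : k ≤ (j : ℕ)
  · simp [addNormal_apply_of_le _ _ hj, add_assoc]
  · simp [addNormal_apply_of_not_le _ _ hj]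

theorem contMDiff_normalPart {n : ℕ∞ω} :
    ContMDiff (𝓡∂ d) 𝓘(ℝ, Normal k d) n (normalPart k (d := d)) :=
  contMDiff_pi_space.2 fun j => contMDiff_halfSpace_apply j.1

theorem contMDiff_addNormal {n : ℕ∞ω} :
    ContMDiff ((𝓡∂ d).prod 𝓘(ℝ, Normal k d)) (𝓡∂ d) n
      (fun p : EuclideanHalfSpace d × Normal k d => addNormal p.1 p.2) := by
  intro p
  refine contMDiffWithinAt_halfSpace_iff.2 fun j => ?_
  have h1 : ContMDiff ((𝓡∂ d).prod 𝓘(ℝ, Normal k d)) 𝓘(ℝ, ℝ) n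
      (fun p : EuclideanHalfSpace d × Normal k d => p.1.1 j) :=
    (contMDiff_halfSpace_apply j).comp contMDiff_fst
  by_cases hj : k ≤ (j : ℕ)
  · have h2 : ContMDiff ((𝓡∂ d).prod 𝓘(ℝ, Normal k d)) 𝓘(ℝ, ℝ) n
        (fun p : EuclideanHalfSpace d × Normal k d => p.2 ⟨j, hj⟩) :=
      (contMDiff_pi_space (φ := fun p : EuclideanHalfSpace d × Normal k d => p.2)).1
        contMDiff_snd ⟨j, hj⟩
    simp only [addNormal_apply_of_le _ _ hj]
    exact (h1.add h2) p
  · simp only [addNormal_apply_of_not_le _ _ hj]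
    exact h1 p

variable {Y : Type*} [TopologicalSpace Y]

/-- The last `d - k` coordinates in the chart `e`. -/
def normalCoord (k : ℕ) {d : ℕ} [NeZero d] {Y : Type*} [TopologicalSpace Y]
    (e : OpenPartialHomeomorph Y (EuclideanHalfSpace d)) (y : Y) : Normal k d :=
  normalPart k (e y)

/-- Translation in the chart `e` by the last `d - k` coordinates. -/
def normalShift (e : OpenPartialHomeomorph Y (EuclideanHalfSpace d)) (y : Y) (h : Normal k d) : Y :=
  e.symm (addNormal (e y) h)

variable {e : OpenPartialHomeomorph Y (EuclideanHalfSpace d)} {y : Y}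

theorem normalShift_zero (hy : y ∈ e.source) : normalShift e y (0 : Normal k d) = y := by
  rw [normalShift, addNormal_zero, e.left_inv hy]

theorem normalShift_mem_source {h : Normal k d} (hh : addNormal (e y) h ∈ e.target) :
    normalShift e y h ∈ e.source := e.map_target hh

theorem normalCoord_normalShift {h : Normal k d} (hh : addNormal (e y) h ∈ e.target) :
    normalCoord k e (normalShift e y h) = normalCoord k e y + h := by
  rw [normalCoord, normalShift, e.right_inv hh, normalPart_addNormal, normalCoord]

theorem normalShift_normalShift {h h' : Normal k d} (hh : addNormal (e y) h ∈ e.target) :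
    normalShift e (normalShift e y h) h' = normalShift e y (h + h') := by
  rw [normalShift, normalShift, e.right_inv hh, addNormal_addNormal, normalShift]

variable [ChartedSpace (EuclideanHalfSpace d) Y] [IsManifold (𝓡∂ d) ∞ Y]

theorem contMDiffAt_normalCoord (he : e ∈ IsManifold.maximalAtlas (𝓡∂ d) ∞ Y)
    (hy : y ∈ e.source) : ContMDiffAt (𝓡∂ d) 𝓘(ℝ, Normal k d) ∞ (normalCoord k e) y :=
  contMDiff_normalPart.contMDiffAt.comp y (contMDiffAt_of_mem_maximalAtlas he hy)

theorem contMDiffAt_normalShift (he : e ∈ IsManifold.maximalAtlas (𝓡∂ d) ∞ Y)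
    {h : Normal k d} (hy : y ∈ e.source) (hh : addNormal (e y) h ∈ e.target) :
    ContMDiffAt ((𝓡∂ d).prod 𝓘(ℝ, Normal k d)) (𝓡∂ d) ∞
      (fun p : Y × Normal k d => normalShift e p.1 p.2) (y, h) := by
  refine ContMDiffAt.comp (y, h) (contMDiffAt_symm_of_mem_maximalAtlas he hh) ?_
  refine ContMDiffAt.comp (y, h)
    (f := fun p : Y × Normal k d => (e p.1, p.2)) contMDiff_addNormal.contMDiffAt ?_
  exact ((contMDiffAt_of_mem_maximalAtlas he hy).comp (y, h) contMDiffAt_fst).prodMk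
    contMDiffAt_snd

end Coordinates

/-! ### Boundary charts and linear changes of coordinates of the half space -/

section Boundary

variable {d : ℕ} [NeZero d]

theorem isBoundaryPoint_halfSpace_iff {z : EuclideanHalfSpace d} :
    (𝓡∂ d).IsBoundaryPoint z ↔ z.1 0 = 0 := by
  rw [ModelWithCorners.isBoundaryPoint_iff, frontier_range_modelWithCornersEuclideanHalfSpace]
  simp only [mfld_simps, mem_ofPred_eq]
  exact eq_comm

variable {Y : Type*} [TopologicalSpace Y] [ChartedSpace (EuclideanHalfSpace d) Y]
  [IsManifold (𝓡∂ d) ∞ Y] {e : OpenPartialHomeomorph Y (EuclideanHalfSpace d)} {y : Y}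

theorem mem_boundary_iff_of_mem_maximalAtlas (he : e ∈ IsManifold.maximalAtlas (𝓡∂ d) ∞ Y)
    (hy : y ∈ e.source) : y ∈ (𝓡∂ d).boundary Y ↔ (e y).1 0 = 0 := by
  have hloc : IsLocalDiffeomorphAt (𝓡∂ d) (𝓡∂ d) ∞ e y :=
    ⟨{ toPartialEquiv := e.toPartialEquiv
       open_source := e.open_source
       open_target := e.open_target
       contMDiffOn_toFun := contMDiffOn_of_mem_maximalAtlas he
       contMDiffOn_invFun := contMDiffOn_symm_of_mem_maximalAtlas he }, hy, fun _ _ => rfl⟩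
  rw [← isBoundaryPoint_halfSpace_iff]
  exact hloc.isBoundaryPoint_iff (by simp)

end Boundary

section LinearAlgebra

variable {k d : ℕ} [NeZero k] [NeZero d]

/-- A linear change of coordinates which straightens a subspace and has a prescribed first
coordinate. -/
theorem exists_straightening {F : Type*} [NormedAddCommGroup F] [NormedSpace ℝ F]
    (L : (EuclideanSpace ℝ (Fin k) × F) ≃L[ℝ] EuclideanSpace ℝ (Fin d))
    (μ : EuclideanSpace ℝ (Fin d) →L[ℝ] ℝ) {c : ℝ} (hc : c ≠ 0)
    (hμ : ∀ x, μ (L (x, 0)) = c * x 0) :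
    ∃ Λ : EuclideanSpace ℝ (Fin d) ≃L[ℝ] EuclideanSpace ℝ (Fin d), (∀ y, Λ y 0 = μ y) ∧
      ∀ y, (L.symm y).2 = 0 ↔ ∀ j : Fin d, k ≤ (j : ℕ) → Λ y j = 0 := by
  have hfin : FiniteDimensional ℝ (EuclideanSpace ℝ (Fin k) × F) :=
    L.symm.toLinearEquiv.finiteDimensional
  have hfinF : FiniteDimensional ℝ F :=
    FiniteDimensional.of_injective (LinearMap.inr ℝ (EuclideanSpace ℝ (Fin k)) F)
      LinearMap.inr_injective
  have hdim : k + Module.finrank ℝ F = d := by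
    have := L.toLinearEquiv.finrank_eq
    simpa using this
  have hcard : Module.finrank ℝ F = Module.finrank ℝ (Normal k d) := by
    have h1 : Fintype.card {j : Fin d // ¬ k ≤ (j : ℕ)} = k := by
      have hkd : k ≤ d := by omega
      have := Fintype.card_congr
        (show Fin k ≃ {j : Fin d // ¬ k ≤ (j : ℕ)} from
          { toFun := fun i => ⟨Fin.castLE hkd i, by simp⟩
            invFun := fun j => ⟨j.1, by simpa using j.2⟩
            left_inv := fun i => rfl
            right_inv := fun j => rfl })
      simpa using this.symm
    have h2 := Fintype.card_subtype_compl (fun j : Fin d => k ≤ (j : ℕ))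
    rw [h1, Fintype.card_fin] at h2
    have h3 := Fintype.card_subtype_le (fun j : Fin d => k ≤ (j : ℕ))
    rw [Fintype.card_fin] at h3
    rw [Module.finrank_fintype_fun_eq_card]
    omega
  let φ : F ≃L[ℝ] Normal k d := ContinuousLinearEquiv.ofFinrankEq hcard
  let T : EuclideanSpace ℝ (Fin d) →ₗ[ℝ] EuclideanSpace ℝ (Fin d) :=
    { toFun := fun y => WithLp.toLp 2 fun j =>
        if hj : k ≤ (j : ℕ) then φ (L.symm y).2 ⟨j, hj⟩
        else if j = 0 then μ y else (L.symm y).1 ⟨j, not_le.1 hj⟩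
      map_add' := fun y y' => by
        ext j
        by_cases hj : k ≤ (j : ℕ) <;> by_cases hj0 : j = 0 <;> simp [hj, hj0, NeZero.ne k]
      map_smul' := fun r y => by
        ext j
        by_cases hj : k ≤ (j : ℕ) <;> by_cases hj0 : j = 0 <;> simp [hj, hj0, NeZero.ne k] }
  have hT1 : ∀ y (j : Fin d) (hj : k ≤ (j : ℕ)), T y j = φ (L.symm y).2 ⟨j, hj⟩ := by
    intro y j hj; simp [T, hj]
  have hT2 : ∀ y, T y 0 = μ y := by
    intro y
    have := not_le_zero_index (k := k) (d := d)
    simp only [T, LinearMap.coe_mk, AddHom.coe_mk, this, dite_false, if_true]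
  have hT3 : ∀ y (j : Fin d) (hj : ¬ k ≤ (j : ℕ)), j ≠ 0 →
      T y j = (L.symm y).1 ⟨j, not_le.1 hj⟩ := by
    intro y j hj hj0; simp [T, hj, hj0]
  have hker : ∀ y, (L.symm y).2 = 0 ↔ ∀ j : Fin d, k ≤ (j : ℕ) → T y j = 0 := by
    intro y
    constructor
    · intro h j hj
      rw [hT1 y j hj, h]; simp
    · intro h
      rw [← φ.map_eq_zero_iff]
      ext j
      rw [← hT1 y j.1 j.2, h j.1 j.2]; rfl
  have hinj : Function.Injective T := by
    rw [← LinearMap.ker_eq_bot, LinearMap.ker_eq_bot']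
    intro y hy
    have h2 : (L.symm y).2 = 0 := (hker y).2 fun j _ => by rw [hy]; rfl
    have hy' : y = L ((L.symm y).1, 0) := by
      rw [← h2]; simp
    have h0 : (L.symm y).1 0 = 0 := by
      have := hT2 y
      rw [hy, hy', hμ] at this
      simpa [hc, eq_comm] using this
    have h1 : (L.symm y).1 = 0 := by
      ext i
      by_cases hi : i = 0
      · rw [hi, h0]; rfl
      · have hid : (i : ℕ) < d := by omega
        have := hT3 y ⟨i, hid⟩ (by simp) (by
          intro h
          apply hi
          ext
          simpa using congrArg Fin.val h)
        rw [hy] at this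
        simpa using this.symm
    rw [hy', h1]
    exact map_zero L
  refine ⟨(LinearEquiv.ofInjectiveEndo T hinj).toContinuousLinearEquiv, hT2, hker⟩

end LinearAlgebra

section LinearChart

variable {d : ℕ} [NeZero d]

/-- A linear isomorphism, restricted to the part of the half space in an open set on which it
respects the half space. -/
def linearHalfSpaceHomeomorph (Λ : EuclideanSpace ℝ (Fin d) ≃L[ℝ] EuclideanSpace ℝ (Fin d))
    {O : Set (EuclideanSpace ℝ (Fin d))} (hO : IsOpen O)
    (h : ∀ z ∈ O, 0 ≤ z 0 ↔ 0 ≤ Λ z 0) :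
    OpenPartialHomeomorph (EuclideanHalfSpace d) (EuclideanHalfSpace d) where
  toFun z := (𝓡∂ d).symm (Λ z.1)
  invFun z := (𝓡∂ d).symm (Λ.symm z.1)
  source := {z | z.1 ∈ O}
  target := {z | Λ.symm z.1 ∈ O}
  map_source' z hz := by
    have h1 : ((𝓡∂ d).symm (Λ z.1)).1 = Λ z.1 :=
      (𝓡∂ d).right_inv (by
        rw [range_modelWithCornersEuclideanHalfSpace]; exact (h _ hz).1 z.2)
    simpa [h1] using hz
  map_target' z hz := by
    have h1 : ((𝓡∂ d).symm (Λ.symm z.1)).1 = Λ.symm z.1 :=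
      (𝓡∂ d).right_inv (by
        rw [range_modelWithCornersEuclideanHalfSpace]
        exact (h _ hz).2 (by simpa using z.2))
    change ((𝓡∂ d).symm (Λ.symm z.1)).1 ∈ O
    rw [h1]
    exact hz
  left_inv' z hz := by
    have h1 : ((𝓡∂ d).symm (Λ z.1)).1 = Λ z.1 :=
      (𝓡∂ d).right_inv (by
        rw [range_modelWithCornersEuclideanHalfSpace]; exact (h _ hz).1 z.2)
    rw [h1]
    simpa using (𝓡∂ d).left_inv z
  right_inv' z hz := by
    have h1 : ((𝓡∂ d).symm (Λ.symm z.1)).1 = Λ.symm z.1 :=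
      (𝓡∂ d).right_inv (by
        rw [range_modelWithCornersEuclideanHalfSpace]
        exact (h _ hz).2 (by simpa using z.2))
    rw [h1]
    simpa using (𝓡∂ d).left_inv z
  open_source := hO.preimage continuous_subtype_val
  open_target := hO.preimage (by fun_prop)
  continuousOn_toFun := ((𝓡∂ d).continuous_symm.comp (by fun_prop)).continuousOn
  continuousOn_invFun := ((𝓡∂ d).continuous_symm.comp (by fun_prop)).continuousOn

variable (Λ : EuclideanSpace ℝ (Fin d) ≃L[ℝ] EuclideanSpace ℝ (Fin d))
    {O : Set (EuclideanSpace ℝ (Fin d))} (hO : IsOpen O)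
    (h : ∀ z ∈ O, 0 ≤ z 0 ↔ 0 ≤ Λ z 0)

theorem linearHalfSpaceHomeomorph_val {z : EuclideanHalfSpace d} (hz : z.1 ∈ O) :
    (linearHalfSpaceHomeomorph Λ hO h z).1 = Λ z.1 :=
  (𝓡∂ d).right_inv (by
    rw [range_modelWithCornersEuclideanHalfSpace]; exact (h _ hz).1 z.2)

theorem linearHalfSpaceHomeomorph_symm_val {z : EuclideanHalfSpace d}
    (hz : Λ.symm z.1 ∈ O) :
    ((linearHalfSpaceHomeomorph Λ hO h).symm z).1 = Λ.symm z.1 :=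
  (𝓡∂ d).right_inv (by
    rw [range_modelWithCornersEuclideanHalfSpace]; exact (h _ hz).2 (by simpa using z.2))

theorem contMDiff_halfSpace_val :
    ContMDiff (𝓡∂ d) 𝓘(ℝ, EuclideanSpace ℝ (Fin d)) ∞ (fun z : EuclideanHalfSpace d => z.1) :=
  fun _ => contMDiffWithinAt_model_iff.1 contMDiffWithinAt_id

theorem contMDiffOn_linearHalfSpaceHomeomorph :
    ContMDiffOn (𝓡∂ d) (𝓡∂ d) ∞ (linearHalfSpaceHomeomorph Λ hO h) {z | z.1 ∈ O} := by
  intro z hz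
  refine contMDiffWithinAt_model_iff.2 ?_
  have : ContMDiff (𝓡∂ d) 𝓘(ℝ, EuclideanSpace ℝ (Fin d)) ∞
      (fun z : EuclideanHalfSpace d => Λ z.1) :=
    Λ.contDiff.contMDiff.comp contMDiff_halfSpace_val
  exact this.contMDiffAt.contMDiffWithinAt.congr
    (fun z' hz' => linearHalfSpaceHomeomorph_val Λ hO h hz')
    (linearHalfSpaceHomeomorph_val Λ hO h hz)

theorem contMDiffOn_linearHalfSpaceHomeomorph_symm :
    ContMDiffOn (𝓡∂ d) (𝓡∂ d) ∞ (linearHalfSpaceHomeomorph Λ hO h).symm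
      {z | Λ.symm z.1 ∈ O} := by
  intro z hz
  refine contMDiffWithinAt_model_iff.2 ?_
  have : ContMDiff (𝓡∂ d) 𝓘(ℝ, EuclideanSpace ℝ (Fin d)) ∞
      (fun z : EuclideanHalfSpace d => Λ.symm z.1) :=
    Λ.symm.contDiff.contMDiff.comp contMDiff_halfSpace_val
  exact this.contMDiffAt.contMDiffWithinAt.congr
    (fun z' hz' => linearHalfSpaceHomeomorph_symm_val Λ hO h hz')
    (linearHalfSpaceHomeomorph_symm_val Λ hO h hz)

end LinearChart

/-! ### Slice charts -/

section SliceChart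

variable {k d : ℕ} [NeZero k] [NeZero d]
  {W : Type*} [TopologicalSpace W] [ChartedSpace (EuclideanHalfSpace k) W]
  {Y : Type*} [TopologicalSpace Y] [ChartedSpace (EuclideanHalfSpace d) Y]
  [IsManifold (𝓡∂ d) ∞ Y]

/-- A slice chart: a chart of `Y` in which the image of `ι` is the set of points whose last `d - k`
coordinates vanish. -/
structure IsSliceChart (ι : C^∞⟮𝓡∂ k, W; 𝓡∂ d, Y⟯)
    (e : OpenPartialHomeomorph Y (EuclideanHalfSpace d)) : Prop where
  mem_maximalAtlas : e ∈ IsManifold.maximalAtlas (𝓡∂ d) ∞ Y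
  mem_range_iff : ∀ y ∈ e.source, y ∈ range ι ↔ normalCoord k e y = 0

variable {ι : C^∞⟮𝓡∂ k, W; 𝓡∂ d, Y⟯}

/-- A slice chart is obtained from charts `D`, `c` in which `ι` is the linear inclusion `L (·, 0)`
by composing `c` with a linear map `Λ` that takes the image of this inclusion to the first `k`
coordinates.  The condition `hpos` says that the points of the linear subspace near `ι w` come from
the half space in which `D` takes its values. -/
theorem exists_isSliceChart_of_straightening {w : W}
    (hι : IsSmoothEmbedding (𝓡∂ k) (𝓡∂ d) ∞ ι)
    {D : OpenPartialHomeomorph W (EuclideanHalfSpace k)}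
    {c : OpenPartialHomeomorph Y (EuclideanHalfSpace d)}
    (hc : c ∈ IsManifold.maximalAtlas (𝓡∂ d) ∞ Y) (hwD : w ∈ D.source)
    (hDc : D.source ⊆ ι ⁻¹' c.source) {F : Type*} [NormedAddCommGroup F] [NormedSpace ℝ F]
    (L : (EuclideanSpace ℝ (Fin k) × F) ≃L[ℝ] EuclideanSpace ℝ (Fin d))
    (hL : ∀ x ∈ D.source, (c (ι x)).1 = L ((D x).1, 0))
    (hpos : ∀ᶠ y in 𝓝 (ι w), ∀ x, (c y).1 = L (x, 0) → 0 ≤ x 0)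
    (Λ : EuclideanSpace ℝ (Fin d) ≃L[ℝ] EuclideanSpace ℝ (Fin d))
    {O : Set (EuclideanSpace ℝ (Fin d))} (hO : IsOpen O)
    (h : ∀ z ∈ O, 0 ≤ z 0 ↔ 0 ≤ Λ z 0) (hwO : (c (ι w)).1 ∈ O)
    (hΛ : ∀ y, (L.symm y).2 = 0 ↔ ∀ j : Fin d, k ≤ (j : ℕ) → Λ y j = 0) :
    ∃ e, IsSliceChart ι e ∧ ι w ∈ e.source := by
  have hwc : ι w ∈ c.source := hDc hwD
  obtain ⟨U, hU, hUD⟩ := hι.isEmbedding.isInducing.isOpen_iff.1 D.open_source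
  have hcc : ContinuousAt c (ι w) := c.continuousAt hwc
  have hmem : ∀ᶠ y in 𝓝 (ι w), (𝓡∂ k).symm (L.symm (c y).1).1 ∈ D.target := by
    have hcont : ContinuousAt (fun y => (𝓡∂ k).symm (L.symm (c y).1).1) (ι w) :=
      (𝓡∂ k).continuous_symm.continuousAt.comp (continuous_fst.continuousAt.comp
        (L.symm.continuous.continuousAt.comp (continuous_subtype_val.continuousAt.comp hcc)))
    refine hcont.eventually_mem (D.open_target.mem_nhds ?_)
    rw [hL w hwD]
    simp only [ContinuousLinearEquiv.symm_apply_apply]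
    rw [show (𝓡∂ k).symm (D w).1 = D w from (𝓡∂ k).left_inv _]
    exact D.map_source hwD
  have hwU : ι w ∈ U := by
    have : w ∈ ι ⁻¹' U := hUD ▸ hwD
    exact this
  obtain ⟨V, hV, hVo, hwV⟩ := eventually_nhds_iff.1
    (hpos.and (hmem.and ((hU.eventually_mem hwU).and (c.open_source.eventually_mem hwc))))
  have hnorm : ∀ y ∈ V, (y ∈ range ι ↔ (L.symm (c y).1).2 = 0) := by
    intro y hy
    obtain ⟨h1, h2, h3, h4⟩ := hV y hy
    constructor
    · rintro ⟨x, rfl⟩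
      have hx : x ∈ D.source := hUD ▸ (show x ∈ ι ⁻¹' U from h3)
      rw [hL x hx]
      simp
    · intro h0
      set x := (L.symm (c y).1).1 with hx
      have hcy : (c y).1 = L (x, 0) := by
        rw [← h0, hx]; simp
      have hx0 := h1 x hcy
      have hval : ((𝓡∂ k).symm x).1 = x := (𝓡∂ k).right_inv (by
        rw [range_modelWithCornersEuclideanHalfSpace]; exact hx0)
      have hx' := D.map_target h2
      have h5 := hL _ hx'
      rw [D.right_inv h2, hval, ← hcy] at h5
      exact ⟨_, c.injOn (hDc hx') h4 (Subtype.ext h5)⟩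
  set A := linearHalfSpaceHomeomorph Λ hO h with hA
  refine ⟨(c.trans A).restrOpen V hVo, ⟨?_, ?_⟩, ?_⟩
  · refine OpenPartialHomeomorph.mem_maximalAtlas_of_contMDiffOn _ ?_ ?_
    · refine (contMDiffOn_linearHalfSpaceHomeomorph Λ hO h).comp
        ((contMDiffOn_of_mem_maximalAtlas hc).mono ?_) ?_
      · intro y hy; exact hy.1.1
      · intro y hy; exact hy.1.2
    · refine (contMDiffOn_symm_of_mem_maximalAtlas hc).comp
        ((contMDiffOn_linearHalfSpaceHomeomorph_symm Λ hO h).mono ?_) ?_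
      · intro y hy; exact hy.1.1
      · intro y hy; exact hy.1.2
  · intro y hy
    rw [hnorm y hy.2, hΛ]
    have hval : (A (c y)).1 = Λ (c y).1 :=
      linearHalfSpaceHomeomorph_val Λ hO h hy.1.2
    constructor
    · intro h0
      ext j
      change (A (c y)).1 j.1 = 0
      rw [hval]
      exact h0 j.1 j.2
    · intro h0 j hj
      rw [← hval]
      exact congrFun h0 ⟨j, hj⟩
  · exact ⟨⟨hwc, hwO⟩, hwV⟩

/-- Slice charts exist.  At a boundary point this uses that the embedding is neat: as the image of
the interior of `W` is in the interior of `Y`, the first coordinate of `Y` restricts to a positive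
multiple of the first coordinate of `W`. -/
theorem exists_isSliceChart [IsManifold (𝓡∂ k) ∞ W] (hι : IsSmoothEmbedding (𝓡∂ k) (𝓡∂ d) ∞ ι)
    (hboundary : ι ⁻¹' (𝓡∂ d).boundary Y = (𝓡∂ k).boundary W) (w : W) :
    ∃ e, IsSliceChart ι e ∧ ι w ∈ e.source := by
  have him := hι.isImmersion.isImmersionAt w
  set D := him.domChart with hD
  set c := him.codChart with hc
  have hDm : D ∈ IsManifold.maximalAtlas (𝓡∂ k) ∞ W := him.domChart_mem_maximalAtlas
  have hcm : c ∈ IsManifold.maximalAtlas (𝓡∂ d) ∞ Y := him.codChart_mem_maximalAtlas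
  have hwD : w ∈ D.source := him.mem_domChart_source
  have hDc : D.source ⊆ ι ⁻¹' c.source := him.source_subset_preimage_source
  set L := him.equiv with hLdef
  have hL : ∀ x ∈ D.source, (c (ι x)).1 = L ((D x).1, 0) := by
    intro x hx
    have hmem : (D x).1 ∈ (D.extend (𝓡∂ k)).target := by
      rw [OpenPartialHomeomorph.extend_target_eq_image_source]
      exact ⟨x, hx, rfl⟩
    have := him.writtenInCharts hmem
    change (c (ι (D.symm ((𝓡∂ k).symm (D x).1)))).1 = L ((D x).1, 0) at this
    rw [show (𝓡∂ k).symm (D x).1 = D x from (𝓡∂ k).left_inv _, D.left_inv hx] at this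
    exact this
  have hbd : ∀ x ∈ D.source, (L ((D x).1, 0) 0 = 0 ↔ (D x).1 0 = 0) := by
    intro x hx
    rw [← hL x hx, ← mem_boundary_iff_of_mem_maximalAtlas hcm (hDc hx),
      ← mem_boundary_iff_of_mem_maximalAtlas hDm hx, ← hboundary]
    rfl
  have hx₀c : ContinuousAt c (ι w) := c.continuousAt (hDc hwD)
  by_cases hw0 : (D w).1 0 = 0
  · -- at a boundary point the first coordinate of `Y` is a positive multiple of that of `W`
    set x₀ : EuclideanSpace ℝ (Fin k) := (D w).1 with hx₀
    have hl0 : L (x₀, 0) 0 = 0 := (hbd w hwD).2 hw0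
    have hray : ∀ a : EuclideanSpace ℝ (Fin k), 0 ≤ a 0 →
        0 ≤ L (a, 0) 0 ∧ (L (a, 0) 0 = 0 ↔ a 0 = 0) := by
      intro a ha
      have hcont : Tendsto (fun t : ℝ => (𝓡∂ k).symm (x₀ + t • a)) (𝓝 0) (𝓝 (D w)) := by
        have : Continuous fun t : ℝ => (𝓡∂ k).symm (x₀ + t • a) :=
          (𝓡∂ k).continuous_symm.comp (by fun_prop)
        have h := this.tendsto 0
        simpa [hx₀, show (𝓡∂ k).symm (D w).1 = D w from (𝓡∂ k).left_inv _] using h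
      have hev : ∀ᶠ t in 𝓝[>] (0 : ℝ), (𝓡∂ k).symm (x₀ + t • a) ∈ D.target :=
        (hcont.mono_left nhdsWithin_le_nhds).eventually_mem
          (D.open_target.mem_nhds (D.map_source hwD))
      obtain ⟨t, ht, ht0⟩ := (hev.and self_mem_nhdsWithin).exists
      have ht0' : 0 < t := ht0
      have hval : ((𝓡∂ k).symm (x₀ + t • a)).1 = x₀ + t • a := (𝓡∂ k).right_inv (by
        rw [range_modelWithCornersEuclideanHalfSpace]
        simp only [mem_ofPred_eq, PiLp.add_apply, PiLp.smul_apply, hw0, zero_add, smul_eq_mul]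
        positivity)
      have hs := D.map_target ht
      have hlin : L (x₀ + t • a, 0) 0 = t * L (a, 0) 0 := by
        have : ((x₀ + t • a, 0) : EuclideanSpace ℝ (Fin k) × him.complement) =
          (x₀, 0) + t • (a, 0) := by simp
        rw [this, map_add, map_smul]
        simp [hl0]
      have h1 := hbd _ hs
      have h2 := (c (ι (D.symm ((𝓡∂ k).symm (x₀ + t • a))))).2
      rw [hL _ hs] at h2
      rw [D.right_inv ht, hval, hlin] at h1 h2
      constructor
      · exact nonneg_of_mul_nonneg_right h2 ht0'
      · simpa [ht0'.ne', hw0] using h1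
    set e₀ : EuclideanSpace ℝ (Fin k) := EuclideanSpace.single 0 1 with he₀
    have hc0 : 0 < L (e₀, 0) 0 := by
      obtain ⟨h1, h2⟩ := hray e₀ (by simp [he₀])
      refine lt_of_le_of_ne h1 fun h => ?_
      have := h2.1 h.symm
      simp [he₀] at this
    have hlin : ∀ a : EuclideanSpace ℝ (Fin k), L (a, 0) 0 = L (e₀, 0) 0 * a 0 := by
      intro a
      have h1 := (hray (a - a 0 • e₀) (by simp [he₀])).2.2 (by simp [he₀])
      have : ((a - a 0 • e₀, 0) : EuclideanSpace ℝ (Fin k) × him.complement) =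
          (a, 0) - a 0 • (e₀, 0) := by simp
      rw [this, map_sub, map_smul] at h1
      simp only [PiLp.sub_apply, PiLp.smul_apply, smul_eq_mul] at h1
      linarith
    obtain ⟨Λ, hΛ0, hΛ⟩ := exists_straightening L (EuclideanSpace.proj (0 : Fin d)) hc0.ne' hlin
    refine exists_isSliceChart_of_straightening hι hcm hwD hDc L hL ?_ Λ isOpen_univ
      (fun z _ => by simp [hΛ0]) (mem_univ _) (by simpa using hΛ)
    refine Eventually.of_forall fun y x hy => ?_
    have h2 := (c y).2
    rw [hy, hlin] at h2
    exact nonneg_of_mul_nonneg_right h2 hc0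
  -- At an interior point, `Λ` need only respect the half space near `c (ι w)`: the chart is
  -- restricted to the set where the first coordinate is positive before and after `Λ`.
  · have hw0' : 0 < (D w).1 0 := lt_of_le_of_ne (D w).2 (Ne.symm hw0)
    have hpos : ∀ᶠ y in 𝓝 (ι w), 0 < (L.symm (c y).1).1 0 := by
      have hcont : ContinuousAt (fun y => (L.symm (c y).1).1 0) (ι w) :=
        (EuclideanSpace.proj (𝕜 := ℝ) (0 : Fin k)).continuous.continuousAt.comp
          (continuous_fst.continuousAt.comp (L.symm.continuous.continuousAt.comp
            (continuous_subtype_val.continuousAt.comp hx₀c)))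
      refine hcont.eventually_mem (Ioi_mem_nhds ?_)
      rw [hL w hwD]
      simpa using hw0'
    obtain ⟨Λ, hΛ0, hΛ⟩ := exists_straightening L
      ((EuclideanSpace.proj (0 : Fin k)).comp ((ContinuousLinearMap.fst ℝ _ _).comp
        (L.symm : EuclideanSpace ℝ (Fin d) →L[ℝ] EuclideanSpace ℝ (Fin k) × him.complement)))
      one_ne_zero (fun x => by simp)
    refine exists_isSliceChart_of_straightening hι hcm hwD hDc L hL ?_ Λ
      (O := {z | 0 < z 0 ∧ 0 < Λ z 0}) ?_ (fun z hz => ?_) ⟨?_, ?_⟩ (by simpa using hΛ)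
    · filter_upwards [hpos] with y hy x hx
      rw [hx] at hy
      simpa using hy.le
    · have h1 : Continuous fun z : EuclideanSpace ℝ (Fin d) => z 0 := by fun_prop
      have h2 : Continuous fun z : EuclideanSpace ℝ (Fin d) => Λ z 0 := by fun_prop
      exact (isOpen_lt continuous_const h1).inter (isOpen_lt continuous_const h2)
    · simp [hz.1.le, hz.2.le]
    · refine lt_of_le_of_ne (c (ι w)).2 fun h => hw0 ?_
      rw [hL w hwD] at h
      exact (hbd w hwD).1 h.symm
    · rw [hΛ0, hL w hwD]
      simpa using hw0'

end SliceChart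

/-! ### Normal vectors in slice charts -/

section Curves

variable {E H E' H' Y Z : Type*} [NormedAddCommGroup E] [NormedSpace ℝ E] [TopologicalSpace H]
  [TopologicalSpace Y] [ChartedSpace H Y] {I : ModelWithCorners ℝ E H}
  [NormedAddCommGroup E'] [NormedSpace ℝ E'] [TopologicalSpace H']
  [TopologicalSpace Z] [ChartedSpace H' Z] {I' : ModelWithCorners ℝ E' H'}

theorem mfderiv_comp_curve {g : Y → Z} {γ : ℝ → Y} {y : Y} (h0 : γ 0 = y)
    (hg : MDifferentiableAt I I' g y) (hγ : MDifferentiableAt 𝓘(ℝ, ℝ) I γ 0) :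
    (mfderiv 𝓘(ℝ, ℝ) I' (fun r => g (γ r)) 0 (1 : ℝ) : E') =
      mfderiv I I' g y (mfderiv 𝓘(ℝ, ℝ) I γ 0 (1 : ℝ) : E) := by
  subst h0
  exact congrArg (fun L => L (1 : ℝ)) (mfderiv_comp (0 : ℝ) hg hγ)

theorem deriv_comp_curve {F : Type*} [NormedAddCommGroup F] [NormedSpace ℝ F] {g : Y → F}
    {γ : ℝ → Y} {y : Y} (h0 : γ 0 = y)
    (hg : MDifferentiableAt I 𝓘(ℝ, F) g y) (hγ : MDifferentiableAt 𝓘(ℝ, ℝ) I γ 0) :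
    deriv (fun r => g (γ r)) 0 =
      mfderiv I 𝓘(ℝ, F) g y (mfderiv 𝓘(ℝ, ℝ) I γ 0 (1 : ℝ) : E) := by
  rw [← mfderiv_comp_curve h0 hg hγ, mfderiv_eq_fderiv]
  rfl

end Curves

section NormalVectors

variable {k d : ℕ} [NeZero k] [NeZero d]
  {W : Type*} [TopologicalSpace W] [ChartedSpace (EuclideanHalfSpace k) W]
  {Y : Type*} [TopologicalSpace Y] [ChartedSpace (EuclideanHalfSpace d) Y]
  [IsManifold (𝓡∂ d) ∞ Y]

/-- The tangent vector at `y` whose coordinates in the chart `e` are `(0, h)`. -/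
def normalVector (e : OpenPartialHomeomorph Y (EuclideanHalfSpace d)) (y : Y) (h : Normal k d) :
    EuclideanSpace ℝ (Fin d) :=
  mfderiv 𝓘(ℝ, ℝ) (𝓡∂ d) (fun r : ℝ => normalShift e y (r • h)) 0 (1 : ℝ)

/-- The differential of the normal coordinates, as a map on tangent vectors. -/
def normalDeriv (k : ℕ) {d : ℕ} [NeZero d] {Y : Type*} [TopologicalSpace Y]
    [ChartedSpace (EuclideanHalfSpace d) Y]
    (e : OpenPartialHomeomorph Y (EuclideanHalfSpace d)) (y : Y) :
    EuclideanSpace ℝ (Fin d) →L[ℝ] Normal k d :=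
  mfderiv (𝓡∂ d) 𝓘(ℝ, Normal k d) (normalCoord k e) y

variable {e : OpenPartialHomeomorph Y (EuclideanHalfSpace d)} {y : Y}

theorem contMDiffAt_normalShift_curve (he : e ∈ IsManifold.maximalAtlas (𝓡∂ d) ∞ Y)
    (hy : y ∈ e.source) (h : Normal k d) :
    ContMDiffAt 𝓘(ℝ, ℝ) (𝓡∂ d) ∞ (fun r : ℝ => normalShift e y (r • h)) 0 := by
  have h1 := contMDiffAt_normalShift (k := k) he (h := (0 : ℝ) • h) hy
    (by simpa using e.map_source hy)
  refine ContMDiffAt.comp (f := fun r : ℝ => (y, r • h)) (0 : ℝ) h1 ?_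
  exact contMDiffAt_const.prodMk (contMDiffAt_id.smul contMDiffAt_const)

theorem mdifferentiableAt_normalCoord (he : e ∈ IsManifold.maximalAtlas (𝓡∂ d) ∞ Y)
    (hy : y ∈ e.source) : MDifferentiableAt (𝓡∂ d) 𝓘(ℝ, Normal k d) (normalCoord k e) y :=
  (contMDiffAt_normalCoord he hy).mdifferentiableAt (by simp)

theorem normalDeriv_normalVector (he : e ∈ IsManifold.maximalAtlas (𝓡∂ d) ∞ Y)
    (hy : y ∈ e.source) (h : Normal k d) :
    normalDeriv k e y (normalVector e y h) = h := by
  have h0 : normalShift e y ((0 : ℝ) • h) = y := by rw [zero_smul, normalShift_zero hy]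
  have hc := contMDiffAt_normalShift_curve he hy h
  have h1 := deriv_comp_curve (γ := fun r : ℝ => normalShift e y (r • h)) h0
    (mdifferentiableAt_normalCoord (k := k) he hy) (hc.mdifferentiableAt (by simp))
  refine h1.symm.trans ?_
  have hev : (fun r : ℝ => normalCoord k e (normalShift e y (r • h))) =ᶠ[𝓝 0]
      fun r => normalCoord k e y + r • h := by
    have : Continuous fun r : ℝ => addNormal (e y) (r • h) :=
      (contMDiff_addNormal (n := 0)).continuous.comp
        (by fun_prop : Continuous fun r : ℝ => (e y, r • h))
    have := this.continuousAt.eventually_mem (x := (0 : ℝ)) (e.open_target.mem_nhds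
      (by simpa using e.map_source hy))
    filter_upwards [this] with r hr
    exact normalCoord_normalShift hr
  rw [hev.deriv_eq]
  simp [deriv_smul_const]

variable {ι : C^∞⟮𝓡∂ k, W; 𝓡∂ d, Y⟯}

/-- The retraction onto the submanifold along the last `d - k` coordinates of a slice chart. -/
def sliceRetraction (ι : C^∞⟮𝓡∂ k, W; 𝓡∂ d, Y⟯) [Nonempty W]
    (e : OpenPartialHomeomorph Y (EuclideanHalfSpace d)) (y : Y) : W :=
  Function.invFun ι (normalShift e y (-normalCoord k e y))

theorem map_sliceRetraction [Nonempty W] (he : IsSliceChart ι e)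
    (hy' : addNormal (e y) (-normalCoord k e y) ∈ e.target) :
    ι (sliceRetraction ι e y) = normalShift e y (-normalCoord k e y) := by
  refine Function.invFun_eq (f := ι) ((he.mem_range_iff _ (normalShift_mem_source hy')).2 ?_)
  rw [normalCoord_normalShift hy', add_neg_cancel]

theorem IsSliceChart.normalCoord_eq_zero (he : IsSliceChart ι e) {w : W} (hw : ι w ∈ e.source) :
    normalCoord k e (ι w) = 0 :=
  (he.mem_range_iff _ hw).1 ⟨w, rfl⟩

theorem sliceRetraction_map [Nonempty W] (hι : IsSmoothEmbedding (𝓡∂ k) (𝓡∂ d) ∞ ι)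
    (he : IsSliceChart ι e) {w : W} (hw : ι w ∈ e.source) : sliceRetraction ι e (ι w) = w := by
  rw [sliceRetraction, he.normalCoord_eq_zero hw, neg_zero, normalShift_zero hw]
  exact Function.leftInverse_invFun hι.isEmbedding.injective w

theorem continuousAt_addNormal_neg (hy : y ∈ e.source) :
    ContinuousAt (fun y => addNormal (e y) (-normalCoord k e y)) y := by
  have h1 : ContinuousAt e y := e.continuousAt hy
  have h2 : ContinuousAt (normalCoord k e) y :=
    (contMDiff_normalPart (n := 0)).continuous.continuousAt.comp h1
  exact ContinuousAt.comp (f := fun y => (e y, -normalCoord k e y))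
    (contMDiff_addNormal (n := 0)).continuous.continuousAt (h1.prodMk h2.neg)

theorem eventually_addNormal_neg_mem_target (he : IsSliceChart ι e) {w : W}
    (hw : ι w ∈ e.source) :
    ∀ᶠ y in 𝓝 (ι w), y ∈ e.source ∧ addNormal (e y) (-normalCoord k e y) ∈ e.target := by
  refine (e.open_source.eventually_mem hw).and
    ((continuousAt_addNormal_neg hw).eventually_mem (e.open_target.mem_nhds ?_))
  rw [he.normalCoord_eq_zero hw, neg_zero, addNormal_zero]
  exact e.map_source hw

theorem contMDiffAt_normalShift_neg (he : e ∈ IsManifold.maximalAtlas (𝓡∂ d) ∞ Y)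
    (hy : y ∈ e.source) (hy' : addNormal (e y) (-normalCoord k e y) ∈ e.target) :
    ContMDiffAt (𝓡∂ d) (𝓡∂ d) ∞ (fun y => normalShift e y (-normalCoord k e y)) y :=
  ContMDiffAt.comp (f := fun y => (y, -normalCoord k e y)) y (contMDiffAt_normalShift he hy hy')
    (contMDiffAt_id.prodMk (contMDiffAt_normalCoord he hy).neg)

/-- A map to `W` is smooth if its composition with the embedding is. -/
theorem contMDiffAt_of_embedding {E H M : Type*} [NormedAddCommGroup E] [NormedSpace ℝ E]
    [TopologicalSpace H] {I : ModelWithCorners ℝ E H} [TopologicalSpace M] [ChartedSpace H M]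
    (hι : IsSmoothEmbedding (𝓡∂ k) (𝓡∂ d) ∞ ι) {f : M → W} {m : M}
    (h : ContMDiffAt I (𝓡∂ d) ∞ (fun m => ι (f m)) m) : ContMDiffAt I (𝓡∂ k) ∞ f m :=
  (ContMDiffAt.iff_comp_isImmersionAt (hι.isImmersion.isImmersionAt (f m))).2
    ⟨hι.isEmbedding.continuousAt_iff.2 h.continuousAt, h⟩

theorem contMDiffAt_sliceRetraction [Nonempty W] (hι : IsSmoothEmbedding (𝓡∂ k) (𝓡∂ d) ∞ ι)
    (he : IsSliceChart ι e) (hy : y ∈ e.source)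
    (hy' : addNormal (e y) (-normalCoord k e y) ∈ e.target) :
    ContMDiffAt (𝓡∂ d) (𝓡∂ k) ∞ (sliceRetraction ι e) y := by
  refine contMDiffAt_of_embedding hι ?_
  refine (contMDiffAt_normalShift_neg he.mem_maximalAtlas hy hy').congr_of_eventuallyEq ?_
  filter_upwards [(continuousAt_addNormal_neg hy).eventually_mem (e.open_target.mem_nhds hy')]
    with y' hy' using map_sliceRetraction he hy'

/-- The kernel of the differential of the normal coordinates is the tangent space of `W`. -/
theorem normalDeriv_eq_zero_iff (hι : IsSmoothEmbedding (𝓡∂ k) (𝓡∂ d) ∞ ι)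
    (he : IsSliceChart ι e) {w : W} (hw : ι w ∈ e.source) (v : TangentSpace (𝓡∂ d) (ι w)) :
    normalDeriv k e (ι w) v = 0 ↔ v ∈ (mfderiv (𝓡∂ k) (𝓡∂ d) ι w).range := by
  have hιd : MDifferentiableAt (𝓡∂ k) (𝓡∂ d) ι w := ι.mdifferentiableAt
  have hn := mdifferentiableAt_normalCoord (k := k) he.mem_maximalAtlas hw
  constructor
  · intro hv
    have : Nonempty W := ⟨w⟩
    have hw' := (eventually_addNormal_neg_mem_target he hw).self_of_nhds.2
    have hr := (contMDiffAt_sliceRetraction hι he hw hw').mdifferentiableAt (by simp)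
    have hrw := sliceRetraction_map hι he hw
    -- both `y` and its retraction have the form `normalShift e y (φ y)` with `φ (ι w) = 0`
    have hshift : ∀ φ : Y → Normal k d, φ (ι w) = 0 →
        MDifferentiableAt (𝓡∂ d) 𝓘(ℝ, Normal k d) φ (ι w) →
        mfderiv (𝓡∂ d) 𝓘(ℝ, Normal k d) φ (ι w) v = 0 →
        (mfderiv (𝓡∂ d) (𝓡∂ d) (fun y => normalShift e y (φ y)) (ι w) v : EuclideanSpace ℝ (Fin d))
          = mfderiv ((𝓡∂ d).prod 𝓘(ℝ, Normal k d)) (𝓡∂ d)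
            (fun p : Y × Normal k d => normalShift e p.1 p.2) (ι w, 0) (v, 0) := by
      intro φ hφ0 hφ hφv
      have hQ : MDifferentiableAt ((𝓡∂ d).prod 𝓘(ℝ, Normal k d)) (𝓡∂ d)
          (fun p : Y × Normal k d => normalShift e p.1 p.2) (ι w, φ (ι w)) :=
        (contMDiffAt_normalShift he.mem_maximalAtlas hw (by
          rw [hφ0, addNormal_zero]; exact e.map_source hw)).mdifferentiableAt (by simp)
      have h1 := mfderiv_comp (I' := (𝓡∂ d).prod 𝓘(ℝ, Normal k d)) (ι w) hQ
        (mdifferentiableAt_id.prodMk hφ)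
      have h2 := congrArg (fun L => L v) h1
      rw [mdifferentiableAt_id.mfderiv_prod hφ] at h2
      refine h2.trans ?_
      have h3 : ((mfderiv (𝓡∂ d) (𝓡∂ d) (id : Y → Y) (ι w) v : EuclideanSpace ℝ (Fin d)),
          (mfderiv (𝓡∂ d) 𝓘(ℝ, Normal k d) φ (ι w) v : Normal k d)) = (v, 0) :=
        Prod.ext (by rw [mfderiv_id]; rfl) hφv
      refine (congrArg (mfderiv ((𝓡∂ d).prod 𝓘(ℝ, Normal k d)) (𝓡∂ d)
            (fun p : Y × Normal k d => normalShift e p.1 p.2) (ι w, φ (ι w))) h3).trans ?_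
      rw [hφ0]
      rfl
    have h1 := hshift (fun y => -normalCoord k e y) (by simp [he.normalCoord_eq_zero hw]) hn.neg
      (by
        refine (DFunLike.congr_fun
          (mfderiv_neg (I := 𝓡∂ d) (f := normalCoord k e) (x := ι w)) v).trans ?_
        exact neg_eq_zero.2 hv)
    have h2 := hshift (fun _ => 0) rfl mdifferentiableAt_const (by simp)
    rw [← h2] at h1
    have h3 : (fun y => normalShift e y (0 : Normal k d)) =ᶠ[𝓝 (ι w)] id := by
      filter_upwards [e.open_source.mem_nhds hw] with y hy using normalShift_zero hy
    rw [h3.mfderiv_eq, mfderiv_id] at h1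
    have h4 : (fun y => normalShift e y (-normalCoord k e y)) =ᶠ[𝓝 (ι w)]
        fun y => ι (sliceRetraction ι e y) := by
      filter_upwards [eventually_addNormal_neg_mem_target he hw] with y hy
      exact (map_sliceRetraction he hy.2).symm
    rw [h4.mfderiv_eq] at h1
    have h5 := congrArg (fun L => L v) (mfderiv_comp (I' := 𝓡∂ k) (ι w)
      (g := ι) (by rw [hrw]; exact hιd) hr)
    rw [LinearMap.mem_range]
    refine ⟨mfderiv (𝓡∂ d) (𝓡∂ k) (sliceRetraction ι e) (ι w) v, ?_⟩
    rw [hrw] at h5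
    exact h5.symm.trans h1
  · rintro ⟨u, rfl⟩
    have h1 := congrArg (fun L => L u) (mfderiv_comp w hn hιd)
    have h2 : (normalCoord k e ∘ ι) =ᶠ[𝓝 w] fun _ => 0 := by
      filter_upwards [(ι.contMDiff.continuous.continuousAt).eventually_mem
        (e.open_source.mem_nhds hw)] with w' hw' using he.normalCoord_eq_zero hw'
    rw [h2.mfderiv_eq, mfderiv_const] at h1
    exact h1.symm

end NormalVectors

/-! ### Rays and directions -/

section Directions

variable {k d : ℕ} [NeZero k] [NeZero d]
  {W : Type*} [TopologicalSpace W] [ChartedSpace (EuclideanHalfSpace k) W]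
  {Y : Type*} [TopologicalSpace Y] [ChartedSpace (EuclideanHalfSpace d) Y]
  [IsManifold (𝓡∂ d) ∞ Y] {ι : C^∞⟮𝓡∂ k, W; 𝓡∂ d, Y⟯}

/-- `x` is the ray of the class of the tangent vector `v` in the normal space at `w`. -/
def IsRayOf (x : BlowUp ι) (w : W) (v : EuclideanSpace ℝ (Fin d)) : Prop :=
  ∃ h : normalClass ι w v ≠ 0, x = .sphere w (rayOfNeZero ℝ _ h)

/-- The normal coordinates of a point of `Y ∖ W`, or of a vector in the ray for a point of the
sphere bundle.  Only the ray of this vector matters. -/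
def direction (e : OpenPartialHomeomorph Y (EuclideanHalfSpace d)) : BlowUp ι → Normal k d
  | .off y _ => normalCoord k e y
  | .sphere w ρ => normalDeriv k e (ι w)
      (Function.surjInv (Submodule.Quotient.mk_surjective _) ρ.someVector)

variable {e : OpenPartialHomeomorph Y (EuclideanHalfSpace d)} {x x' : BlowUp ι} {w w' : W}
  {v v' : EuclideanSpace ℝ (Fin d)}

theorem exists_isRayOf (h : x ∈ sphereBundle ι) : ∃ w v, IsRayOf x w v := by
  obtain ⟨w, ρ, rfl⟩ := h
  set v := Function.surjInv (Submodule.Quotient.mk_surjective _) ρ.someVector with hv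
  have hc : normalClass ι w v = ρ.someVector :=
    Function.surjInv_eq (Submodule.Quotient.mk_surjective _) ρ.someVector
  refine ⟨w, v, by rw [hc]; exact ρ.someVector_ne_zero, ?_⟩
  simp only [hc, Module.Ray.someVector_ray]

theorem IsRayOf.proj_eq (h : IsRayOf x w v) : x.proj = ι w := by
  obtain ⟨_, rfl⟩ := h
  rfl

theorem mem_sphereBundle_iff : x ∈ sphereBundle ι ↔ x.proj ∈ range ι := by
  cases x with
  | off y h =>
    constructor
    · rintro ⟨w, ρ, h'⟩; cases h'
    · exact fun h' => (h h').elim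
  | sphere w ρ => exact ⟨fun _ => ⟨w, rfl⟩, fun _ => ⟨w, ρ, rfl⟩⟩

theorem eq_of_proj_eq (hx : x ∉ sphereBundle ι) (h : x'.proj = x.proj) : x' = x := by
  have hx' : x' ∉ sphereBundle ι := by
    rw [mem_sphereBundle_iff] at hx ⊢
    rwa [h]
  cases x with
  | sphere w ρ => exact (hx ⟨w, ρ, rfl⟩).elim
  | off y hy =>
    cases x' with
    | sphere w ρ => exact (hx' ⟨w, ρ, rfl⟩).elim
    | off y' hy' =>
      simp only [BlowUp.proj] at h
      subst h
      rfl

theorem direction_off (hx : x ∉ sphereBundle ι) : direction e x = normalCoord k e x.proj := by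
  cases x with
  | sphere w ρ => exact (hx ⟨w, ρ, rfl⟩).elim
  | off y hy => rfl

variable (hι : IsSmoothEmbedding (𝓡∂ k) (𝓡∂ d) ∞ ι) (he : IsSliceChart ι e)
include hι he

theorem normalClass_ne_zero_iff (hw : ι w ∈ e.source) :
    normalClass ι w v ≠ 0 ↔ normalDeriv k e (ι w) v ≠ 0 :=
  not_congr ((Submodule.Quotient.mk_eq_zero _).trans (normalDeriv_eq_zero_iff hι he hw v).symm)

/-- Rays in the normal space correspond to rays of normal coordinates. -/
theorem sameRay_normalClass_iff (hw : ι w ∈ e.source) :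
    SameRay ℝ (normalClass ι w v) (normalClass ι w v') ↔
      SameRay ℝ (normalDeriv k e (ι w) v) (normalDeriv k e (ι w) v') := by
  let L : NormalSpace ι w →ₗ[ℝ] Normal k d :=
    Submodule.liftQ _ (normalDeriv k e (ι w)).toLinearMap
      fun u hu => (normalDeriv_eq_zero_iff hι he hw u).2 hu
  have hL : Function.Injective L := by
    rw [← LinearMap.ker_eq_bot, LinearMap.ker_eq_bot']
    intro n hn
    obtain ⟨u, rfl⟩ := Submodule.Quotient.mk_surjective _ n
    exact (Submodule.Quotient.mk_eq_zero _).2 ((normalDeriv_eq_zero_iff hι he hw u).1 hn)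
  exact (hL.sameRay_map_iff (f := L)).symm

theorem IsRayOf.normalDeriv_ne_zero (h : IsRayOf x w v) (hw : ι w ∈ e.source) :
    normalDeriv k e (ι w) v ≠ 0 :=
  (normalClass_ne_zero_iff hι he hw).1 h.1

theorem IsRayOf.sameRay_direction (h : IsRayOf x w v) (hw : ι w ∈ e.source) :
    direction e x ≠ 0 ∧ SameRay ℝ (direction e x) (normalDeriv k e (ι w) v) := by
  obtain ⟨h, rfl⟩ := h
  set ρ := rayOfNeZero ℝ _ h with hρ
  let u : EuclideanSpace ℝ (Fin d) :=
    Function.surjInv (Submodule.Quotient.mk_surjective _) ρ.someVector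
  have hc : normalClass ι w u = ρ.someVector :=
    Function.surjInv_eq (Submodule.Quotient.mk_surjective _) ρ.someVector
  constructor
  · refine (normalClass_ne_zero_iff hι he hw (v := u)).1 ?_
    rw [hc]
    exact ρ.someVector_ne_zero
  · refine (sameRay_normalClass_iff hι he hw (v := u)).1 ?_
    rw [hc, ← ray_eq_iff (R := ℝ) ρ.someVector_ne_zero h, Module.Ray.someVector_ray]

theorem direction_ne_zero (hx : x.proj ∈ e.source) : direction e x ≠ 0 := by
  by_cases h : x ∈ sphereBundle ι
  · obtain ⟨w, v, hv⟩ := exists_isRayOf h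
    rw [hv.proj_eq] at hx
    exact (hv.sameRay_direction hι he hx).1
  · rw [direction_off h, Ne, ← he.mem_range_iff _ hx, ← mem_sphereBundle_iff]
    exact h

theorem isRayOf_of_sameRay (hw : ι w ∈ e.source) (hx : x.proj = ι w)
    (hv : normalDeriv k e (ι w) v ≠ 0)
    (h : SameRay ℝ (direction e x) (normalDeriv k e (ι w) v)) : IsRayOf x w v := by
  obtain ⟨w', v', hv'⟩ := exists_isRayOf (mem_sphereBundle_iff.2 ⟨w, hx.symm⟩)
  obtain rfl : w' = w := hι.isEmbedding.injective (by rw [← hv'.proj_eq, hx])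
  obtain ⟨h1, h2⟩ := hv'.sameRay_direction hι he hw
  have hv0 := (normalClass_ne_zero_iff hι he hw).2 hv
  refine ⟨hv0, ?_⟩
  obtain ⟨h3, rfl⟩ := hv'
  congr 1
  rw [ray_eq_iff]
  refine (sameRay_normalClass_iff hι he hw).2 ?_
  exact h2.symm.trans h fun h0 => (h1 h0).elim

/-- A point of the blow-up is determined by its projection and its direction. -/
theorem eq_of_direction (hx : x.proj ∈ e.source) (h : x.proj = x'.proj)
    (hd : SameRay ℝ (direction e x) (direction e x')) : x = x' := by
  by_cases hs : x ∈ sphereBundle ι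
  · obtain ⟨w, v, hv⟩ := exists_isRayOf hs
    have hw : ι w ∈ e.source := hv.proj_eq ▸ hx
    have hv0 := hv.normalDeriv_ne_zero hι he hw
    have h' : IsRayOf x' w v := by
      refine isRayOf_of_sameRay hι he hw (by rw [← h, hv.proj_eq]) hv0 ?_
      exact hd.symm.trans (hv.sameRay_direction hι he hw).2
        fun h0 => (direction_ne_zero hι he hx h0).elim
    obtain ⟨_, rfl⟩ := hv
    obtain ⟨_, rfl⟩ := h'
    rfl
  · exact (eq_of_proj_eq hs h.symm).symm

/-- If `h` represents the direction of `x`, then the ray of `x` contains the normal vector with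
normal coordinates `h`. -/
theorem isRayOf_normalVector (hw : ι w ∈ e.source) {h : Normal k d} (hh : h ≠ 0) (hx : x.proj = ι w)
    (hd : SameRay ℝ (direction e x) h) : IsRayOf x w (normalVector e (ι w) h) := by
  have h1 := normalDeriv_normalVector (k := k) he.mem_maximalAtlas hw h
  exact isRayOf_of_sameRay hι he hw hx (by rwa [h1]) (by rwa [h1])

/-- Every nonzero vector of normal coordinates is the direction of a ray at each point. -/
theorem exists_direction (hw : ι w ∈ e.source) {h : Normal k d} (hh : h ≠ 0) :
    ∃ x : BlowUp ι, x.proj = ι w ∧ SameRay ℝ (direction e x) h := by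
  have h1 := normalDeriv_normalVector (k := k) he.mem_maximalAtlas hw h
  have h2 : normalClass ι w (normalVector e (ι w) h) ≠ 0 :=
    (normalClass_ne_zero_iff hι he hw).2 (by rwa [h1])
  refine ⟨.sphere w (rayOfNeZero ℝ _ h2), rfl, ?_⟩
  have := (IsRayOf.sameRay_direction (x := .sphere w (rayOfNeZero ℝ _ h2)) hι he ⟨h2, rfl⟩ hw).2
  rwa [h1] at this

end Directions

/-! ### Smooth maps into the blow-up -/

section SmoothLift

-- The model vector space `E` is in `Type` because `contMDiffAt_dslope` needs it in the same
-- universe as the Euclidean spaces.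

variable {k d : ℕ} [NeZero k] [NeZero d]
  {W : Type*} [TopologicalSpace W] [ChartedSpace (EuclideanHalfSpace k) W]
  {Y : Type*} [TopologicalSpace Y] [ChartedSpace (EuclideanHalfSpace d) Y]
  [IsManifold (𝓡∂ d) ∞ Y] {ι : C^∞⟮𝓡∂ k, W; 𝓡∂ d, Y⟯}
  {E : Type} [NormedAddCommGroup E] [NormedSpace ℝ E] {H M : Type*} [TopologicalSpace H]
  [TopologicalSpace M] [ChartedSpace H M] (I : ModelWithCorners ℝ E H)
  {E' : Type} [NormedAddCommGroup E'] [NormedSpace ℝ E'] {H' M' : Type*} [TopologicalSpace H']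
  [TopologicalSpace M'] [ChartedSpace H' M'] (I' : ModelWithCorners ℝ E' H')

/-- Near `m`, the direction of `f` in the slice chart `e` is the ray of a smooth, nowhere vanishing
function. -/
def HasSmoothDirection (e : OpenPartialHomeomorph Y (EuclideanHalfSpace d)) (f : M → BlowUp ι)
    (s : Set M) (m : M) : Prop :=
  ∃ h : M → Normal k d, ContMDiffWithinAt I 𝓘(ℝ, Normal k d) ∞ h s m ∧ h m ≠ 0 ∧
    ∀ᶠ m' in 𝓝[s] m, SameRay ℝ (direction e (f m')) (h m')

/-- The maps into the blow-up that will turn out to be the smooth ones: those with a smooth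
projection to `Y` and a smooth direction in each slice chart. -/
structure SmoothLift (f : M → BlowUp ι) (s : Set M) (m : M) : Prop where
  proj : ContMDiffWithinAt I (𝓡∂ d) ∞ (fun m => (f m).proj) s m
  direction : ∀ e, IsSliceChart ι e → (f m).proj ∈ e.source → HasSmoothDirection I e f s m

variable {e e' : OpenPartialHomeomorph Y (EuclideanHalfSpace d)} {f f' : M → BlowUp ι} {s : Set M}
  {m : M} {I I'}

theorem HasSmoothDirection.comp {g : M' → M} {t : Set M'} {m' : M'}
    (hf : HasSmoothDirection I e f s (g m')) (hg : ContMDiffWithinAt I' I ∞ g t m')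
    (hst : MapsTo g t s) : HasSmoothDirection I' e (fun z => f (g z)) t m' := by
  obtain ⟨h, h1, h2, h3⟩ := hf
  exact ⟨fun z => h (g z), h1.comp m' hg hst, h2,
    (hg.continuousWithinAt.tendsto_nhdsWithin hst).eventually h3⟩

theorem SmoothLift.comp {g : M' → M} {t : Set M'} {m' : M'}
    (hf : SmoothLift I f s (g m')) (hg : ContMDiffWithinAt I' I ∞ g t m')
    (hst : MapsTo g t s) : SmoothLift I' (fun z => f (g z)) t m' :=
  ⟨ContMDiffWithinAt.comp (g := fun m => (f m).proj) m' hf.proj hg hst,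
    fun e he h => (hf.direction e he h).comp hg hst⟩

theorem SmoothLift.congr (hf : SmoothLift I f s m) (h : f' =ᶠ[𝓝[s] m] f) (hm : f' m = f m) :
    SmoothLift I f' s m := by
  refine ⟨hf.proj.congr_of_eventuallyEq (h.fun_comp BlowUp.proj) (by rw [hm]), fun e he hx => ?_⟩
  obtain ⟨g, h1, h2, h3⟩ := hf.direction e he (hm ▸ hx)
  exact ⟨g, h1, h2, by filter_upwards [h3, h] with m' h3 h4 using h4 ▸ h3⟩

variable (hι : IsSmoothEmbedding (𝓡∂ k) (𝓡∂ d) ∞ ι)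
include hι

/-- On the complement of the sphere bundle, the normal coordinates themselves give a smooth
direction. -/
theorem hasSmoothDirection_of_notMem (hclosed : IsClosed (range ι)) (he : IsSliceChart ι e)
    (hp : ContMDiffWithinAt I (𝓡∂ d) ∞ (fun m => (f m).proj) s m) (hx : f m ∉ sphereBundle ι)
    (hy : (f m).proj ∈ e.source) : HasSmoothDirection I e f s m := by
  refine ⟨fun m => normalCoord k e (f m).proj,
    ContMDiffAt.comp_contMDiffWithinAt (g := normalCoord k e) m
      (contMDiffAt_normalCoord he.mem_maximalAtlas hy) hp, ?_, ?_⟩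
  · have := direction_ne_zero hι he hy
    rwa [direction_off hx] at this
  · filter_upwards [hp.continuousWithinAt.eventually_mem
      (hclosed.isOpen_compl.mem_nhds fun h => hx (mem_sphereBundle_iff.2 h))] with m' hm'
    rw [direction_off fun h => hm' (mem_sphereBundle_iff.1 h)]

/-- If a smooth family `G` of maps preserves `W`, and `f'` is the image of `f` under the maps that
it induces on the blow-up, then a smooth direction of `f` gives one of `f'`.  In normal
coordinates `r • h` with `r ≥ 0`, where `h` is the smooth direction of `f`, the map `G` has the form
`r ↦ r • h'` by Hadamard's lemma, and `h'` is the smooth direction of `f'`. -/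
theorem HasSmoothDirection.map (hm : m ∈ s) (hdir : HasSmoothDirection I e f s m)
    (hp : ContMDiffWithinAt I (𝓡∂ d) ∞ (fun m => (f m).proj) s m) (hfm : f m ∈ sphereBundle ι)
    (he : IsSliceChart ι e) (he' : IsSliceChart ι e') {G : M × Y → Y}
    (hG : ContMDiffAt (I.prod (𝓡∂ d)) (𝓡∂ d) ∞ G (m, (f m).proj))
    (hGd : ∀ m', MDifferentiable (𝓡∂ d) (𝓡∂ d) fun y => G (m', y))
    (hy : (f m).proj ∈ e.source) (hy' : (f' m).proj ∈ e'.source)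
    (hproj : ∀ m', (f' m').proj = G (m', (f m').proj))
    (hrange : ∀ m' y, G (m', y) ∈ range ι ↔ y ∈ range ι)
    (hray : ∀ m' w v w', IsRayOf (f m') w v → ι w' = G (m', ι w) →
      IsRayOf (f' m') w' (mfderiv (𝓡∂ d) (𝓡∂ d) (fun y => G (m', y)) (ι w) v)) :
    HasSmoothDirection I e' f' s m := by
  obtain ⟨h, hh, h0, hev⟩ := hdir
  obtain ⟨i, hi⟩ := Function.ne_iff.1 h0
  obtain ⟨w₀, hw₀⟩ := mem_sphereBundle_iff.1 hfm
  have hyw : ι w₀ ∈ e.source := hw₀ ▸ hy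
  set y : M → Y := fun m => (f m).proj with hydef
  have hyc : Tendsto y (𝓝[s] m) (𝓝 (y m)) := hp.continuousWithinAt
  have hn : ContMDiffWithinAt I 𝓘(ℝ, Normal k d) ∞ (fun m' => normalCoord k e (y m')) s m :=
    ContMDiffAt.comp_contMDiffWithinAt (g := normalCoord k e) m
      (contMDiffAt_normalCoord he.mem_maximalAtlas hy) hp
  set r : M → ℝ := fun m' => normalCoord k e (y m') i / h m' i with hr_def
  have hr : ContMDiffWithinAt I 𝓘(ℝ, ℝ) ∞ r s m :=
    ContMDiffWithinAt.div₀ (contMDiffWithinAt_pi_space.1 hn i)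
      (contMDiffWithinAt_pi_space.1 hh i) hi
  have hn0 : normalCoord k e (y m) = 0 := by
    rw [← he.mem_range_iff _ hy]; exact ⟨w₀, hw₀⟩
  have hr0 : r m = 0 := by simp [hr_def, hn0]
  set ρ : Y → Y := fun y => normalShift e y (-normalCoord k e y) with hρ
  have hρ0 : ρ (y m) = y m := by rw [hρ]; simp only [hn0, neg_zero]; exact normalShift_zero hy
  have htgt : addNormal (e (y m)) (-normalCoord k e (y m)) ∈ e.target := by
    rw [hn0, neg_zero, addNormal_zero]; exact e.map_source hy
  set g : ((M × Y) × Normal k d) × ℝ → Normal k d := fun z =>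
    normalCoord k e' (G (z.1.1.1, normalShift e (ρ z.1.1.2) (z.2 • z.1.2))) with hg_def
  have hg : ContMDiffAt (((I.prod (𝓡∂ d)).prod 𝓘(ℝ, Normal k d)).prod 𝓘(ℝ, ℝ))
      𝓘(ℝ, Normal k d) ∞ g (((m, y m), h m), 0) := by
    have hS : ContMDiffAt (((I.prod (𝓡∂ d)).prod 𝓘(ℝ, Normal k d)).prod 𝓘(ℝ, ℝ)) (𝓡∂ d) ∞
        (fun z : ((M × Y) × Normal k d) × ℝ => normalShift e (ρ z.1.1.2) (z.2 • z.1.2))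
        (((m, y m), h m), 0) := by
      refine ContMDiffAt.comp (I' := (𝓡∂ d).prod 𝓘(ℝ, Normal k d))
        (g := fun p : Y × Normal k d => normalShift e p.1 p.2)
        (f := fun z : ((M × Y) × Normal k d) × ℝ => (ρ z.1.1.2, z.2 • z.1.2)) _
        (contMDiffAt_normalShift he.mem_maximalAtlas ?_ ?_) (ContMDiffAt.prodMk ?_ ?_)
      · simpa only [hρ0] using hy
      · simp only [hρ0, zero_smul, addNormal_zero]; exact e.map_source hy
      · exact ContMDiffAt.comp (g := ρ)
          (f := fun z : ((M × Y) × Normal k d) × ℝ => z.1.1.2) _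
          (contMDiffAt_normalShift_neg he.mem_maximalAtlas hy htgt)
          ((contMDiffAt_snd.comp _ contMDiffAt_fst).comp _ contMDiffAt_fst)
      · exact contMDiffAt_snd.smul (contMDiffAt_snd.comp _ contMDiffAt_fst)
    have hS0 : normalShift e (ρ (y m)) ((0 : ℝ) • h m) = y m := by
      rw [hρ0, zero_smul, normalShift_zero hy]
    refine ContMDiffAt.comp (g := normalCoord k e') _
      (contMDiffAt_normalCoord he'.mem_maximalAtlas ?_)
      (ContMDiffAt.comp (g := G) (I' := I.prod (𝓡∂ d)) _ ?_ (ContMDiffAt.prodMk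
        ((contMDiffAt_fst.comp _ contMDiffAt_fst).comp _ contMDiffAt_fst) hS))
    · simp only [hS0]; rw [← hproj]; exact hy'
    · simp only [hS0]; exact hG
  have hD := contMDiffAt_dslope hg
  have hinner : ContMDiffWithinAt I (((I.prod (𝓡∂ d)).prod 𝓘(ℝ, Normal k d)).prod 𝓘(ℝ, ℝ)) ∞
      (fun m' => (((m', y m'), h m'), r m')) s m :=
    ((contMDiffWithinAt_id.prodMk hp).prodMk hh).prodMk hr
  set D : ((M × Y) × Normal k d) × ℝ → Normal k d :=
    fun z => dslope (fun t => g (z.1, t)) 0 z.2 with hD_def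
  have hDc : ContMDiffWithinAt I 𝓘(ℝ, Normal k d) ∞
      (fun m' => D (((m', y m'), h m'), r m')) s m := by
    refine ContMDiffAt.comp_contMDiffWithinAt (g := D) m ?_ hinner
    rw [hr0]; exact hD
  -- `G` and the auxiliary maps are well behaved at `m'` near `m`
  have hG' : ∀ᶠ p in 𝓝 (m, y m), G p ∈ e'.source := by
    refine hG.continuousAt.eventually_mem (e'.open_source.mem_nhds ?_)
    rw [← hproj]; exact hy'
  have hpair : Tendsto (fun m' => (m', y m')) (𝓝[s] m) (𝓝 (m, y m)) :=
    (tendsto_id.mono_left nhdsWithin_le_nhds).prodMk_nhds hyc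
  have hρc : Tendsto (fun m' => (m', ρ (y m'))) (𝓝[s] m) (𝓝 (m, y m)) := by
    refine (tendsto_id.mono_left nhdsWithin_le_nhds).prodMk_nhds ?_
    have := (contMDiffAt_normalShift_neg he.mem_maximalAtlas hy htgt).continuousAt.tendsto.comp hyc
    have h2 : normalShift e (y m) (-normalCoord k e (y m)) = y m := hρ0
    rwa [h2] at this
  have hkey : ∀ᶠ m' in 𝓝[s] m,
      SameRay ℝ (direction e' (f' m')) (D (((m', y m'), h m'), r m')) ∧
      (f m' ∈ sphereBundle ι → D (((m', y m'), h m'), r m') ≠ 0) := by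
    have hi' : ∀ᶠ m' in 𝓝[s] m, h m' i ≠ 0 :=
      (contMDiffWithinAt_pi_space.1 hh i).continuousWithinAt.eventually_ne hi
    have hsrc := hyc.eventually (e.open_source.eventually_mem hy)
    have htg := hyc.eventually
      ((continuousAt_addNormal_neg hy).eventually_mem (e.open_target.mem_nhds htgt))
    filter_upwards [hev, hi', hsrc, htg, hpair.eventually hG',
      hρc.eventually hG'] with m' hm1 hm2 hm3 hm4 hm6 hm7
    have hg0 : g (((m', y m'), h m'), 0) = 0 := by
      simp only [hg_def, zero_smul]
      have h1 : ρ (y m') ∈ e.source := normalShift_mem_source hm4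
      rw [normalShift_zero h1, ← he'.mem_range_iff _ hm7, hrange, he.mem_range_iff _ h1, hρ]
      simp only
      rw [normalCoord_normalShift hm4, add_neg_cancel]
    by_cases hs : f m' ∈ sphereBundle ι
    · obtain ⟨w, v, hv⟩ := exists_isRayOf hs
      have hyw' : y m' = ι w := hv.proj_eq
      have hws : ι w ∈ e.source := hyw' ▸ hm3
      have hhm : h m' ≠ 0 := fun h => hm2 (by rw [h]; rfl)
      have hr' := isRayOf_normalVector hι he hws hhm hyw' hm1
      obtain ⟨w', hw'⟩ : G (m', ι w) ∈ range ι := (hrange _ _).2 ⟨w, rfl⟩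
      have hr2 := hray m' w _ w' hr' hw'
      have hnw : normalCoord k e (ι w) = 0 := he.normalCoord_eq_zero hws
      have hrm : r m' = 0 := by simp [hr_def, hyw', hnw]
      have hρw : ρ (y m') = ι w := by
        rw [hρ]; simp only [hyw', hnw, neg_zero]; exact normalShift_zero hws
      have hGw' : ι w' ∈ e'.source := by rw [hw', ← hyw']; exact hm6
      have hDv : D (((m', y m'), h m'), r m') = normalDeriv k e' (ι w')
          (mfderiv (𝓡∂ d) (𝓡∂ d) (fun y => G (m', y)) (ι w) (normalVector e (ι w) (h m'))) := by
        simp only [hD_def, hrm, dslope_same, hg_def, hρw]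
        have hGm := hGd m' (ι w)
        have hn' : MDifferentiableAt (𝓡∂ d) 𝓘(ℝ, Normal k d) (normalCoord k e') (G (m', ι w)) := by
          rw [← hw']; exact mdifferentiableAt_normalCoord he'.mem_maximalAtlas hGw'
        have hc := (contMDiffAt_normalShift_curve he.mem_maximalAtlas hws (h m')).mdifferentiableAt
          (by simp)
        refine (deriv_comp_curve (g := fun y => normalCoord k e' (G (m', y)))
          (γ := fun t : ℝ => normalShift e (ι w) (t • h m'))
          (by rw [zero_smul, normalShift_zero hws])
          (MDifferentiableAt.comp (g := normalCoord k e') (ι w) hn' hGm) hc).trans ?_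
        have h3 := DFunLike.congr_fun (mfderiv_comp (ι w) hn' hGm) (normalVector e (ι w) (h m'))
        refine h3.trans ?_
        rw [hw']
        rfl
      rw [hDv]
      have := hr2.sameRay_direction hι he' hGw'
      exact ⟨this.2, fun _ => hr2.normalDeriv_ne_zero hι he' hGw'⟩
    · refine ⟨?_, fun h => (hs h).elim⟩
      have hs' : f' m' ∉ sphereBundle ι := by
        rw [mem_sphereBundle_iff, hproj, hrange, ← mem_sphereBundle_iff]; exact hs
      rw [direction_off hs] at hm1
      have hnn : normalCoord k e (y m') ≠ 0 := by
        have := direction_ne_zero hι he (x := f m') hm3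
        rwa [direction_off hs] at this
      have hhm : h m' ≠ 0 := fun h => hm2 (by rw [h]; rfl)
      obtain ⟨c, hc, hcn⟩ := hm1.exists_pos_right hnn hhm
      have hcr : r m' = c := by
        have h1 : normalCoord k e (y m') = c • h m' := hcn
        simp only [hr_def, h1, Pi.smul_apply, smul_eq_mul]
        field_simp
      have h1 : g (((m', y m'), h m'), r m') = direction e' (f' m') := by
        rw [direction_off hs', hproj]
        simp only [hg_def]
        congr 2
        rw [hcr, ← hcn]
        simp only [hρ]
        have h5 : normalShift e (normalShift e (y m') (-normalCoord k e (y m')))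
            (normalCoord k e (y m')) = y m' := by
          rw [normalShift_normalShift hm4, neg_add_cancel, normalShift_zero hm3]
        rw [show (f m').proj = y m' from rfl, h5]
      have h2 := eq_add_smul_dslope (fun t => g (((m', y m'), h m'), t)) (r m')
      simp only [hg0, zero_add] at h2
      rw [← h1, h2, hcr]
      exact SameRay.sameRay_pos_smul_left _ hc
  refine ⟨fun m' => D (((m', y m'), h m'), r m'), hDc, ?_, hkey.mono fun _ h => h.1⟩
  exact (hkey.self_of_nhdsWithin hm).2 hfm

/-- It is enough to check the direction in one slice chart. -/
theorem SmoothLift.of_hasSmoothDirection (hclosed : IsClosed (range ι)) (hm : m ∈ s)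
    (hp : ContMDiffWithinAt I (𝓡∂ d) ∞ (fun m => (f m).proj) s m) (he : IsSliceChart ι e)
    (hy : (f m).proj ∈ e.source) (hdir : HasSmoothDirection I e f s m) : SmoothLift I f s m := by
  refine ⟨hp, fun e' he' hy' => ?_⟩
  by_cases hfm : f m ∈ sphereBundle ι
  · refine hdir.map hι hm hp hfm he he' (G := Prod.snd) contMDiffAt_snd
      (fun _ => mdifferentiable_id) hy hy'
      (fun _ => rfl) (fun _ _ => Iff.rfl) fun m' w v w' hr hw => ?_
    obtain rfl := hι.isEmbedding.injective hw
    have h1 : mfderiv (𝓡∂ d) (𝓡∂ d) (fun y : Y => y) (ι w') v = v :=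
      DFunLike.congr_fun (mfderiv_id (I := 𝓡∂ d) (x := ι w')) v
    have h2 : (mfderiv (𝓡∂ d) (𝓡∂ d) (fun y : Y => y) (ι w') v : EuclideanSpace ℝ (Fin d)) = v := h1
    exact h2.symm ▸ hr
  · exact hasSmoothDirection_of_notMem hι hclosed he' hp hfm hy'

/-- Away from the sphere bundle only the projection matters. -/
theorem SmoothLift.of_notMem (hclosed : IsClosed (range ι))
    (hp : ContMDiffWithinAt I (𝓡∂ d) ∞ (fun m => (f m).proj) s m) (hfm : f m ∉ sphereBundle ι) :
    SmoothLift I f s m :=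
  ⟨hp, fun _ he hy => hasSmoothDirection_of_notMem hι hclosed he hp hfm hy⟩

end SmoothLift

/-! ### Charts of the blow-up -/

section Charts

variable {k d : ℕ} [NeZero k] [NeZero d]
  {W : Type*} [TopologicalSpace W] [ChartedSpace (EuclideanHalfSpace k) W]
  {Y : Type*} [TopologicalSpace Y] [ChartedSpace (EuclideanHalfSpace d) Y]
  [IsManifold (𝓡∂ d) ∞ Y] {ι : C^∞⟮𝓡∂ k, W; 𝓡∂ d, Y⟯}
  {e : OpenPartialHomeomorph Y (EuclideanHalfSpace d)} {i : {j : Fin d // k ≤ (j : ℕ)}} {σ : ℝ}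
  {x : BlowUp ι} {c : PartialEquiv (BlowUp ι) (EuclideanQuadrant d)} {q : EuclideanQuadrant d}

/-- Polar coordinates in the slice chart `e` on the set of directions with nonzero `i`-th
coordinate: the `i`-th coordinate is the absolute value of the `i`-th normal coordinate, and the
other normal coordinates are divided by it.  The exponential function makes the coordinates that
are not bounded by the corners positive. -/
def sphereCoord (e : OpenPartialHomeomorph Y (EuclideanHalfSpace d))
    (i : {j : Fin d // k ≤ (j : ℕ)}) (x : BlowUp ι) : EuclideanQuadrant d :=
  ⟨WithLp.toLp 2 fun j =>
    if h : k ≤ (j : ℕ) then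
      if j = i then |normalCoord k e x.proj i|
      else Real.exp (direction e x ⟨j, h⟩ / |direction e x i|)
    else if j = 0 then (e x.proj).1 0 else Real.exp ((e x.proj).1 j), by
    intro j
    simp only
    split_ifs
    · exact abs_nonneg _
    · exact (Real.exp_pos _).le
    · exact (e x.proj).2
    · exact (Real.exp_pos _).le⟩

/-- The coordinates in the chart `e` with the exponential function applied to all coordinates but
the first. -/
def complementCoord (e : OpenPartialHomeomorph Y (EuclideanHalfSpace d)) (x : BlowUp ι) :
    EuclideanQuadrant d :=
  ⟨WithLp.toLp 2 fun j => if j = 0 then (e x.proj).1 0 else Real.exp ((e x.proj).1 j), by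
    intro j
    simp only
    split_ifs
    · exact (e x.proj).2
    · exact (Real.exp_pos _).le⟩

/-- The direction of the point with given polar coordinates. -/
def polarDirection (i : {j : Fin d // k ≤ (j : ℕ)}) (σ : ℝ) (q : EuclideanQuadrant d) :
    Normal k d :=
  fun j => if j = i then σ else Real.log (q.1 j)

/-- The projection, in the slice chart, of the point with given polar coordinates. -/
def polarBase (i : {j : Fin d // k ≤ (j : ℕ)}) (σ : ℝ) (q : EuclideanQuadrant d) :
    EuclideanHalfSpace d :=
  ⟨WithLp.toLp 2 fun j =>
    if h : k ≤ (j : ℕ) then q.1 i * polarDirection i σ q ⟨j, h⟩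
    else if j = 0 then q.1 0 else Real.log (q.1 j), by
    simp only [not_le_zero_index (k := k), dite_false, if_true]
    exact q.2 0⟩

/-- The point of the half space with given modified coordinates. -/
def complementBase (q : EuclideanQuadrant d) : EuclideanHalfSpace d :=
  ⟨WithLp.toLp 2 fun j => if j = 0 then q.1 0 else Real.log (q.1 j), by
    simp only [if_true]
    exact q.2 0⟩

/-- `c` is the chart given by polar coordinates on the set of points whose direction has an `i`-th
coordinate of the same sign as `σ`. -/
structure IsSphereChart (e : OpenPartialHomeomorph Y (EuclideanHalfSpace d))
    (i : {j : Fin d // k ≤ (j : ℕ)}) (σ : ℝ)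
    (c : PartialEquiv (BlowUp ι) (EuclideanQuadrant d)) : Prop where
  slice : IsSliceChart ι e
  sign : |σ| = 1
  source_eq : c.source = {x | x.proj ∈ e.source ∧ 0 < σ * direction e x i}
  target_eq : c.target =
    {q | (∀ j : Fin d, j ≠ 0 → j ≠ i → 0 < q.1 j) ∧ polarBase i σ q ∈ e.target}
  apply_eq : EqOn c (sphereCoord e i) c.source

/-- `c` is the chart of `Y ∖ W` given by the chart `e` of `Y`. -/
structure IsComplementChart (e : OpenPartialHomeomorph Y (EuclideanHalfSpace d))
    (c : PartialEquiv (BlowUp ι) (EuclideanQuadrant d)) : Prop where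
  mem_maximalAtlas : e ∈ IsManifold.maximalAtlas (𝓡∂ d) ∞ Y
  disjoint : ∀ y ∈ e.source, y ∉ range ι
  source_eq : c.source = {x | x.proj ∈ e.source}
  target_eq : c.target = {q | (∀ j, j ≠ 0 → 0 < q.1 j) ∧ complementBase q ∈ e.target}
  apply_eq : EqOn c (complementCoord e) c.source

/-- The charts of the blow-up. -/
def IsBlowUpChart (c : PartialEquiv (BlowUp ι) (EuclideanQuadrant d)) : Prop :=
  (∃ e i σ, IsSphereChart e i σ c) ∨ ∃ e, IsComplementChart e c

theorem sphereCoord_self : (sphereCoord e i x).1 i = |normalCoord k e x.proj i| := by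
  simp [sphereCoord, i.2]

theorem sphereCoord_normal {j : {j : Fin d // k ≤ (j : ℕ)}} (hj : j ≠ i) :
    (sphereCoord e i x).1 j = Real.exp (direction e x j / |direction e x i|) := by
  have : (j : Fin d) ≠ i := fun h => hj (Subtype.ext h)
  simp [sphereCoord, j.2, this]

theorem sphereCoord_zero : (sphereCoord e i x).1 0 = (e x.proj).1 0 := by
  simp [sphereCoord, NeZero.ne k]

theorem sphereCoord_tangent {j : Fin d} (hj : ¬ k ≤ (j : ℕ)) (h0 : j ≠ 0) :
    (sphereCoord e i x).1 j = Real.exp ((e x.proj).1 j) := by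
  simp [sphereCoord, hj, h0]

theorem complementCoord_zero : (complementCoord e x).1 0 = (e x.proj).1 0 := by
  simp [complementCoord]

theorem complementCoord_of_ne {j : Fin d} (h0 : j ≠ 0) :
    (complementCoord e x).1 j = Real.exp ((e x.proj).1 j) := by
  simp [complementCoord, h0]

theorem polarDirection_self : polarDirection i σ q i = σ := by simp [polarDirection]

theorem polarDirection_of_ne {j : {j : Fin d // k ≤ (j : ℕ)}} (hj : j ≠ i) :
    polarDirection i σ q j = Real.log (q.1 j) := by simp [polarDirection, hj]

theorem polarDirection_ne_zero (hσ : |σ| = 1) : polarDirection i σ q ≠ 0 := fun h => by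
  have := congrFun h i
  rw [polarDirection_self] at this
  simp [this] at hσ

theorem normalPart_polarBase : normalPart k (polarBase i σ q) = q.1 i • polarDirection i σ q := by
  ext j
  simp [normalPart, polarBase, j.2]

theorem polarBase_zero : (polarBase i σ q).1 0 = q.1 0 := by
  simp [polarBase, NeZero.ne k]

theorem polarBase_tangent {j : Fin d} (hj : ¬ k ≤ (j : ℕ)) (h0 : j ≠ 0) :
    (polarBase i σ q).1 j = Real.log (q.1 j) := by
  simp [polarBase, hj, h0]

theorem complementBase_zero : (complementBase q).1 0 = q.1 0 := by simp [complementBase]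

theorem complementBase_of_ne {j : Fin d} (h0 : j ≠ 0) :
    (complementBase q).1 j = Real.log (q.1 j) := by simp [complementBase, h0]

theorem halfSpace_ext {z z' : EuclideanHalfSpace d} (h0 : z.1 0 = z'.1 0)
    (ht : ∀ j : Fin d, ¬ k ≤ (j : ℕ) → j ≠ 0 → z.1 j = z'.1 j)
    (hn : normalPart k z = normalPart k z') : z = z' := by
  refine Subtype.ext (PiLp.ext fun j => ?_)
  by_cases hj : k ≤ (j : ℕ)
  · exact congrFun hn ⟨j, hj⟩
  · by_cases hj0 : j = 0
    · rw [hj0, h0]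
    · exact ht j hj hj0

/-! The inverses of the charts are described by the projection and the direction. -/

variable (hι : IsSmoothEmbedding (𝓡∂ k) (𝓡∂ d) ∞ ι)

theorem exists_normalCoord_eq_smul (he : IsSliceChart ι e) (hx : x.proj ∈ e.source) :
    ∃ t : ℝ, 0 ≤ t ∧ normalCoord k e x.proj = t • direction e x := by
  by_cases hs : x ∈ sphereBundle ι
  · exact ⟨0, le_rfl, by rw [zero_smul, ← he.mem_range_iff _ hx, ← mem_sphereBundle_iff]; exact hs⟩
  · exact ⟨1, zero_le_one, by rw [one_smul, direction_off hs]⟩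

include hι in
theorem exists_proj_direction (he : IsSliceChart ι e) {y : Y} (hy : y ∈ e.source)
    {h : Normal k d} (hh : h ≠ 0) {t : ℝ} (ht : 0 ≤ t) (hn : normalCoord k e y = t • h) :
    ∃ x : BlowUp ι, x.proj = y ∧ SameRay ℝ (direction e x) h := by
  by_cases hr : y ∈ range ι
  · obtain ⟨w, rfl⟩ := hr
    exact exists_direction hι he hy hh
  · refine ⟨.off y hr, rfl, ?_⟩
    have : direction e (BlowUp.off y hr : BlowUp ι) = t • h := hn
    rw [this]
    exact SameRay.sameRay_nonneg_smul_left _ ht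

theorem mul_abs_of_sign {σ a : ℝ} (hσ : |σ| = 1) (h : 0 < σ * a) : σ * |a| = a := by
  rcases (abs_eq zero_le_one).1 hσ with rfl | rfl
  · rw [abs_of_pos (by linarith)]; ring
  · rw [abs_of_neg (by linarith)]; ring

theorem sphereCoord_spec (he : IsSliceChart ι e) (hσ : |σ| = 1) (hx : x.proj ∈ e.source)
    (hi : 0 < σ * direction e x i) :
    polarDirection i σ (sphereCoord e i x) = |direction e x i|⁻¹ • direction e x ∧
      polarBase i σ (sphereCoord e i x) = e x.proj := by
  have hne : direction e x i ≠ 0 := fun h => by simp [h] at hi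
  have h1 : polarDirection i σ (sphereCoord e i x) = |direction e x i|⁻¹ • direction e x := by
    ext j
    by_cases hj : j = i
    · subst hj
      rw [polarDirection_self, Pi.smul_apply, smul_eq_mul]
      nth_rewrite 2 [← mul_abs_of_sign hσ hi]
      have := abs_ne_zero.2 hne
      field_simp
    · rw [polarDirection_of_ne hj, sphereCoord_normal hj, Real.log_exp, Pi.smul_apply, smul_eq_mul]
      ring
  refine ⟨h1, halfSpace_ext (k := k) ?_ ?_ ?_⟩
  · rw [polarBase_zero, sphereCoord_zero]
  · intro j hj h0
    rw [polarBase_tangent hj h0, sphereCoord_tangent hj h0, Real.log_exp]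
  · obtain ⟨t, ht, hn⟩ := exists_normalCoord_eq_smul he hx
    rw [normalPart_polarBase, h1, sphereCoord_self]
    change _ = normalCoord k e x.proj
    rw [hn, Pi.smul_apply, smul_eq_mul, abs_mul, abs_of_nonneg ht, smul_smul]
    congr 1
    have := abs_ne_zero.2 hne
    field_simp

include hι in
theorem sphereCoord_eq (he : IsSliceChart ι e) (hσ : |σ| = 1)
    (hq : ∀ j : Fin d, j ≠ 0 → j ≠ i → 0 < q.1 j) (hqt : polarBase i σ q ∈ e.target)
    (hx : x.proj = e.symm (polarBase i σ q))
    (hd : SameRay ℝ (direction e x) (polarDirection i σ q)) :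
    0 < σ * direction e x i ∧ sphereCoord e i x = q := by
  have hxs : x.proj ∈ e.source := hx ▸ e.map_target hqt
  obtain ⟨a, ha, had⟩ :=
    hd.exists_pos_right (direction_ne_zero hι he hxs) (polarDirection_ne_zero hσ)
  have hσσ : σ * σ = 1 := by rw [← abs_mul_abs_self, hσ, one_mul]
  have hex : e x.proj = polarBase i σ q := by rw [hx, e.right_inv hqt]
  have hi : direction e x i = a * σ := by
    rw [had, Pi.smul_apply, polarDirection_self, smul_eq_mul]
  have hpos : 0 < σ * direction e x i := by
    rw [hi, show σ * (a * σ) = a * (σ * σ) by ring, hσσ, mul_one]; exact ha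
  refine ⟨hpos, Subtype.ext (PiLp.ext fun j => ?_)⟩
  have hai : |direction e x i| = a := by rw [hi, abs_mul, hσ, mul_one, abs_of_pos ha]
  by_cases hj : k ≤ (j : ℕ)
  · lift j to {j : Fin d // k ≤ (j : ℕ)} using hj
    by_cases hji : j = i
    · subst hji
      rw [sphereCoord_self, normalCoord, hex, normalPart_polarBase, Pi.smul_apply,
        polarDirection_self, smul_eq_mul, abs_mul, hσ, mul_one, abs_of_nonneg (q.2 j)]
    · rw [sphereCoord_normal hji, hai, had, Pi.smul_apply, polarDirection_of_ne hji, smul_eq_mul,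
        mul_div_cancel_left₀ _ ha.ne', Real.exp_log]
      refine hq j ?_ fun h => hji (Subtype.ext h)
      rintro h
      have := j.2
      rw [h] at this
      exact not_le_zero_index this
  · have hji : j ≠ i := fun h => hj (h ▸ i.2)
    by_cases h0 : j = 0
    · rw [h0, sphereCoord_zero, hex, polarBase_zero]
    · rw [sphereCoord_tangent hj h0, hex, polarBase_tangent hj h0, Real.exp_log (hq j h0 hji)]

include hι in
theorem exists_isSphereChart (he : IsSliceChart ι e) (hσ : |σ| = 1) (hx : x.proj ∈ e.source)
    (hi : 0 < σ * direction e x i) :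
    ∃ c : PartialEquiv (BlowUp ι) (EuclideanQuadrant d), IsSphereChart e i σ c ∧ x ∈ c.source := by
  have : Nonempty (BlowUp ι) := ⟨x⟩
  have hb : BijOn (sphereCoord e i) {x : BlowUp ι | x.proj ∈ e.source ∧ 0 < σ * direction e x i}
      {q | (∀ j : Fin d, j ≠ 0 → j ≠ i → 0 < q.1 j) ∧ polarBase i σ q ∈ e.target} := by
    refine ⟨fun x hx => ⟨fun j h0 hji => ?_, ?_⟩, fun x hx x' hx' h => ?_, fun q hq => ?_⟩
    · by_cases hj : k ≤ (j : ℕ)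
      · lift j to {j : Fin d // k ≤ (j : ℕ)} using hj
        rw [sphereCoord_normal fun h => hji (by rw [h])]
        exact Real.exp_pos _
      · rw [sphereCoord_tangent hj h0]
        exact Real.exp_pos _
    · rw [(sphereCoord_spec he hσ hx.1 hx.2).2]
      exact e.map_source hx.1
    · obtain ⟨h1, h2⟩ := sphereCoord_spec he hσ hx.1 hx.2
      obtain ⟨h3, h4⟩ := sphereCoord_spec he hσ hx'.1 hx'.2
      have hp : ∀ x : BlowUp ι, 0 < σ * direction e x i → 0 < |direction e x i|⁻¹ := fun x hx =>
        inv_pos.2 (abs_pos.2 fun h => by simp [h] at hx)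
      refine eq_of_direction hι he hx.1 (e.injOn hx.1 hx'.1 (by rw [← h2, ← h4, h])) ?_
      rw [h] at h1
      have h5 : SameRay ℝ (direction e x) (|direction e x i|⁻¹ • direction e x) :=
        SameRay.sameRay_pos_smul_right _ (hp x hx.2)
      rw [← h1, h3] at h5
      have h6 := h5.pos_smul_right (inv_pos.2 (hp x' hx'.2))
      rwa [smul_smul, inv_mul_cancel₀ (hp x' hx'.2).ne', one_smul] at h6
    · obtain ⟨x, h1, h2⟩ := exists_proj_direction hι he (e.map_target hq.2)
        (polarDirection_ne_zero (i := i) (q := q) hσ) (q.2 i)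
        (by rw [normalCoord, e.right_inv hq.2, normalPart_polarBase])
      obtain ⟨h3, h4⟩ := sphereCoord_eq hι he hσ hq.1 hq.2 h1 h2
      exact ⟨x, ⟨h1 ▸ e.map_target hq.2, h3⟩, h4⟩
  exact ⟨BijOn.toPartialEquiv _ _ _ hb, ⟨he, hσ, rfl, rfl, fun _ _ => rfl⟩, hx, hi⟩

theorem exists_isComplementChart (he : e ∈ IsManifold.maximalAtlas (𝓡∂ d) ∞ Y)
    (hd : ∀ y ∈ e.source, y ∉ range ι) (hx : x.proj ∈ e.source) :
    ∃ c : PartialEquiv (BlowUp ι) (EuclideanQuadrant d), IsComplementChart e c ∧ x ∈ c.source := by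
  have : Nonempty (BlowUp ι) := ⟨x⟩
  have hspec : ∀ x : BlowUp ι, complementBase (complementCoord e x) = e x.proj := by
    intro x
    refine Subtype.ext (PiLp.ext fun j => ?_)
    by_cases hj : j = 0
    · rw [hj, complementBase_zero, complementCoord_zero]
    · rw [complementBase_of_ne hj, complementCoord_of_ne hj, Real.log_exp]
  have hb : BijOn (complementCoord e) {x : BlowUp ι | x.proj ∈ e.source}
      {q | (∀ j, j ≠ 0 → 0 < q.1 j) ∧ complementBase q ∈ e.target} := by
    refine ⟨fun x hx => ⟨fun j h0 => ?_, ?_⟩, fun x hx x' hx' h => ?_, fun q hq => ?_⟩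
    · rw [complementCoord_of_ne h0]
      exact Real.exp_pos _
    · rw [hspec]
      exact e.map_source hx
    · refine eq_of_proj_eq (fun h => hd _ hx' (mem_sphereBundle_iff.1 h)) (e.injOn hx hx' ?_)
      rw [← hspec, ← hspec, h]
    · have h1 := e.map_target hq.2
      refine ⟨.off (e.symm (complementBase q)) (hd _ h1), h1, ?_⟩
      refine Subtype.ext (PiLp.ext fun j => ?_)
      have h2 : (e (BlowUp.off (e.symm (complementBase q)) (hd _ h1) : BlowUp ι).proj) =
        complementBase q := e.right_inv hq.2
      by_cases hj : j = 0
      · rw [hj, complementCoord_zero, h2, complementBase_zero]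
      · rw [complementCoord_of_ne hj, h2, complementBase_of_ne hj, Real.exp_log (hq.1 j hj)]
  exact ⟨BijOn.toPartialEquiv _ _ _ hb, ⟨he, hd, rfl, rfl, fun _ _ => rfl⟩, hx⟩

end Charts

/-! ### Smoothness of the charts of the blow-up -/

section ChartSmoothness

variable {k d : ℕ} [NeZero k] [NeZero d]
  {W : Type*} [TopologicalSpace W] [ChartedSpace (EuclideanHalfSpace k) W]
  {Y : Type*} [TopologicalSpace Y] [ChartedSpace (EuclideanHalfSpace d) Y]
  [IsManifold (𝓡∂ d) ∞ Y] {ι : C^∞⟮𝓡∂ k, W; 𝓡∂ d, Y⟯}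
  {e : OpenPartialHomeomorph Y (EuclideanHalfSpace d)} {i : {j : Fin d // k ≤ (j : ℕ)}} {σ : ℝ}
  {x : BlowUp ι} {c : PartialEquiv (BlowUp ι) (EuclideanQuadrant d)} {q : EuclideanQuadrant d}
  {E : Type} [NormedAddCommGroup E] [NormedSpace ℝ E] {H M : Type*} [TopologicalSpace H]
  [TopologicalSpace M] [ChartedSpace H M] {I : ModelWithCorners ℝ E H}
  {f : M → BlowUp ι} {s : Set M} {m : M}

theorem ContMDiffWithinAt.exp {g : M → ℝ} (hg : ContMDiffWithinAt I 𝓘(ℝ, ℝ) ∞ g s m) :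
    ContMDiffWithinAt I 𝓘(ℝ, ℝ) ∞ (fun m => Real.exp (g m)) s m :=
  (Real.contDiff_exp.contMDiff.contMDiffAt).comp_contMDiffWithinAt m hg

theorem contMDiffAt_log_apply {j : Fin d} (hj : q.1 j ≠ 0) :
    ContMDiffAt (modelWithCornersEuclideanQuadrant d) 𝓘(ℝ, ℝ) ∞
      (fun q : EuclideanQuadrant d => Real.log (q.1 j)) q :=
  ContMDiffAt.comp (g := Real.log) q (Real.contDiffAt_log.2 hj).contMDiffAt
    (contMDiff_quadrant_apply j q)

theorem contMDiffAt_polarDirection (hq : ∀ j : Fin d, j ≠ 0 → j ≠ i → 0 < q.1 j) :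
    ContMDiffAt (modelWithCornersEuclideanQuadrant d) 𝓘(ℝ, Normal k d) ∞
      (polarDirection i σ) q := by
  refine contMDiffAt_pi_space.2 fun j => ?_
  by_cases hj : j = i
  · subst hj
    simp only [polarDirection_self]
    exact contMDiffAt_const
  · simp only [polarDirection_of_ne hj]
    refine contMDiffAt_log_apply (hq j ?_ fun h => hj (Subtype.ext h)).ne'
    intro h
    have := j.2
    rw [h] at this
    exact not_le_zero_index this

theorem contMDiffAt_polarBase (hq : ∀ j : Fin d, j ≠ 0 → j ≠ i → 0 < q.1 j) :
    ContMDiffAt (modelWithCornersEuclideanQuadrant d) (𝓡∂ d) ∞ (polarBase i σ) q := by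
  refine contMDiffWithinAt_halfSpace_iff.2 fun j => ?_
  by_cases hj : k ≤ (j : ℕ)
  · have h1 : ∀ q : EuclideanQuadrant d,
        (polarBase i σ q).1 j = q.1 i * polarDirection i σ q ⟨j, hj⟩ := fun q =>
      congrFun (normalPart_polarBase (q := q)) ⟨j, hj⟩
    simp only [h1]
    exact (contMDiff_quadrant_apply i.1 q).mul
      (contMDiffAt_pi_space.1 (contMDiffAt_polarDirection hq) ⟨j, hj⟩)
  · by_cases h0 : j = 0
    · subst h0
      simp only [polarBase_zero]
      exact contMDiff_quadrant_apply 0 q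
    · simp only [polarBase_tangent hj h0]
      exact contMDiffAt_log_apply (hq j h0 fun h => hj (h ▸ i.2)).ne'

theorem contMDiffAt_complementBase (hq : ∀ j : Fin d, j ≠ 0 → 0 < q.1 j) :
    ContMDiffAt (modelWithCornersEuclideanQuadrant d) (𝓡∂ d) ∞ complementBase q := by
  refine contMDiffWithinAt_halfSpace_iff.2 fun j => ?_
  by_cases h0 : j = 0
  · subst h0
    simp only [complementBase_zero]
    exact contMDiff_quadrant_apply 0 q
  · simp only [complementBase_of_ne h0]
    exact contMDiffAt_log_apply (hq j h0).ne'

theorem continuous_quadrant_apply (j : Fin d) :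
    Continuous fun q : EuclideanQuadrant d => q.1 j :=
  (contMDiff_quadrant_apply (n := 0) j).continuous

theorem IsSphereChart.isOpen_target (hc : IsSphereChart e i σ c) : IsOpen c.target := by
  rw [hc.target_eq, isOpen_iff_mem_nhds]
  intro q hq
  have h1 : ∀ᶠ q' : EuclideanQuadrant d in 𝓝 q, ∀ j : Fin d, j ≠ 0 → j ≠ i → 0 < q'.1 j :=
    eventually_all.2 fun j => eventually_imp_distrib_left.2 fun h0 =>
      eventually_imp_distrib_left.2 fun hi =>
        (continuous_quadrant_apply j).continuousAt.eventually_const_lt (hq.1 j h0 hi)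
  exact h1.and ((contMDiffAt_polarBase hq.1).continuousAt.eventually_mem
    (e.open_target.mem_nhds hq.2))

theorem IsComplementChart.isOpen_target (hc : IsComplementChart e c) : IsOpen c.target := by
  rw [hc.target_eq, isOpen_iff_mem_nhds]
  intro q hq
  have h1 : ∀ᶠ q' : EuclideanQuadrant d in 𝓝 q, ∀ j : Fin d, j ≠ 0 → 0 < q'.1 j :=
    eventually_all.2 fun j => eventually_imp_distrib_left.2 fun h0 =>
        (continuous_quadrant_apply j).continuousAt.eventually_const_lt (hq.1 j h0)
  exact h1.and ((contMDiffAt_complementBase hq.1).continuousAt.eventually_mem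
    (e.open_target.mem_nhds hq.2))

theorem IsBlowUpChart.isOpen_target (hc : IsBlowUpChart c) : IsOpen c.target := by
  obtain ⟨e, i, σ, hc⟩ | ⟨e, hc⟩ := hc
  · exact hc.isOpen_target
  · exact hc.isOpen_target

theorem IsSphereChart.symm_spec (hc : IsSphereChart e i σ c) (hq : q ∈ c.target) :
    (c.symm q).proj = e.symm (polarBase i σ q) ∧
      SameRay ℝ (direction e (c.symm q)) (polarDirection i σ q) := by
  have hs := c.map_target hq
  have h1 : sphereCoord e i (c.symm q) = q := by rw [← hc.apply_eq hs, c.right_inv hq]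
  rw [hc.source_eq] at hs
  obtain ⟨h2, h3⟩ := sphereCoord_spec hc.slice hc.sign hs.1 hs.2
  rw [h1] at h2 h3
  refine ⟨by rw [h3, e.left_inv hs.1], ?_⟩
  rw [h2]
  refine SameRay.sameRay_pos_smul_right _ (inv_pos.2 (abs_pos.2 fun h => ?_))
  simpa [h] using hs.2

theorem IsComplementChart.symm_spec (hc : IsComplementChart e c) (hq : q ∈ c.target) :
    (c.symm q).proj = e.symm (complementBase q) := by
  have hs := c.map_target hq
  have h1 : complementCoord e (c.symm q) = q := by rw [← hc.apply_eq hs, c.right_inv hq]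
  rw [hc.source_eq] at hs
  rw [← e.left_inv hs]
  congr 1
  refine Subtype.ext (PiLp.ext fun j => ?_)
  by_cases h0 : j = 0
  · rw [h0, complementBase_zero, ← complementCoord_zero, h1]
  · nth_rewrite 2 [← h1]
    rw [complementBase_of_ne h0, complementCoord_of_ne h0, Real.log_exp]

variable (hι : IsSmoothEmbedding (𝓡∂ k) (𝓡∂ d) ∞ ι)
include hι

/-- The inverse of a chart of the blow-up is smooth. -/
theorem IsBlowUpChart.smoothLift_symm (hclosed : IsClosed (range ι)) (hc : IsBlowUpChart c)
    (hq : q ∈ c.target) : SmoothLift (modelWithCornersEuclideanQuadrant d) c.symm univ q := by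
  have hnh := hc.isOpen_target.mem_nhds hq
  obtain ⟨e, i, σ, hc⟩ | ⟨e, hc⟩ := hc
  · have hq' := hq
    rw [hc.target_eq] at hq'
    have hs := c.map_target hq
    rw [hc.source_eq] at hs
    have hp : ContMDiffAt (modelWithCornersEuclideanQuadrant d) (𝓡∂ d) ∞
        (fun q => (c.symm q).proj) q := by
      refine (ContMDiffAt.comp (g := e.symm) q (contMDiffAt_symm_of_mem_maximalAtlas
        hc.slice.mem_maximalAtlas hq'.2)
        (contMDiffAt_polarBase hq'.1)).congr_of_eventuallyEq ?_
      filter_upwards [hnh] with q' h' using (hc.symm_spec h').1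
    refine SmoothLift.of_hasSmoothDirection hι hclosed (mem_univ _) hp hc.slice hs.1
      ⟨polarDirection i σ, contMDiffAt_polarDirection hq'.1, polarDirection_ne_zero hc.sign, ?_⟩
    rw [nhdsWithin_univ]
    filter_upwards [hnh] with q' h' using (hc.symm_spec h').2
  · have hq' := hq
    rw [hc.target_eq] at hq'
    have hs := c.map_target hq
    rw [hc.source_eq] at hs
    refine SmoothLift.of_notMem hι hclosed ?_ fun h => hc.disjoint _ hs (mem_sphereBundle_iff.1 h)
    refine ContMDiffAt.congr_of_eventuallyEq (ContMDiffAt.comp (g := e.symm) q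
      (contMDiffAt_symm_of_mem_maximalAtlas hc.mem_maximalAtlas hq'.2)
        (contMDiffAt_complementBase hq'.1)) ?_
    filter_upwards [hnh] with q' h' using hc.symm_spec h'

/-- The coordinates of a smooth map into the blow-up are smooth. -/
theorem IsSphereChart.contMDiffWithinAt (hc : IsSphereChart e i σ c) (hf : SmoothLift I f s m)
    (hm : m ∈ s) (hfm : f m ∈ c.source) : (∀ᶠ m' in 𝓝[s] m, f m' ∈ c.source) ∧
      ContMDiffWithinAt I (modelWithCornersEuclideanQuadrant d) ∞ (fun m => c (f m)) s m := by
  have hfm' := hfm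
  rw [hc.source_eq] at hfm'
  obtain ⟨h, hh, h0, hev⟩ := hf.direction e hc.slice hfm'.1
  have hsrc : ∀ᶠ m' in 𝓝[s] m, (f m').proj ∈ e.source :=
    hf.proj.continuousWithinAt.eventually_mem (e.open_source.mem_nhds hfm'.1)
  have hpos : 0 < σ * h m i := by
    obtain ⟨a, ha, had⟩ := (hev.self_of_nhdsWithin hm).exists_pos_right
      (direction_ne_zero hι hc.slice hfm'.1) h0
    have := hfm'.2
    rw [had, Pi.smul_apply, smul_eq_mul, mul_left_comm] at this
    exact (pos_iff_pos_of_mul_pos this).1 ha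
  have hhi : ContMDiffWithinAt I 𝓘(ℝ, ℝ) ∞ (fun m => h m i) s m := contMDiffWithinAt_pi_space.1 hh i
  have hpos' : ∀ᶠ m' in 𝓝[s] m, 0 < σ * h m' i :=
    (continuousWithinAt_const.mul hhi.continuousWithinAt).eventually_const_lt hpos
  have hray : ∀ᶠ m' in 𝓝[s] m, ∃ a : ℝ, 0 < a ∧ direction e (f m') = a • h m' := by
    filter_upwards [hev, hsrc, hpos'] with m' h1 h2 h3
    exact h1.exists_pos_right (direction_ne_zero hι hc.slice h2) fun h => by simp [h] at h3
  have hmem : ∀ᶠ m' in 𝓝[s] m, f m' ∈ c.source := by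
    filter_upwards [hray, hsrc, hpos'] with m' ⟨a, ha, h1⟩ h2 h3
    rw [hc.source_eq]
    refine ⟨h2, ?_⟩
    rw [h1, Pi.smul_apply, smul_eq_mul, mul_left_comm]
    exact mul_pos ha h3
  refine ⟨hmem, contMDiffWithinAt_quadrant_iff.2 fun j => ?_⟩
  have hcong : ∀ {g : M → ℝ}, ContMDiffWithinAt I 𝓘(ℝ, ℝ) ∞ g s m →
      (∀ᶠ m' in 𝓝[s] m, (sphereCoord e i (f m')).1 j = g m') →
      ContMDiffWithinAt I 𝓘(ℝ, ℝ) ∞ (fun m => (c (f m)).1 j) s m := by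
    intro g hg hgc
    have hgc' : (fun m => (c (f m)).1 j) =ᶠ[𝓝[s] m] g := by
      filter_upwards [hgc, hmem] with m' h1 h2
      rw [hc.apply_eq h2, h1]
    exact hg.congr_of_eventuallyEq_of_mem hgc' hm
  have hchart : ContMDiffWithinAt I (𝓡∂ d) ∞ (fun m => e (f m).proj) s m :=
    ContMDiffAt.comp_contMDiffWithinAt (g := e) m
      (contMDiffAt_of_mem_maximalAtlas hc.slice.mem_maximalAtlas hfm'.1) hf.proj
  have hchart' := contMDiffWithinAt_halfSpace_iff.1 hchart
  have hhi0 : σ * h m i ≠ 0 := hpos.ne'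
  by_cases hj : k ≤ (j : ℕ)
  · lift j to {j : Fin d // k ≤ (j : ℕ)} using hj
    by_cases hji : j = i
    · subst hji
      refine hcong (g := fun m => σ * (e (f m).proj).1 j)
        (contMDiffWithinAt_const.mul (hchart' j)) ?_
      filter_upwards [hmem] with m' hm'
      rw [hc.source_eq] at hm'
      obtain ⟨t, ht, hn⟩ := exists_normalCoord_eq_smul hc.slice hm'.1
      rw [sphereCoord_self]
      change |normalCoord k e (f m').proj j| = σ * normalCoord k e (f m').proj j
      have h1 : 0 ≤ σ * normalCoord k e (f m').proj j := by
        rw [hn, Pi.smul_apply, smul_eq_mul, mul_left_comm]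
        exact mul_nonneg ht hm'.2.le
      rw [← abs_of_nonneg h1, abs_mul, hc.sign, one_mul]
    · refine hcong (g := fun m => Real.exp (h m j / (σ * h m i))) (ContMDiffWithinAt.exp
        ((contMDiffWithinAt_pi_space.1 hh j).div₀ (contMDiffWithinAt_const.mul hhi) hhi0)) ?_
      filter_upwards [hray, hpos'] with m' ⟨a, ha, h1⟩ h3
      have h4 : |h m' i| = σ * h m' i := by
        rw [← abs_of_pos h3, abs_mul, hc.sign, one_mul]
      rw [sphereCoord_normal hji, h1, Pi.smul_apply, Pi.smul_apply, smul_eq_mul, smul_eq_mul,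
        abs_mul, abs_of_pos ha, h4, mul_div_mul_left _ _ ha.ne']
  · by_cases h0 : j = 0
    · subst h0
      exact hcong (hchart' 0) (Eventually.of_forall fun _ => sphereCoord_zero)
    · exact hcong (ContMDiffWithinAt.exp (hchart' j))
        (Eventually.of_forall fun _ => sphereCoord_tangent hj h0)

theorem IsBlowUpChart.contMDiffWithinAt (hc : IsBlowUpChart c) (hf : SmoothLift I f s m)
    (hm : m ∈ s) (hfm : f m ∈ c.source) : (∀ᶠ m' in 𝓝[s] m, f m' ∈ c.source) ∧
      ContMDiffWithinAt I (modelWithCornersEuclideanQuadrant d) ∞ (fun m => c (f m)) s m := by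
  obtain ⟨e, i, σ, hc⟩ | ⟨e, hc⟩ := hc
  · exact hc.contMDiffWithinAt hι hf hm hfm
  · have hfm' := hfm
    rw [hc.source_eq] at hfm'
    have hmem : ∀ᶠ m' in 𝓝[s] m, f m' ∈ c.source := by
      rw [hc.source_eq]
      exact hf.proj.continuousWithinAt.eventually_mem (e.open_source.mem_nhds hfm')
    refine ⟨hmem, contMDiffWithinAt_quadrant_iff.2 fun j => ?_⟩
    have hchart : ContMDiffWithinAt I (𝓡∂ d) ∞ (fun m => e (f m).proj) s m :=
      ContMDiffAt.comp_contMDiffWithinAt (g := e) m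
        (contMDiffAt_of_mem_maximalAtlas hc.mem_maximalAtlas hfm') hf.proj
    have hchart' := contMDiffWithinAt_halfSpace_iff.1 hchart
    by_cases h0 : j = 0
    · subst h0
      refine (hchart' 0).congr_of_eventuallyEq_of_mem ?_ hm
      filter_upwards [hmem] with m' hm'
      rw [hc.apply_eq hm', complementCoord_zero]
    · refine (ContMDiffWithinAt.exp (hchart' j)).congr_of_eventuallyEq_of_mem ?_ hm
      filter_upwards [hmem] with m' hm'
      rw [hc.apply_eq hm', complementCoord_of_ne h0]

/-- The charts cover the blow-up. -/
theorem exists_isBlowUpChart [IsManifold (𝓡∂ k) ∞ W] (hclosed : IsClosed (range ι))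
    (hboundary : ι ⁻¹' (𝓡∂ d).boundary Y = (𝓡∂ k).boundary W) (x : BlowUp ι) :
    ∃ c : PartialEquiv (BlowUp ι) (EuclideanQuadrant d), IsBlowUpChart c ∧ x ∈ c.source := by
  by_cases hx : x ∈ sphereBundle ι
  · obtain ⟨w, hw⟩ := mem_sphereBundle_iff.1 hx
    obtain ⟨e, he, hew⟩ := exists_isSliceChart hι hboundary w
    rw [hw] at hew
    obtain ⟨i, hi⟩ := Function.ne_iff.1 (direction_ne_zero hι he hew)
    rcases lt_or_gt_of_ne hi with h | h
    · obtain ⟨c, hc, hxc⟩ := exists_isSphereChart (σ := -1) (i := i) hι he (by simp) hew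
        (by simpa using h)
      exact ⟨c, .inl ⟨_, _, _, hc⟩, hxc⟩
    · obtain ⟨c, hc, hxc⟩ := exists_isSphereChart (σ := 1) (i := i) hι he (by simp) hew
        (by simpa using h)
      exact ⟨c, .inl ⟨_, _, _, hc⟩, hxc⟩
  · have hx' : x.proj ∈ (range ι)ᶜ := fun h => hx (mem_sphereBundle_iff.2 h)
    let e₀ := chartAt (EuclideanHalfSpace d) x.proj
    have he₀ : e₀ ∈ IsManifold.maximalAtlas (𝓡∂ d) ∞ Y := IsManifold.chart_mem_maximalAtlas x.proj
    have hsrc : (e₀.restr (range ι)ᶜ).source = e₀.source ∩ (range ι)ᶜ :=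
      e₀.restr_source' _ hclosed.isOpen_compl
    obtain ⟨c, hc, hxc⟩ := exists_isComplementChart (e := e₀.restr (range ι)ᶜ) (x := x) (ι := ι)
      (restr_mem_maximalAtlas _ he₀ hclosed.isOpen_compl)
      (fun y hy => by rw [hsrc] at hy; exact hy.2)
      (by rw [hsrc]; exact ⟨mem_chart_source _ _, hx'⟩)
    exact ⟨c, .inr ⟨_, hc⟩, hxc⟩

end ChartSmoothness

/-! ### The structure of manifold with corners -/

/-- A `C^n` map between model spaces is `C^n` as a map between subsets of vector spaces. -/
theorem contDiffOn_of_contMDiffOn_model {E H E' H' : Type*} [NormedAddCommGroup E]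
    [NormedSpace ℝ E] [TopologicalSpace H] [NormedAddCommGroup E'] [NormedSpace ℝ E']
    [TopologicalSpace H'] {I : ModelWithCorners ℝ E H} {J : ModelWithCorners ℝ E' H'} {n : ℕ∞ω}
    {f : H → H'} {s : Set H} (hf : ContMDiffOn I J n f s) :
    ContDiffOn ℝ n (J ∘ f ∘ I.symm) (I.symm ⁻¹' s ∩ range I) := by
  intro z hz
  have h := (contMDiffOn_iff.1 hf).2 (I.symm z) (f (I.symm z))
  simp only [chartAt_self_eq, mfld_simps] at h
  rw [inter_comm]
  exact h z ⟨hz.2, hz.1⟩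

theorem secondCountableTopology_of_charts {X H : Type*} [TopologicalSpace X] [TopologicalSpace H]
    [SecondCountableTopology H] {S : Set (Set X)} (hS : S.Countable)
    (h : ∀ s ∈ S, ∃ C : OpenPartialHomeomorph X H, C.source = s) (hcover : ∀ x, ∃ s ∈ S, x ∈ s) :
    SecondCountableTopology X := by
  have : Countable S := hS.to_subtype
  have (s : S) : SecondCountableTopology s.1 := by
    obtain ⟨C, hC⟩ := h s.1 s.2
    rw [← hC]
    exact C.secondCountableTopology_source
  refine TopologicalSpace.secondCountableTopology_of_countable_cover (U := fun s : S => s.1)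
    (fun s => ?_) (eq_univ_of_forall fun x => ?_)
  · obtain ⟨C, hC⟩ := h s.1 s.2
    rw [← hC]
    exact C.open_source
  · obtain ⟨s, hs, hx⟩ := hcover x
    exact mem_iUnion.2 ⟨⟨s, hs⟩, hx⟩

section Structure

variable {k d : ℕ} [NeZero k] [NeZero d]
  {W : Type*} [TopologicalSpace W] [ChartedSpace (EuclideanHalfSpace k) W]
  [IsManifold (𝓡∂ k) ∞ W]
  {Y : Type*} [TopologicalSpace Y] [ChartedSpace (EuclideanHalfSpace d) Y]
  [IsManifold (𝓡∂ d) ∞ Y] {ι : C^∞⟮𝓡∂ k, W; 𝓡∂ d, Y⟯}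

theorem IsBlowUpChart.transition (hι : IsSmoothEmbedding (𝓡∂ k) (𝓡∂ d) ∞ ι)
    (hclosed : IsClosed (range ι)) {c c' : PartialEquiv (BlowUp ι) (EuclideanQuadrant d)}
    (hc : IsBlowUpChart c) (hc' : IsBlowUpChart c') {q : EuclideanQuadrant d}
    (hq : q ∈ (c.symm.trans c').source) :
    (∀ᶠ q' in 𝓝 q, q' ∈ (c.symm.trans c').source) ∧
      ContMDiffAt (modelWithCornersEuclideanQuadrant d) (modelWithCornersEuclideanQuadrant d) ∞
        (c.symm.trans c') q := by
  obtain ⟨h1, h2⟩ := hc'.contMDiffWithinAt hι (hc.smoothLift_symm hι hclosed hq.1) (mem_univ q) hq.2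
  rw [nhdsWithin_univ] at h1
  exact ⟨(hc.isOpen_target.eventually_mem hq.1).and h1, h2⟩

variable (hι : IsSmoothEmbedding (𝓡∂ k) (𝓡∂ d) ∞ ι) (hclosed : IsClosed (range ι))
  (hboundary : ι ⁻¹' (𝓡∂ d).boundary Y = (𝓡∂ k).boundary W)

/-- The charts of the blow-up as a charted space core. -/
def blowUpCore : ChartedSpaceCore (EuclideanQuadrant d) (BlowUp ι) where
  atlas := {c | IsBlowUpChart c}
  chartAt x := (exists_isBlowUpChart hι hclosed hboundary x).choose
  mem_chart_source x := (exists_isBlowUpChart hι hclosed hboundary x).choose_spec.2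
  chart_mem_atlas x := (exists_isBlowUpChart hι hclosed hboundary x).choose_spec.1
  open_source _ _ hc hc' := isOpen_iff_mem_nhds.2 fun _ hq =>
    (IsBlowUpChart.transition hι hclosed hc hc' hq).1
  continuousOn_toFun _ _ hc hc' _ hq :=
    (IsBlowUpChart.transition hι hclosed hc hc' hq).2.continuousAt.continuousWithinAt

/-- The blow-up of `Y` along `W` as a manifold with corners. -/
def blowUpStructure : CornerStructure d (BlowUp ι) where
  top := (blowUpCore hι hclosed hboundary).toTopologicalSpace
  charts := (blowUpCore hι hclosed hboundary).toChartedSpace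
  smooth := by
    let _ := (blowUpCore hι hclosed hboundary).toTopologicalSpace
    let _ := (blowUpCore hι hclosed hboundary).toChartedSpace
    refine isManifold_of_contDiffOn _ _ _ fun e e' he he' => ?_
    have hmem : ∀ e ∈ atlas (EuclideanQuadrant d) (BlowUp ι), IsBlowUpChart e.toPartialEquiv := by
      intro e he
      obtain ⟨c, hc, rfl⟩ : ∃ c, ∃ hc : c ∈ (blowUpCore hι hclosed hboundary).atlas,
          e = (blowUpCore hι hclosed hboundary).openPartialHomeomorph c hc := by
        change e ∈ ⋃ (c : PartialEquiv _ _) (hc : c ∈ (blowUpCore hι hclosed hboundary).atlas),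
          {(blowUpCore hι hclosed hboundary).openPartialHomeomorph c hc} at he
        simpa using he
      exact hc
    refine contDiffOn_of_contMDiffOn_model (f := e.symm ≫ₕ e') fun q hq => ?_
    exact (IsBlowUpChart.transition hι hclosed (hmem e he)
      (hmem e' he') hq).2.contMDiffWithinAt

/-- A chart of the blow-up as an open partial homeomorphism. -/
theorem exists_mem_maximalAtlas {c : PartialEquiv (BlowUp ι) (EuclideanQuadrant d)}
    (hc : IsBlowUpChart c) :
    ∃ C ∈ IsManifold.maximalAtlas (modelWithCornersEuclideanQuadrant d) ∞
      (blowUpStructure hι hclosed hboundary).Space, C.toPartialEquiv = c := by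
  refine ⟨(blowUpCore hι hclosed hboundary).openPartialHomeomorph c hc,
    IsManifold.subset_maximalAtlas ?_, rfl⟩
  exact mem_iUnion₂.2 ⟨c, hc, rfl⟩

theorem isBlowUpChart_chartAt (x : (blowUpStructure hι hclosed hboundary).Space) :
    IsBlowUpChart (chartAt (EuclideanQuadrant d) x).toPartialEquiv :=
  (exists_isBlowUpChart hι hclosed hboundary x).choose_spec.1

variable {E : Type} [NormedAddCommGroup E] [NormedSpace ℝ E] {H M : Type*} [TopologicalSpace H]
  [TopologicalSpace M] [ChartedSpace H M] {I : ModelWithCorners ℝ E H}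

/-- The smooth maps into the blow-up are those with a smooth projection and smooth directions. -/
theorem contMDiffWithinAt_blowUp_of_smoothLift {f : M → BlowUp ι} {s : Set M} {m : M} (hm : m ∈ s)
    (hf : SmoothLift I f s m) : ContMDiffWithinAt I (modelWithCornersEuclideanQuadrant d) ∞
      (fun m => (show (blowUpStructure hι hclosed hboundary).Space from f m)) s m := by
  set A := blowUpStructure hι hclosed hboundary
  let C := chartAt (EuclideanQuadrant d) (show A.Space from f m)
  have hx : (show A.Space from f m) ∈ C.source := mem_chart_source _ _
  obtain ⟨h1, h2⟩ :=
    (isBlowUpChart_chartAt hι hclosed hboundary (f m)).contMDiffWithinAt hι hf hm hx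
  have h3 : ContMDiffAt (modelWithCornersEuclideanQuadrant d) (modelWithCornersEuclideanQuadrant d)
      ∞ C.symm (C (f m)) :=
    contMDiffAt_symm_of_mem_maximalAtlas (IsManifold.chart_mem_maximalAtlas _) (C.map_source hx)
  refine (ContMDiffAt.comp_contMDiffWithinAt (g := C.symm) m
    h3 h2).congr_of_eventuallyEq_of_mem ?_ hm
  filter_upwards [h1] with m' h' using (C.left_inv h').symm

theorem smoothLift_id (x : (blowUpStructure hι hclosed hboundary).Space) :
    SmoothLift (modelWithCornersEuclideanQuadrant d)
      (fun x : (blowUpStructure hι hclosed hboundary).Space => (show BlowUp ι from x)) univ x := by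
  let C := chartAt (EuclideanQuadrant d) x
  have hx : x ∈ C.source := mem_chart_source _ _
  have h1 := (isBlowUpChart_chartAt hι hclosed hboundary x).smoothLift_symm hι hclosed
    (C.map_source hx)
  refine SmoothLift.congr (f := fun z => C.symm (C z))
    (SmoothLift.comp (I' := modelWithCornersEuclideanQuadrant d) (t := univ) (m' := x)
      (f := C.symm) (g := C) h1
      (contMDiffAt_of_mem_maximalAtlas (IsManifold.chart_mem_maximalAtlas _) hx)
      (mapsTo_univ _ _)) ?_ (C.left_inv hx).symm
  rw [nhdsWithin_univ]
  filter_upwards [C.open_source.mem_nhds hx] with m' h' using (C.left_inv h').symm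

theorem contMDiff_proj_blowUp : ContMDiff (modelWithCornersEuclideanQuadrant d) (𝓡∂ d) ∞
    (blowUpStructure hι hclosed hboundary).proj :=
  fun x => (smoothLift_id hι hclosed hboundary x).proj

theorem isClosed_sphere : IsClosed (blowUpStructure hι hclosed hboundary).sphere := by
  have : (blowUpStructure hι hclosed hboundary).sphere =
      (blowUpStructure hι hclosed hboundary).proj ⁻¹' range ι :=
    ext fun x => mem_sphereBundle_iff
  rw [this]
  exact hclosed.preimage (contMDiff_proj_blowUp hι hclosed hboundary).continuous

theorem exists_section_proj (x : BlowUp ι) :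
    ∃ s : Y → BlowUp ι, ∀ y ∈ (range ι)ᶜ, (s y).proj = y := by
  classical
  refine ⟨fun y => if h : y ∉ range ι then .off y h else x, fun y hy => ?_⟩
  exact congrArg BlowUp.proj (dif_pos (show y ∉ range ι from hy))

theorem extendsComplement_blowUp : (blowUpStructure hι hclosed hboundary).ExtendsComplement := by
  refine ⟨(isClosed_sphere hι hclosed hboundary).isOpen_compl, ?_, ?_, ?_⟩
  · intro x _
    exact ⟨(blowUpStructure hι hclosed hboundary).proj, fun _ _ => rfl,
      (contMDiff_proj_blowUp hι hclosed hboundary).contMDiffAt.contMDiffWithinAt⟩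
  · intro x hx x' _ h
    exact (eq_of_proj_eq hx h.symm).symm
  · intro z hz
    have hz' : BlowUp.proj z ∉ range ι := fun h => hz (mem_sphereBundle_iff.2 h)
    obtain ⟨s, hs⟩ := exists_section_proj (ι := ι) z
    have hs' : ∀ y ∈ (range ι)ᶜ, s y ∉ sphereBundle ι := fun y hy h => by
      rw [mem_sphereBundle_iff, hs y hy] at h
      exact hy h
    refine ⟨(range ι)ᶜ, hclosed.isOpen_compl.mem_nhds hz', s, fun y hy => ?_, fun y hy =>
      ⟨mem_univ _, hs' y hy, hs y hy⟩⟩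
    refine contMDiffWithinAt_blowUp_of_smoothLift hι hclosed hboundary hy
      (SmoothLift.of_notMem hι hclosed ?_ (hs' y hy))
    refine contMDiffWithinAt_id.congr_of_eventuallyEq_of_mem ?_ hy
    filter_upwards [self_mem_nhdsWithin] with y' hy' using hs y' hy'

/-! ### Separation and countability -/

theorem t2Space_blowUp [T2Space Y] : T2Space (blowUpStructure hι hclosed hboundary).Space := by
  set A := blowUpStructure hι hclosed hboundary
  refine t2Space_iff_disjoint_nhds.2 fun x x' hxx => ?_
  have hproj : Continuous A.proj := (contMDiff_proj_blowUp hι hclosed hboundary).continuous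
  by_cases hp : A.proj x = A.proj x'
  · have hs : BlowUp.proj x ∈ range ι := by
      by_contra h
      exact hxx (eq_of_proj_eq (fun h' => h (mem_sphereBundle_iff.1 h')) hp.symm).symm
    obtain ⟨w, hw⟩ := hs
    obtain ⟨e, he, hew⟩ := exists_isSliceChart hι hboundary w
    have hN : ∀ z : A.Space, A.proj z ∈ e.source → ContinuousAt
        (fun z : A.Space => ‖direction (ι := ι) e z‖⁻¹ • direction (ι := ι) e z) z := by
      intro z hz
      obtain ⟨h, h1, h2, h3⟩ := (smoothLift_id hι hclosed hboundary z).direction e he hz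
      have hc : ContinuousAt (fun z => ‖h z‖⁻¹ • h z) z := by
        have h1' : ContinuousAt h z := ContMDiffAt.continuousAt h1
        exact (h1'.norm.inv₀ (norm_ne_zero_iff.2 h2)).smul h1'
      refine hc.congr ?_
      rw [nhdsWithin_univ] at h3
      filter_upwards [h3, hproj.continuousAt.eventually_mem (e.open_source.mem_nhds hz),
        (ContMDiffAt.continuousAt h1).eventually_ne h2] with z' h4 h5 h6
      exact ((sameRay_iff_inv_norm_smul_eq_of_ne (direction_ne_zero hι he h5) h6).1 h4).symm
    have hx : A.proj x ∈ e.source := by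
      change BlowUp.proj x ∈ _
      rwa [← hw]
    have hx' : A.proj x' ∈ e.source := by rwa [hp] at hx
    refine (hN x hx).tendsto.disjoint (disjoint_nhds_nhds.2 fun h => hxx ?_) (hN x' hx').tendsto
    exact eq_of_direction hι he hx hp ((sameRay_iff_inv_norm_smul_eq_of_ne
      (direction_ne_zero hι he hx) (direction_ne_zero hι he hx')).2 h)
  · exact hproj.continuousAt.tendsto.disjoint (disjoint_nhds_nhds.2 hp) hproj.continuousAt.tendsto

include hι hclosed hboundary in
theorem exists_nhds_countable_charts (y : Y) :
    ∃ U ∈ 𝓝 y, ∃ S : Set (Set (BlowUp ι)), S.Countable ∧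
      (∀ s ∈ S, ∃ c : PartialEquiv (BlowUp ι) (EuclideanQuadrant d),
        IsBlowUpChart c ∧ c.source = s) ∧ ∀ x : BlowUp ι, x.proj ∈ U → ∃ s ∈ S, x ∈ s := by
  by_cases hy : y ∈ range ι
  · obtain ⟨w, rfl⟩ := hy
    obtain ⟨e, he, hew⟩ := exists_isSliceChart hι hboundary w
    let T : {j : Fin d // k ≤ (j : ℕ)} → ℝ → Set (BlowUp ι) :=
      fun i σ => {x | x.proj ∈ e.source ∧ 0 < σ * direction e x i}
    refine ⟨e.source, e.open_source.mem_nhds hew,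
      {s | s ∈ image2 T univ {1, -1} ∧ s.Nonempty}, ?_, ?_, ?_⟩
    · exact (((to_countable univ).image2 (to_countable {1, -1}) T)).mono fun s hs => hs.1
    · rintro s ⟨⟨i, -, σ, hσ, rfl⟩, x, hx⟩
      have hσ' : |σ| = 1 := by rcases hσ with rfl | rfl <;> simp
      obtain ⟨c, hc, -⟩ := exists_isSphereChart hι he hσ' hx.1 hx.2
      exact ⟨c, .inl ⟨_, _, _, hc⟩, hc.source_eq⟩
    · intro x hx
      obtain ⟨i, hi⟩ := Function.ne_iff.1 (direction_ne_zero hι he hx)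
      rcases lt_or_gt_of_ne hi with h | h
      · have h' : x ∈ T i (-1) := ⟨hx, by simpa using h⟩
        exact ⟨T i (-1), ⟨⟨i, mem_univ _, -1, by simp, rfl⟩, x, h'⟩, h'⟩
      · have h' : x ∈ T i 1 := ⟨hx, by simpa using h⟩
        exact ⟨T i 1, ⟨⟨i, mem_univ _, 1, by simp, rfl⟩, x, h'⟩, h'⟩
  · obtain ⟨c, hc, hxc⟩ := exists_isBlowUpChart hι hclosed hboundary (.off y hy : BlowUp ι)
    set A := blowUpStructure hι hclosed hboundary
    obtain ⟨C, hC, rfl⟩ := exists_mem_maximalAtlas hι hclosed hboundary hc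
    -- `proj` is an open embedding on `Y ∖ W`
    obtain ⟨V, hV, s, hs, hsV⟩ := (extendsComplement_blowUp hι hclosed hboundary).2.smooth_inverse
      (show A.Space from .off y hy) (fun h => hy (mem_sphereBundle_iff.1 h))
    have hsx : ∀ z ∈ V, ∀ x : BlowUp ι, x.proj = z → s z = x := by
      intro z hz x hx
      obtain ⟨_, h1, h2⟩ := hsV z hz
      exact (eq_of_proj_eq h1 (hx.trans h2.symm)).symm
    have hcont : ContinuousAt s y := ((hs y (mem_of_mem_nhds hV)).contMDiffAt hV).continuousAt
    refine ⟨V ∩ s ⁻¹' C.source, inter_mem hV (hcont.preimage_mem_nhds (C.open_source.mem_nhds ?_)),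
      {C.source}, countable_singleton _, ?_, fun x hx => ⟨C.source, rfl, ?_⟩⟩
    · rw [hsx y (mem_of_mem_nhds hV) (.off y hy) rfl]
      exact hxc
    · rintro s rfl
      exact ⟨_, hc, rfl⟩
    · have := hx.2
      rwa [mem_preimage, hsx _ hx.1 x rfl] at this

theorem secondCountableTopology_blowUp [SecondCountableTopology Y] :
    SecondCountableTopology (blowUpStructure hι hclosed hboundary).Space := by
  choose U hU S hSc hS hUS using exists_nhds_countable_charts hι hclosed hboundary
  obtain ⟨t, htc, ht⟩ := TopologicalSpace.countable_cover_nhds hU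
  have : SecondCountableTopology (EuclideanQuadrant d) :=
    TopologicalSpace.Subtype.secondCountableTopology _
  refine secondCountableTopology_of_charts (H := EuclideanQuadrant d)
    (htc.biUnion fun y _ => hSc y) (fun s hs => ?_) (fun x => ?_)
  · obtain ⟨y, -, hsy⟩ := mem_iUnion₂.1 hs
    obtain ⟨c, hc, rfl⟩ := hS y s hsy
    obtain ⟨C, -, rfl⟩ := exists_mem_maximalAtlas hι hclosed hboundary hc
    exact ⟨C, rfl⟩
  · obtain ⟨y, hy, hxy⟩ := mem_iUnion₂.1 (ht ▸ mem_univ (BlowUp.proj x) : BlowUp.proj x ∈ _)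
    obtain ⟨s, hs, hxs⟩ := hUS y x hxy
    exact ⟨s, mem_iUnion₂.2 ⟨y, hy, hs⟩, hxs⟩

end Structure

/-! ### The restriction of the tangent bundle -/

section RestrictedTangent

variable {k d : ℕ} [NeZero k] [NeZero d]
  {W : Type*} [TopologicalSpace W] [ChartedSpace (EuclideanHalfSpace k) W]
  {Y : Type*} [TopologicalSpace Y] [ChartedSpace (EuclideanHalfSpace d) Y]
  [IsManifold (𝓡∂ d) ∞ Y] {ι : C^∞⟮𝓡∂ k, W; 𝓡∂ d, Y⟯}
  {E H M : Type*} [NormedAddCommGroup E] [NormedSpace ℝ E] [TopologicalSpace H]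
  [TopologicalSpace M] [ChartedSpace H M] {I : ModelWithCorners ℝ E H}
  {e : OpenPartialHomeomorph Y (EuclideanHalfSpace d)}

/-- The canonical map `TY|_W → TY`. -/
def toTangent (p : RestrictedTangent ι) : TangentBundle (𝓡∂ d) Y := ⟨ι p.proj, p.snd⟩

/-- The normal coordinates of a vector of `TY|_W` in a slice chart. -/
def normalComponent (e : OpenPartialHomeomorph Y (EuclideanHalfSpace d))
    (p : RestrictedTangent ι) : Normal k d :=
  normalDeriv k e (ι p.proj) p.snd

/-- The vector of `TY|_W` at `w` with coordinates `(0, h)`. -/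
def restrictedVector (ι : C^∞⟮𝓡∂ k, W; 𝓡∂ d, Y⟯)
    (e : OpenPartialHomeomorph Y (EuclideanHalfSpace d)) (w : W) (h : Normal k d) :
    RestrictedTangent ι :=
  ⟨w, normalVector e (ι w) h⟩

/-- Fibrewise scalar multiplication. -/
def scale (r : ℝ) (p : RestrictedTangent ι) : RestrictedTangent ι := ⟨p.proj, r • p.snd⟩

theorem contMDiffAt_restrictedTangent_iff {f : M → RestrictedTangent ι} {m : M} :
    ContMDiffAt I ((𝓡∂ k).prod 𝓘(ℝ, EuclideanSpace ℝ (Fin d))) ∞ f m ↔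
      ContMDiffAt I (𝓡∂ k) ∞ (fun m => (f m).proj) m ∧
        ContMDiffAt I ((𝓡∂ d).prod 𝓘(ℝ, EuclideanSpace ℝ (Fin d))) ∞
          (fun m => toTangent (f m)) m := by
  rw [contMDiffAt_totalSpace, contMDiffAt_totalSpace]
  refine and_congr_right fun h => ?_
  exact ⟨fun h' => ⟨ι.contMDiff.contMDiffAt.comp m h, h'⟩, fun h' => h'.2⟩

theorem contMDiff_restrictedTangent_proj :
    ContMDiff ((𝓡∂ k).prod 𝓘(ℝ, EuclideanSpace ℝ (Fin d))) (𝓡∂ k) ∞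
      (fun p : RestrictedTangent ι => p.proj) :=
  fun _ => (contMDiffAt_restrictedTangent_iff.1 contMDiffAt_id).1

theorem contMDiff_toTangent :
    ContMDiff ((𝓡∂ k).prod 𝓘(ℝ, EuclideanSpace ℝ (Fin d)))
      ((𝓡∂ d).prod 𝓘(ℝ, EuclideanSpace ℝ (Fin d))) ∞ (toTangent (ι := ι)) :=
  fun _ => (contMDiffAt_restrictedTangent_iff.1 contMDiffAt_id).2

theorem contMDiff_scale :
    ContMDiff (((𝓡∂ k).prod 𝓘(ℝ, EuclideanSpace ℝ (Fin d))).prod 𝓘(ℝ, ℝ))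
      ((𝓡∂ k).prod 𝓘(ℝ, EuclideanSpace ℝ (Fin d))) ∞
      (fun z : RestrictedTangent ι × ℝ => scale z.2 z.1) := by
  intro z
  have h1 : ContMDiffAt (((𝓡∂ k).prod 𝓘(ℝ, EuclideanSpace ℝ (Fin d))).prod 𝓘(ℝ, ℝ))
      ((𝓡∂ k).prod 𝓘(ℝ, EuclideanSpace ℝ (Fin d))) ∞
      (fun z : RestrictedTangent ι × ℝ => z.1) z := contMDiffAt_fst
  rw [contMDiffAt_totalSpace] at h1 ⊢
  refine ⟨h1.1, (contMDiffAt_snd.smul h1.2).congr_of_eventuallyEq ?_⟩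
  let t := trivializationAt (EuclideanSpace ℝ (Fin d))
    (ι *ᵖ (TangentSpace (𝓡∂ d) : Y → Type)) z.1.proj
  filter_upwards [h1.1.continuousAt.eventually_mem
    (t.open_baseSet.mem_nhds (FiberBundle.mem_baseSet_trivializationAt' z.1.proj))] with z' hz'
  exact (t.linear ℝ hz').map_smul z'.2 z'.1.snd

theorem contMDiffAt_normalDeriv (he : e ∈ IsManifold.maximalAtlas (𝓡∂ d) ∞ Y)
    {p : TangentBundle (𝓡∂ d) Y} (hp : p.proj ∈ e.source) :
    ContMDiffAt ((𝓡∂ d).prod 𝓘(ℝ, EuclideanSpace ℝ (Fin d))) 𝓘(ℝ, Normal k d) ∞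
      (fun p : TangentBundle (𝓡∂ d) Y => normalDeriv k e p.proj p.snd) p := by
  have h0 : ContMDiffAt ((𝓡∂ d).prod 𝓘(ℝ, EuclideanSpace ℝ (Fin d))) (𝓡∂ d) ∞
      (fun p : TangentBundle (𝓡∂ d) Y => p.proj) p := (contMDiffAt_totalSpace.1 contMDiffAt_id).1
  have h1 := ContMDiffAt.mfderiv (I := 𝓡∂ d) (I' := 𝓘(ℝ, Normal k d)) (n := ∞) (m := ∞)
    (fun (_ : TangentBundle (𝓡∂ d) Y) y => normalCoord k e y)
    (fun p : TangentBundle (𝓡∂ d) Y => p.proj) (x₀ := p)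
    (ContMDiffAt.comp (g := normalCoord k e) (f := Prod.snd) (p, p.proj)
      (contMDiffAt_normalCoord he hp) contMDiffAt_snd) h0 (by simp)
  have h2 := ContMDiffAt.clm_apply_of_inCoordinates (E₁ := (TangentSpace (𝓡∂ d) : Y → Type))
    (E₂ := (TangentSpace 𝓘(ℝ, Normal k d) : Normal k d → Type))
    (v := fun p : TangentBundle (𝓡∂ d) Y => p.snd) h1 contMDiffAt_id
    (ContMDiffAt.comp (g := normalCoord k e) p (contMDiffAt_normalCoord he hp) h0)
  exact (contMDiff_snd_tangentBundle_modelSpace (Normal k d) 𝓘(ℝ, Normal k d)).contMDiffAt.comp p h2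

theorem contMDiffAt_normalComponent (he : e ∈ IsManifold.maximalAtlas (𝓡∂ d) ∞ Y)
    {p : RestrictedTangent ι} (hp : ι p.proj ∈ e.source) :
    ContMDiffAt ((𝓡∂ k).prod 𝓘(ℝ, EuclideanSpace ℝ (Fin d))) 𝓘(ℝ, Normal k d) ∞
      (normalComponent (ι := ι) e) p :=
  ContMDiffAt.comp (f := toTangent (ι := ι)) p (contMDiffAt_normalDeriv he hp)
    (contMDiff_toTangent p)

theorem contMDiffAt_normalVector (he : e ∈ IsManifold.maximalAtlas (𝓡∂ d) ∞ Y) {y : Y}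
    (hy : y ∈ e.source) (h : Normal k d) :
    ContMDiffAt ((𝓡∂ d).prod 𝓘(ℝ, Normal k d)) ((𝓡∂ d).prod 𝓘(ℝ, EuclideanSpace ℝ (Fin d))) ∞
      (fun z : Y × Normal k d => (⟨z.1, normalVector e z.1 z.2⟩ : TangentBundle (𝓡∂ d) Y))
      (y, h) := by
  have hS : ContMDiffAt (((𝓡∂ d).prod 𝓘(ℝ, Normal k d)).prod 𝓘(ℝ, ℝ)) (𝓡∂ d) ∞
      (Function.uncurry fun (z : Y × Normal k d) (r : ℝ) => normalShift e z.1 (r • z.2))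
      ((y, h), 0) := by
    refine ContMDiffAt.comp (I' := (𝓡∂ d).prod 𝓘(ℝ, Normal k d))
      (g := fun p : Y × Normal k d => normalShift e p.1 p.2)
      (f := fun z : (Y × Normal k d) × ℝ => (z.1.1, z.2 • z.1.2)) _
      (contMDiffAt_normalShift he hy (by simpa using e.map_source hy)) (ContMDiffAt.prodMk ?_ ?_)
    · exact contMDiffAt_fst.comp _ contMDiffAt_fst
    · exact contMDiffAt_snd.smul (contMDiffAt_snd.comp _ contMDiffAt_fst)
  have h1 := ContMDiffAt.mfderiv (I := 𝓘(ℝ, ℝ)) (I' := 𝓡∂ d) (n := ∞) (m := ∞)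
    (fun (z : Y × Normal k d) (r : ℝ) => normalShift e z.1 (r • z.2))
    (fun _ => (0 : ℝ)) (x₀ := (y, h)) hS contMDiffAt_const (by simp)
  have hb : ContMDiffAt ((𝓡∂ d).prod 𝓘(ℝ, Normal k d)) (𝓡∂ d) ∞
      (fun z : Y × Normal k d => normalShift e z.1 ((0 : ℝ) • z.2)) (y, h) :=
    ContMDiffAt.comp (f := fun z : Y × Normal k d => (z, (0 : ℝ))) (y, h) hS
      (contMDiffAt_id.prodMk contMDiffAt_const)
  have hv : ContMDiffAt ((𝓡∂ d).prod 𝓘(ℝ, Normal k d)) (𝓘(ℝ, ℝ).prod 𝓘(ℝ, ℝ)) ∞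
      (fun _ : Y × Normal k d => (⟨0, (1 : ℝ)⟩ : TangentBundle 𝓘(ℝ, ℝ) ℝ)) (y, h) :=
    contMDiffAt_const
  have h2 := ContMDiffAt.clm_apply_of_inCoordinates
    (E₁ := (TangentSpace 𝓘(ℝ, ℝ) : ℝ → Type)) (E₂ := (TangentSpace (𝓡∂ d) : Y → Type))
    (b₁ := fun _ : Y × Normal k d => (0 : ℝ))
    (b₂ := fun z : Y × Normal k d => normalShift e z.1 ((0 : ℝ) • z.2))
    (ϕ := fun z : Y × Normal k d =>
      mfderiv 𝓘(ℝ, ℝ) (𝓡∂ d) (fun r : ℝ => normalShift e z.1 (r • z.2)) 0)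
    (v := fun _ : Y × Normal k d => (1 : ℝ)) h1 hv hb
  refine h2.congr_of_eventuallyEq ?_
  filter_upwards [continuousAt_fst.eventually_mem (e.open_source.mem_nhds hy)] with z hz
  have h3 : normalShift e z.1 ((0 : ℝ) • z.2) = z.1 := by rw [zero_smul, normalShift_zero hz]
  have key : ∀ y' (v : EuclideanSpace ℝ (Fin d)), y' = z.1 →
      (⟨z.1, v⟩ : TangentBundle (𝓡∂ d) Y) = ⟨y', v⟩ := by
    rintro _ v rfl
    rfl
  exact key _ _ h3

theorem contMDiffAt_restrictedVector (he : e ∈ IsManifold.maximalAtlas (𝓡∂ d) ∞ Y) {w : W}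
    (hw : ι w ∈ e.source) (h : Normal k d) :
    ContMDiffAt ((𝓡∂ k).prod 𝓘(ℝ, Normal k d)) ((𝓡∂ k).prod 𝓘(ℝ, EuclideanSpace ℝ (Fin d))) ∞
      (fun z : W × Normal k d => restrictedVector ι e z.1 z.2) (w, h) := by
  refine contMDiffAt_restrictedTangent_iff.2 ⟨contMDiffAt_fst, ?_⟩
  exact ContMDiffAt.comp (f := fun z : W × Normal k d => (ι z.1, z.2)) (w, h)
    (contMDiffAt_normalVector he hw h)
    ((ι.contMDiff.contMDiffAt.comp _ contMDiffAt_fst).prodMk contMDiffAt_snd)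

theorem normalComponent_restrictedVector (he : e ∈ IsManifold.maximalAtlas (𝓡∂ d) ∞ Y) {w : W}
    (hw : ι w ∈ e.source) (h : Normal k d) :
    normalComponent e (restrictedVector ι e w h) = h :=
  normalDeriv_normalVector he hw h

theorem normalComponent_scale (r : ℝ) (p : RestrictedTangent ι) :
    normalComponent e (scale r p) = r • normalComponent e p :=
  map_smul (normalDeriv k e (ι p.proj)) r p.snd

theorem toNormal_scale (r : ℝ) (p : RestrictedTangent ι) :
    toNormal ι (scale r p) = ⟨p.proj, r • normalClass ι p.proj p.snd⟩ := rfl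

/-- A vector of the normal bundle is determined by its base point and its normal coordinates. -/
theorem toNormal_eq_iff (hι : IsSmoothEmbedding (𝓡∂ k) (𝓡∂ d) ∞ ι) (he : IsSliceChart ι e)
    {p p' : RestrictedTangent ι} (hp : ι p.proj ∈ e.source) :
    toNormal ι p = toNormal ι p' ↔
      p.proj = p'.proj ∧ normalComponent e p = normalComponent e p' := by
  obtain ⟨w, v⟩ := p
  obtain ⟨w', v'⟩ := p'
  have key : ∀ u u' : EuclideanSpace ℝ (Fin d), normalClass ι w u = normalClass ι w u' ↔
      normalDeriv k e (ι w) u = normalDeriv k e (ι w) u' := by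
    intro u u'
    rw [← sub_eq_zero (a := normalDeriv k e (ι w) u), ← map_sub]
    exact (Submodule.Quotient.eq _).trans (normalDeriv_eq_zero_iff hι he hp (u - u')).symm
  constructor
  · intro h
    obtain ⟨rfl, h2⟩ := Sigma.mk.inj_iff.1 h
    exact ⟨rfl, (key v v').1 (eq_of_heq h2)⟩
  · rintro ⟨rfl, h2⟩
    exact Sigma.mk.inj_iff.2 ⟨rfl, heq_of_eq ((key v v').2 h2)⟩

end RestrictedTangent

/-! ### Tubular maps fit the structure -/

section Tubular

variable {k d : ℕ} [NeZero k] [NeZero d]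
  {W : Type*} [TopologicalSpace W] [ChartedSpace (EuclideanHalfSpace k) W]
  {Y : Type*} [TopologicalSpace Y] [ChartedSpace (EuclideanHalfSpace d) Y]
  [IsManifold (𝓡∂ d) ∞ Y] {ι : C^∞⟮𝓡∂ k, W; 𝓡∂ d, Y⟯}
  {e : OpenPartialHomeomorph Y (EuclideanHalfSpace d)}
  {V : Set W} {U : Set (NormalBundle ι)} {T : NormalBundle ι → Y}

theorem normalClass_eq_iff (hι : IsSmoothEmbedding (𝓡∂ k) (𝓡∂ d) ∞ ι) (he : IsSliceChart ι e)
    {w : W} (hw : ι w ∈ e.source) (u u' : EuclideanSpace ℝ (Fin d)) :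
    normalClass ι w u = normalClass ι w u' ↔
      normalDeriv k e (ι w) u = normalDeriv k e (ι w) u' := by
  rw [← sub_eq_zero (a := normalDeriv k e (ι w) u), ← map_sub]
  exact (Submodule.Quotient.eq _).trans (normalDeriv_eq_zero_iff hι he hw (u - u')).symm

theorem zeroSection_eq_toNormal (w : W) : zeroSection ι w = toNormal ι ⟨w, 0⟩ := rfl

theorem normalComponent_eq_zero (hι : IsSmoothEmbedding (𝓡∂ k) (𝓡∂ d) ∞ ι) (he : IsSliceChart ι e)
    {p : RestrictedTangent ι} {w : W} (hw : ι w ∈ e.source) (hp : toNormal ι p = zeroSection ι w) :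
    p.proj = w ∧ normalComponent e p = 0 := by
  rw [zeroSection_eq_toNormal, eq_comm, toNormal_eq_iff hι he hw] at hp
  exact ⟨hp.1.symm, hp.2.symm.trans (map_zero (normalDeriv k e (ι w)))⟩

theorem inducedMap_of_mem {c : HalfCylinder ι} (h : T c.toNormalBundle ∈ range ι) :
    inducedMap ι T c = .sphere c.base c.ray := dif_pos h

theorem inducedMap_of_notMem {c : HalfCylinder ι} (h : T c.toNormalBundle ∉ range ι) :
    inducedMap ι T c = .off (T c.toNormalBundle) h := dif_neg h

namespace IsTubularMap

variable (hT : IsTubularMap ι V U T)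
include hT

theorem contMDiffAt {p : RestrictedTangent ι} (hp : toNormal ι p ∈ U) :
    ContMDiffAt ((𝓡∂ k).prod 𝓘(ℝ, EuclideanSpace ℝ (Fin d))) (𝓡∂ d) ∞
      (fun p => T (toNormal ι p)) p := by
  obtain ⟨F, hF, hs⟩ := hT.diffeo.smooth ⟨p, mem_univ p⟩ hp
  have hU : {p' : RestrictedTangent ι | ∃ _ : p' ∈ univ, toNormal ι p' ∈ U} ∈ 𝓝 p := by
    filter_upwards [hT.isOpen.mem_nhds hp] with p' hp' using ⟨mem_univ _, hp'⟩
  refine (hs.contMDiffAt hU).congr_of_eventuallyEq ?_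
  filter_upwards [hT.isOpen.mem_nhds hp] with p' hp' using (hF ⟨p', mem_univ p'⟩ hp').symm

theorem eq_zeroSection {n : NormalBundle ι} {w : W} (hn : n ∈ U) (h : T n = ι w) :
    n = zeroSection ι w ∧ w ∈ V := by
  have hw : w ∈ V := (hT.mem_range_iff w).1 ⟨n, hn, h⟩
  exact ⟨hT.diffeo.injOn hn ((hT.zero_mem_iff w).2 hw) (h.trans (hT.map_zero w hw).symm), hw⟩

theorem map_zeroSection {w : W} (h : zeroSection ι w ∈ U) : T (zeroSection ι w) = ι w :=
  hT.map_zero w ((hT.zero_mem_iff w).1 h)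

theorem proj_inducedMap {c : HalfCylinder ι}
    (hc : c.toNormalBundle ∈ U) : (inducedMap ι T c).proj = T c.toNormalBundle := by
  by_cases h : T c.toNormalBundle ∈ range ι
  · obtain ⟨w, hw⟩ := h
    have h1 := (hT.eq_zeroSection hc hw.symm).1
    rw [inducedMap_of_mem ⟨w, hw⟩, ← hw]
    exact congrArg ι (congrArg Sigma.fst h1)
  · rw [inducedMap_of_notMem h]
    rfl

theorem point_eq_zero_iff {c : HalfCylinder ι} (hc : c.toNormalBundle ∈ U) :
    T c.toNormalBundle ∈ range ι ↔ c.point = 0 := by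
  constructor
  · rintro ⟨w, hw⟩
    obtain ⟨h1, -⟩ := hT.eq_zeroSection hc hw.symm
    obtain ⟨h2, h3⟩ := Sigma.mk.inj_iff.1 h1
    subst h2
    exact eq_of_heq h3
  · intro h
    have h1 : c.toNormalBundle = zeroSection ι c.base := by
      rw [HalfCylinder.toNormalBundle, h]
      rfl
    rw [h1] at hc ⊢
    exact ⟨_, (hT.map_zeroSection hc).symm⟩

theorem injOn_inducedMap :
    InjOn (inducedMap ι T) (HalfCylinder.toNormalBundle ⁻¹' U) := by
  intro c hc c' hc' h
  have hiff := hT.point_eq_zero_iff hc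
  have hiff' := hT.point_eq_zero_iff hc'
  by_cases hr : T c.toNormalBundle ∈ range ι
  · rw [inducedMap_of_mem hr] at h
    by_cases hr' : T c'.toNormalBundle ∈ range ι
    · rw [inducedMap_of_mem hr'] at h
      have hp := hiff.1 hr
      have hp' := hiff'.1 hr'
      obtain ⟨b, ρ, n, hm⟩ := c
      obtain ⟨b', ρ', n', hm'⟩ := c'
      simp only at hp hp' h
      obtain ⟨rfl, h2⟩ := BlowUp.sphere.inj h
      obtain rfl := eq_of_heq h2
      obtain rfl : n = n' := hp.trans hp'.symm
      rfl
    · rw [inducedMap_of_notMem hr'] at h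
      cases h
  · rw [inducedMap_of_notMem hr] at h
    by_cases hr' : T c'.toNormalBundle ∈ range ι
    · rw [inducedMap_of_mem hr'] at h
      cases h
    · rw [inducedMap_of_notMem hr'] at h
      have h1 := hT.diffeo.injOn hc hc' (BlowUp.off.inj h)
      have hp : c.point ≠ 0 := fun h0 => hr (hiff.2 h0)
      obtain ⟨b, ρ, n, hm⟩ := c
      obtain ⟨b', ρ', n', hm'⟩ := c'
      obtain ⟨rfl, h2⟩ := Sigma.mk.inj_iff.1 h1
      obtain rfl := eq_of_heq h2
      obtain rfl : ρ = ρ' := (hm hp).symm.trans (hm' hp)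
      rfl

theorem normalDeriv_mfderiv (hι : IsSmoothEmbedding (𝓡∂ k) (𝓡∂ d) ∞ ι) (he : IsSliceChart ι e)
    {w : W} (hw : ι w ∈ e.source) (hV : w ∈ V) (v : EuclideanSpace ℝ (Fin d)) :
    normalDeriv k e (ι w)
      (mfderiv 𝓘(ℝ, ℝ) (𝓡∂ d) (fun t : ℝ => T (toNormal ι (scale t ⟨w, v⟩))) 0 (1 : ℝ)) =
    normalDeriv k e (ι w) v :=
  (normalClass_eq_iff hι he hw _ _).1 (hT.normal_deriv w hV v)

theorem scale_zero_mem {p : RestrictedTangent ι} (hV : p.proj ∈ V) :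
    toNormal ι (scale 0 p) ∈ U ∧ T (toNormal ι (scale 0 p)) = ι p.proj := by
  have h : toNormal ι (scale 0 p) = zeroSection ι p.proj := by
    rw [toNormal_scale, zero_smul]
    rfl
  rw [h]
  exact ⟨(hT.zero_mem_iff _).2 hV, hT.map_zero _ hV⟩

theorem contMDiffAt_scale {p : RestrictedTangent ι} {r : ℝ} (h : toNormal ι (scale r p) ∈ U) :
    ContMDiffAt (((𝓡∂ k).prod 𝓘(ℝ, EuclideanSpace ℝ (Fin d))).prod 𝓘(ℝ, ℝ)) (𝓡∂ d) ∞
      (fun z : RestrictedTangent ι × ℝ => T (toNormal ι (scale z.2 z.1))) (p, r) :=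
  ContMDiffAt.comp (f := fun z : RestrictedTangent ι × ℝ => scale z.2 z.1) (p, r)
    (hT.contMDiffAt h) (contMDiff_scale (p, r))

theorem mdifferentiableAt_scale {p : RestrictedTangent ι} (hV : p.proj ∈ V) :
    MDifferentiableAt 𝓘(ℝ, ℝ) (𝓡∂ d) (fun t : ℝ => T (toNormal ι (scale t p))) 0 := by
  have h := ContMDiffAt.comp (f := fun t : ℝ => (p, t)) (0 : ℝ)
    (hT.contMDiffAt_scale (hT.scale_zero_mem hV).1) (contMDiffAt_const.prodMk contMDiffAt_id)
  exact h.mdifferentiableAt (by simp)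

/-- In normal coordinates, the map `(v, r) ↦ T (r [v])` has the form `r • h`, where `h` is a smooth
direction of the induced map. -/
theorem smoothLift_inducedMap [IsManifold (𝓡∂ k) ∞ W] (hι : IsSmoothEmbedding (𝓡∂ k) (𝓡∂ d) ∞ ι)
    (hclosed : IsClosed (range ι))
    (hboundary : ι ⁻¹' (𝓡∂ d).boundary Y = (𝓡∂ k).boundary W)
    {F : RestrictedTangent ι × ℝ → BlowUp ι}
    (hF : ∀ m : cylinderDomain ι, F m = inducedMap ι T (toHalfCylinder ι m))
    (m : cylinderDomain ι) (hm : (toHalfCylinder ι m).toNormalBundle ∈ U) :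
    SmoothLift (((𝓡∂ k).prod 𝓘(ℝ, EuclideanSpace ℝ (Fin d))).prod 𝓘(ℝ, ℝ)) F
      {m | ∃ h : m ∈ cylinderDomain ι, (toHalfCylinder ι ⟨m, h⟩).toNormalBundle ∈ U} m := by
  set S := {m | ∃ h : m ∈ cylinderDomain ι, (toHalfCylinder ι ⟨m, h⟩).toNormalBundle ∈ U} with hS
  have hmS : m.1 ∈ S := ⟨m.2, hm⟩
  have hproj : ∀ m' ∈ S, (F m').proj = T (toNormal ι (scale m'.2 m'.1)) := by
    rintro m' ⟨h1, h2⟩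
    rw [hF ⟨m', h1⟩, hT.proj_inducedMap h2]
    rfl
  have hTs := hT.contMDiffAt_scale (p := m.1.1) (r := m.1.2) hm
  have hp : ContMDiffWithinAt (((𝓡∂ k).prod 𝓘(ℝ, EuclideanSpace ℝ (Fin d))).prod 𝓘(ℝ, ℝ)) (𝓡∂ d)
      ∞ (fun m => (F m).proj) S m :=
    hTs.contMDiffWithinAt.congr hproj (hproj _ hmS)
  by_cases hfm : F m ∈ sphereBundle ι
  · rw [mem_sphereBundle_iff, hproj _ hmS] at hfm
    have h0 := (hT.point_eq_zero_iff hm).1 hfm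
    have hr : m.1.2 = 0 := (smul_eq_zero.1 h0).resolve_right m.2.1
    obtain ⟨⟨p, r⟩, hD⟩ := m
    obtain rfl : r = 0 := hr
    have hmV : ∀ p' r', (p', r') ∈ S → r' = 0 → p'.proj ∈ V := by
      rintro p' _ ⟨h1, h2⟩ rfl
      rw [← hT.zero_mem_iff]
      have : (toHalfCylinder ι ⟨(p', 0), h1⟩).toNormalBundle = zeroSection ι p'.proj := by
        change toNormal ι (scale 0 p') = _
        rw [toNormal_scale, zero_smul]
        rfl
      rwa [this] at h2
    have hV := hmV p 0 hmS rfl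
    obtain ⟨e, he, hew⟩ := exists_isSliceChart hι hboundary p.proj
    have hT0 := (hT.scale_zero_mem hV).2
    set g : RestrictedTangent ι × ℝ → Normal k d := fun z =>
      normalCoord k e (T (toNormal ι (scale z.2 z.1))) with hg_def
    have hg : ContMDiffAt (((𝓡∂ k).prod 𝓘(ℝ, EuclideanSpace ℝ (Fin d))).prod 𝓘(ℝ, ℝ))
        𝓘(ℝ, Normal k d) ∞ g (p, 0) := by
      refine ContMDiffAt.comp (g := normalCoord k e) (p, (0 : ℝ))
        (contMDiffAt_normalCoord he.mem_maximalAtlas ?_) hTs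
      rw [hT0]
      exact hew
    have hsrc : ∀ᶠ p' : RestrictedTangent ι in 𝓝 p, ι p'.proj ∈ e.source :=
      (ι.contMDiff.continuous.comp
        contMDiff_restrictedTangent_proj.continuous).continuousAt.eventually_mem
        (e.open_source.mem_nhds hew)
    have hsrc' : ∀ᶠ z : RestrictedTangent ι × ℝ in 𝓝[S] (p, 0), ι z.1.proj ∈ e.source :=
      ((continuousAt_fst (p := (p, (0 : ℝ)))).eventually hsrc).filter_mono nhdsWithin_le_nhds
    have hV' : ∀ᶠ z : RestrictedTangent ι × ℝ in 𝓝[S] (p, 0), z.1.proj ∈ V := by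
      have h1 : Continuous fun z : RestrictedTangent ι × ℝ => scale 0 z.1 :=
        (contMDiff_scale (ι := ι)).continuous.comp (continuous_fst.prodMk continuous_const)
      have h2 := h1.continuousAt.eventually_mem (x := (p, (0 : ℝ)))
        (hT.isOpen.mem_nhds (hT.scale_zero_mem hV).1)
      refine (h2.mono fun z hz => ?_).filter_mono nhdsWithin_le_nhds
      rw [← hT.zero_mem_iff]
      have h3 : toNormal ι (scale 0 z.1) = zeroSection ι z.1.proj := by
        rw [toNormal_scale, zero_smul]
        rfl
      exact h3 ▸ hz
    -- the direction at the points with `r = 0`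
    have hzero : ∀ p' : RestrictedTangent ι, p'.proj ∈ V → ι p'.proj ∈ e.source →
        dslope (fun r => g (p', r)) 0 0 = normalDeriv k e (ι p'.proj) p'.snd := by
      intro p' hV' hs'
      have hT0' := (hT.scale_zero_mem hV').2
      rw [dslope_same]
      have h1 := deriv_comp_curve (γ := fun t : ℝ => T (toNormal ι (scale t p')))
        (g := normalCoord k e) hT0' (mdifferentiableAt_normalCoord he.mem_maximalAtlas hs')
        (hT.mdifferentiableAt_scale hV')
      exact h1.trans (hT.normalDeriv_mfderiv hι he hs' hV' p'.snd)
    refine SmoothLift.of_hasSmoothDirection hι hclosed hmS hp he (by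
      rw [hproj _ hmS]; exact hT0.symm ▸ hew)
      ⟨fun z => dslope (fun r => g (z.1, r)) 0 z.2,
        (contMDiffAt_dslope hg).contMDiffWithinAt, ?_, ?_⟩
    · simp only [hzero p hV hew]
      exact (normalClass_ne_zero_iff hι he hew).1 hD.1
    · filter_upwards [hsrc', hV', self_mem_nhdsWithin] with z hz hzV hzS
      obtain ⟨p', r'⟩ := z
      obtain ⟨h1, h2⟩ := hzS
      rw [hF ⟨_, h1⟩]
      by_cases hr' : r' = 0
      · subst hr'
        have hray : IsRayOf (inducedMap ι T (toHalfCylinder ι ⟨(p', 0), h1⟩)) p'.proj p'.snd := by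
          refine ⟨h1.1, inducedMap_of_mem ⟨p'.proj, (hT.scale_zero_mem hzV).2.symm⟩⟩
        simp only [hzero p' hzV hz]
        exact (hray.sameRay_direction hι he hz).2
      · have hpos : 0 < r' := lt_of_le_of_ne h1.2 (Ne.symm hr')
        have hnr : T (toHalfCylinder ι ⟨(p', r'), h1⟩).toNormalBundle ∉ range ι := fun h =>
          smul_ne_zero hr' h1.1 ((hT.point_eq_zero_iff h2).1 h)
        have hd : direction e (inducedMap ι T (toHalfCylinder ι ⟨(p', r'), h1⟩)) = g (p', r') := by
          rw [inducedMap_of_notMem hnr]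
          rfl
        have hg0 : g (p', 0) = 0 := by
          simp only [hg_def, (hT.scale_zero_mem hzV).2]
          exact he.normalCoord_eq_zero hz
        have h3 := eq_add_smul_dslope (fun t => g (p', t)) r'
        simp only [hg0, zero_add] at h3
        rw [hd, h3]
        exact SameRay.sameRay_pos_smul_left _ hpos
  · exact SmoothLift.of_notMem hι hclosed hp hfm

/-- The normal component of a local inverse of `T` has the same differential along `W` as the
normal coordinates. -/
theorem mfderiv_normalComponent (hι : IsSmoothEmbedding (𝓡∂ k) (𝓡∂ d) ∞ ι)
    (he : IsSliceChart ι e) {w : W} (hw : ι w ∈ e.source) {s : Y → RestrictedTangent ι}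
    (hs : ContMDiffAt (𝓡∂ d) ((𝓡∂ k).prod 𝓘(ℝ, EuclideanSpace ℝ (Fin d))) ∞ s (ι w))
    (hsU : ∀ᶠ y in 𝓝 (ι w), toNormal ι (s y) ∈ U ∧ T (toNormal ι (s y)) = y)
    (v : EuclideanSpace ℝ (Fin d)) :
    mfderiv (𝓡∂ d) 𝓘(ℝ, Normal k d) (fun y => normalComponent e (s y)) (ι w) v =
      normalDeriv k e (ι w) v := by
  have hsw := hT.eq_zeroSection hsU.self_of_nhds.1 hsU.self_of_nhds.2
  have hV := hsw.2
  have hsp : (s (ι w)).proj = w := (normalComponent_eq_zero hι he hw hsw.1).1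
  have hΦ : MDifferentiableAt (𝓡∂ d) 𝓘(ℝ, Normal k d) (fun y => normalComponent e (s y)) (ι w) :=
    (ContMDiffAt.comp (g := normalComponent (ι := ι) e) (ι w)
      (contMDiffAt_normalComponent he.mem_maximalAtlas (by rw [hsp]; exact hw))
      hs).mdifferentiableAt
      (by simp)
  -- it vanishes on the tangent space of `W`
  have hker : ∀ u, mfderiv (𝓡∂ d) 𝓘(ℝ, Normal k d) (fun y => normalComponent e (s y)) (ι w)
      (mfderiv (𝓡∂ k) (𝓡∂ d) ι w u) = 0 := by
    intro u
    have h1 := DFunLike.congr_fun (mfderiv_comp w hΦ ι.mdifferentiableAt) u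
    have h2 : ((fun y => normalComponent e (s y)) ∘ ι) =ᶠ[𝓝 w] fun _ => 0 := by
      have hc := ι.contMDiff.continuous.continuousAt (x := w)
      filter_upwards [hc.eventually hsU, hc.eventually_mem (e.open_source.mem_nhds hw)]
        with w' h3 h4
      exact (normalComponent_eq_zero hι he h4 (hT.eq_zeroSection h3.1 h3.2).1).2
    rw [h2.mfderiv_eq, mfderiv_const] at h1
    exact h1.symm
  set γ : ℝ → Y := fun t => T (toNormal ι (scale t ⟨w, v⟩)) with hγ
  have hT0 := hT.scale_zero_mem (p := ⟨w, v⟩) hV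
  have hγd := hT.mdifferentiableAt_scale (p := ⟨w, v⟩) hV
  have hdiff : mfderiv (𝓡∂ d) 𝓘(ℝ, Normal k d) (fun y => normalComponent e (s y)) (ι w) v =
      mfderiv (𝓡∂ d) 𝓘(ℝ, Normal k d) (fun y => normalComponent e (s y)) (ι w)
        (mfderiv 𝓘(ℝ, ℝ) (𝓡∂ d) γ 0 (1 : ℝ) : EuclideanSpace ℝ (Fin d)) := by
    obtain ⟨u, hu⟩ := (Submodule.Quotient.eq _).1 (hT.normal_deriv w hV v)
    have h1 := hker u
    let γ' : EuclideanSpace ℝ (Fin d) := mfderiv 𝓘(ℝ, ℝ) (𝓡∂ d) γ 0 (1 : ℝ)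
    have h2 : mfderiv (𝓡∂ d) 𝓘(ℝ, Normal k d) (fun y => normalComponent e (s y)) (ι w)
        (γ' - v) = 0 := by
      rw [← h1]
      exact congrArg _ hu.symm
    refine (sub_eq_zero.1 ?_).symm
    exact (map_sub (mfderiv (𝓡∂ d) 𝓘(ℝ, Normal k d) (fun y => normalComponent e (s y)) (ι w))
      γ' v).symm.trans h2
  rw [hdiff]
  refine (deriv_comp_curve (γ := γ) hT0.2 hΦ hγd).symm.trans ?_
  have hev : (fun t => normalComponent e (s (γ t))) =ᶠ[𝓝 0]
      fun t => t • normalDeriv k e (ι w) v := by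
    have hγc : Tendsto γ (𝓝 0) (𝓝 (ι w)) := by
      have h1 : Tendsto γ (𝓝 0) (𝓝 (γ 0)) := hγd.continuousAt.tendsto
      rwa [show γ 0 = ι w from hT0.2] at h1
    have hsc : ContinuousAt (fun t : ℝ => scale t (⟨w, v⟩ : RestrictedTangent ι)) 0 :=
      ContinuousAt.comp (g := fun z : RestrictedTangent ι × ℝ => scale z.2 z.1)
        (f := fun t : ℝ => ((⟨w, v⟩ : RestrictedTangent ι), t))
        contMDiff_scale.continuous.continuousAt (by fun_prop)
    filter_upwards [hγc.eventually hsU, hsc.eventually_mem (hT.isOpen.mem_nhds hT0.1)] with t h1 h2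
    have h3 : toNormal ι (scale t ⟨w, v⟩) = toNormal ι (s (γ t)) :=
      hT.diffeo.injOn h2 h1.1 h1.2.symm
    rw [← ((toNormal_eq_iff hι he hw).1 h3).2, normalComponent_scale]
    rfl
  rw [hev.deriv_eq]
  simp [deriv_smul_const]

end IsTubularMap

end Tubular

/-! ### Inverses of the maps induced by tubular maps -/

section Inverse

variable {k d : ℕ} [NeZero k] [NeZero d]
  {W : Type*} [TopologicalSpace W] [ChartedSpace (EuclideanHalfSpace k) W]
  [IsManifold (𝓡∂ k) ∞ W]
  {Y : Type*} [TopologicalSpace Y] [ChartedSpace (EuclideanHalfSpace d) Y]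
  [IsManifold (𝓡∂ d) ∞ Y] {ι : C^∞⟮𝓡∂ k, W; 𝓡∂ d, Y⟯}
  {e : OpenPartialHomeomorph Y (EuclideanHalfSpace d)} {i : {j : Fin d // k ≤ (j : ℕ)}}
  {V : Set W} {U : Set (NormalBundle ι)} {T : NormalBundle ι → Y}

/-- The multiple of the direction whose `i`-th coordinate is `1` or `-1`. -/
def unitDirection (e : OpenPartialHomeomorph Y (EuclideanHalfSpace d))
    (i : {j : Fin d // k ≤ (j : ℕ)}) (x : BlowUp ι) : Normal k d :=
  |direction e x i|⁻¹ • direction e x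

theorem normalCoord_eq_abs_smul_unitDirection (he : IsSliceChart ι e) {x : BlowUp ι}
    (hx : x.proj ∈ e.source) (hi : direction e x i ≠ 0) :
    normalCoord k e x.proj = |normalCoord k e x.proj i| • unitDirection e i x := by
  obtain ⟨t, ht, hn⟩ := exists_normalCoord_eq_smul he hx
  rw [unitDirection, hn, Pi.smul_apply, smul_eq_mul, abs_mul, abs_of_nonneg ht, smul_smul]
  congr 1
  have := abs_ne_zero.2 hi
  field_simp

theorem sameRay_unitDirection {x : BlowUp ι} (hi : direction e x i ≠ 0) :
    SameRay ℝ (direction e x) (unitDirection e i x) :=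
  SameRay.sameRay_pos_smul_right _ (inv_pos.2 (abs_pos.2 hi))

theorem unitDirection_ne_zero {x : BlowUp ι} (hi : direction e x i ≠ 0) :
    unitDirection e i x ≠ 0 :=
  smul_ne_zero (inv_ne_zero (abs_ne_zero.2 hi)) fun h => hi (by rw [h]; rfl)

theorem unitDirection_eq {x : BlowUp ι} {h : Normal k d} {a : ℝ} (ha : 0 < a)
    (hx : direction e x = a • h) : unitDirection e i x = |h i|⁻¹ • h := by
  rw [unitDirection, hx, Pi.smul_apply, smul_eq_mul, abs_mul, abs_of_pos ha, smul_smul, mul_inv,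
    mul_comm a⁻¹, mul_assoc, inv_mul_cancel₀ ha.ne', mul_one]

theorem abs_unitDirection_self {x : BlowUp ι} (hi : direction e x i ≠ 0) :
    |unitDirection e i x i| = 1 := by
  rw [unitDirection, Pi.smul_apply, smul_eq_mul, abs_mul, abs_inv, abs_abs,
    inv_mul_cancel₀ (abs_ne_zero.2 hi)]

variable (hι : IsSmoothEmbedding (𝓡∂ k) (𝓡∂ d) ∞ ι) (hclosed : IsClosed (range ι))
  (hboundary : ι ⁻¹' (𝓡∂ d).boundary Y = (𝓡∂ k).boundary W)

theorem contMDiffAt_unitDirection (he : IsSliceChart ι e)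
    {x : (blowUpStructure hι hclosed hboundary).Space}
    (hx : BlowUp.proj x ∈ e.source) (hi : direction (ι := ι) e x i ≠ 0) :
    ContMDiffAt (modelWithCornersEuclideanQuadrant d) 𝓘(ℝ, Normal k d) ∞
      (fun x : (blowUpStructure hι hclosed hboundary).Space => unitDirection (ι := ι) e i x) x := by
  obtain ⟨h, h1, h2, h3⟩ := (smoothLift_id hι hclosed hboundary x).direction e he hx
  have h1 : ContMDiffAt (modelWithCornersEuclideanQuadrant d) 𝓘(ℝ, Normal k d) ∞ h x := h1
  rw [nhdsWithin_univ] at h3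
  have hhi : h x i ≠ 0 := by
    obtain ⟨a, ha, had⟩ := h3.self_of_nhds.exists_pos_left (direction_ne_zero hι he hx) h2
    rw [← had]
    exact mul_ne_zero ha.ne' hi
  have hsmooth : ContMDiffAt (modelWithCornersEuclideanQuadrant d) 𝓘(ℝ, Normal k d) ∞
      (fun x => |h x i|⁻¹ • h x) x := by
    have h4 : ContMDiffAt (modelWithCornersEuclideanQuadrant d) 𝓘(ℝ, ℝ) ∞ (fun x => h x i) x :=
      contMDiffAt_pi_space.1 h1 i
    have h5 : ContMDiffAt 𝓘(ℝ, ℝ) 𝓘(ℝ, ℝ) ∞ (fun t : ℝ => |t|⁻¹) (h x i) :=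
      ((contDiffAt_abs hhi).inv (abs_ne_zero.2 hhi)).contMDiffAt
    exact (ContMDiffAt.comp (g := fun t : ℝ => |t|⁻¹) x h5 h4).smul h1
  refine hsmooth.congr_of_eventuallyEq ?_
  have hproj := (contMDiff_proj_blowUp hι hclosed hboundary).continuous.continuousAt (x := x)
  filter_upwards [h3, hproj.eventually_mem (e.open_source.mem_nhds hx),
    h1.continuousAt.eventually_ne h2] with x' h4 h5 h6
  obtain ⟨a, ha, had⟩ := h4.exists_pos_right (direction_ne_zero hι he h5) h6
  exact unitDirection_eq ha had

theorem eventually_direction_ne_zero (he : IsSliceChart ι e)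
    {x : (blowUpStructure hι hclosed hboundary).Space}
    (hx : BlowUp.proj x ∈ e.source) (hi : direction (ι := ι) e x i ≠ 0) :
    ∀ᶠ x' : (blowUpStructure hι hclosed hboundary).Space in 𝓝 x,
      direction (ι := ι) e x' i ≠ 0 := by
  have h := contMDiffAt_pi_space.1 (contMDiffAt_unitDirection hι hclosed hboundary he hx hi) i
  have h0 : unitDirection (ι := ι) e i x i ≠ 0 :=
    mul_ne_zero (inv_ne_zero (abs_ne_zero.2 hi)) hi
  filter_upwards [h.continuousAt.eventually_ne h0] with x' hx' h'
  refine hx' ?_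
  change |direction (ι := ι) e x' i|⁻¹ * direction (ι := ι) e x' i = 0
  rw [h', mul_zero]

/-- The radial coordinate is smooth. -/
theorem contMDiffAt_abs_normalCoord (he : IsSliceChart ι e)
    {x : (blowUpStructure hι hclosed hboundary).Space}
    (hx : BlowUp.proj x ∈ e.source) (hi : direction (ι := ι) e x i ≠ 0) :
    ContMDiffAt (modelWithCornersEuclideanQuadrant d) 𝓘(ℝ, ℝ) ∞
      (fun x : (blowUpStructure hι hclosed hboundary).Space =>
        |normalCoord k e (BlowUp.proj (ι := ι) x) i|) x := by
  -- `unitDirection e i x i` is the sign of the `i`-th coordinate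
  have hu := contMDiffAt_pi_space.1 (contMDiffAt_unitDirection hι hclosed hboundary he hx hi) i
  have hproj := contMDiff_proj_blowUp hι hclosed hboundary
  have hn : ContMDiffAt (modelWithCornersEuclideanQuadrant d) 𝓘(ℝ, ℝ) ∞
      (fun x : (blowUpStructure hι hclosed hboundary).Space =>
        normalCoord k e (BlowUp.proj (ι := ι) x) i) x :=
    contMDiffAt_pi_space.1 (ContMDiffAt.comp (g := normalCoord k e)
      (f := (blowUpStructure hι hclosed hboundary).proj) x
      (contMDiffAt_normalCoord he.mem_maximalAtlas hx) hproj.contMDiffAt) i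
  refine (hu.mul hn).congr_of_eventuallyEq ?_
  filter_upwards [hproj.continuous.continuousAt.eventually_mem (e.open_source.mem_nhds hx),
    eventually_direction_ne_zero hι hclosed hboundary he hx hi] with x' h1 h2
  have h3 := congrFun (normalCoord_eq_abs_smul_unitDirection he (i := i) h1 h2) i
  have h6 : |unitDirection (ι := ι) e i x' i| = 1 := abs_unitDirection_self h2
  have h4 : unitDirection (ι := ι) e i x' i * unitDirection (ι := ι) e i x' i = 1 := by
    rw [← abs_mul_abs_self, h6, one_mul]
  have h5 : normalCoord k e (BlowUp.proj (ι := ι) x') i =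
      |normalCoord k e (BlowUp.proj (ι := ι) x') i| * unitDirection (ι := ι) e i x' i := h3
  change _ = unitDirection (ι := ι) e i x' i * normalCoord k e (BlowUp.proj (ι := ι) x') i
  rw [h5, abs_mul, abs_abs, h6, mul_one, mul_left_comm, h4, mul_one]

/-- The properties of a local inverse `s` of `T ∘ toNormal` at a point `y` of the domain of the
slice chart `e`. -/
structure IsGoodAt (e : OpenPartialHomeomorph Y (EuclideanHalfSpace d)) (U : Set (NormalBundle ι))
    (T : NormalBundle ι → Y) (s : Y → RestrictedTangent ι) (y : Y) : Prop where
  smooth : ContMDiffAt (𝓡∂ d) ((𝓡∂ k).prod 𝓘(ℝ, EuclideanSpace ℝ (Fin d))) ∞ s y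
  eventually : ∀ᶠ y' in 𝓝 y, toNormal ι (s y') ∈ U ∧ T (toNormal ι (s y')) = y'
  mem_source : y ∈ e.source
  proj_mem_source : ι (s y).proj ∈ e.source

theorem IsGoodAt.normalComponent_eq_zero {s : Y → RestrictedTangent ι} {w : W}
    (hg : IsGoodAt e U T s (ι w)) (hT : IsTubularMap ι V U T)
    (hι : IsSmoothEmbedding (𝓡∂ k) (𝓡∂ d) ∞ ι) (he : IsSliceChart ι e) :
    (s (ι w)).proj = w ∧ normalComponent e (s (ι w)) = 0 :=
  M5.normalComponent_eq_zero hι he hg.mem_source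
    (hT.eq_zeroSection hg.eventually.self_of_nhds.1 hg.eventually.self_of_nhds.2).1

/-- The retraction of a neighbourhood of `W` onto `W` along the normal coordinates. -/
def chartRetraction (k : ℕ) [NeZero k] {d : ℕ} [NeZero d] {Y : Type*} [TopologicalSpace Y]
    (e : OpenPartialHomeomorph Y (EuclideanHalfSpace d)) (y : Y) : Y :=
  normalShift e y (-normalCoord k e y)

/-- The normal component of the local inverse of the map induced by `T`: by Hadamard's lemma, the
normal component of `s` at the point with normal coordinates `r • u` has the form `r • h`. -/
def inverseDirection (e : OpenPartialHomeomorph Y (EuclideanHalfSpace d))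
    (i : {j : Fin d // k ≤ (j : ℕ)}) (s : Y → RestrictedTangent ι) (x : BlowUp ι) : Normal k d :=
  dslope (fun r : ℝ => normalComponent e
    (s (normalShift e (chartRetraction k e x.proj) (r • unitDirection e i x)))) 0
    |normalCoord k e x.proj i|

theorem chartRetraction_mem_range (he : IsSliceChart ι e) {y : Y}
    (hy : addNormal (e y) (-normalCoord k e y) ∈ e.target) : chartRetraction k e y ∈ range ι := by
  rw [chartRetraction, he.mem_range_iff _ (normalShift_mem_source hy), normalCoord_normalShift hy,
    add_neg_cancel]

theorem chartRetraction_map (he : IsSliceChart ι e) {w : W} (hw : ι w ∈ e.source) :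
    chartRetraction k e (ι w) = ι w := by
  rw [chartRetraction, he.normalCoord_eq_zero hw, neg_zero, normalShift_zero hw]

section InverseDirection

variable {s : Y → RestrictedTangent ι} {x : BlowUp ι} (hT : IsTubularMap ι V U T)
  (he : IsSliceChart ι e) (hi : direction e x i ≠ 0) (hg : IsGoodAt e U T s x.proj)
include hι hT he hi hg

theorem normalComponent_eq_smul_inverseDirection
    (ht : addNormal (e x.proj) (-normalCoord k e x.proj) ∈ e.target)
    (hg' : IsGoodAt e U T s (chartRetraction k e x.proj)) :
    normalComponent e (s x.proj) =
      |normalCoord k e x.proj i| • inverseDirection e i s x := by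
  have h := eq_add_smul_dslope (fun r : ℝ => normalComponent e
    (s (normalShift e (chartRetraction k e x.proj) (r • unitDirection e i x))))
    |normalCoord k e x.proj i|
  rw [← normalCoord_eq_abs_smul_unitDirection he hg.mem_source hi, zero_smul,
    normalShift_zero hg'.mem_source] at h
  have h1 : normalShift e (chartRetraction k e x.proj) (normalCoord k e x.proj) = x.proj := by
    rw [chartRetraction, normalShift_normalShift ht, neg_add_cancel, normalShift_zero hg.mem_source]
  obtain ⟨w, hw⟩ := chartRetraction_mem_range he ht
  rw [← hw] at hg'
  have h2 := (hg'.normalComponent_eq_zero hT hι he).2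
  rw [h1, ← hw, h2, zero_add, hw] at h
  exact h

theorem inverseDirection_of_mem {w : W} (hx : x.proj = ι w) :
    inverseDirection e i s x = unitDirection e i x := by
  have hw : ι w ∈ e.source := hx ▸ hg.mem_source
  have hn0 : |normalCoord k e x.proj i| = 0 := by
    rw [hx, he.normalCoord_eq_zero hw]
    simp
  rw [hx] at hg
  have hsp := (hg.normalComponent_eq_zero hT hι he).1
  rw [inverseDirection, hn0, dslope_same, hx, chartRetraction_map he hw]
  have hs : MDifferentiableAt (𝓡∂ d) 𝓘(ℝ, Normal k d) (fun y => normalComponent e (s y)) (ι w) :=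
    (ContMDiffAt.comp (g := normalComponent (ι := ι) e) (ι w)
      (contMDiffAt_normalComponent he.mem_maximalAtlas hg.proj_mem_source)
      hg.smooth).mdifferentiableAt (by simp)
  have hc := contMDiffAt_normalShift_curve he.mem_maximalAtlas hw (unitDirection e i x)
  refine (deriv_comp_curve
    (γ := fun r : ℝ => normalShift e (ι w) (r • unitDirection e i x))
    (g := fun y => normalComponent e (s y))
    (by rw [zero_smul, normalShift_zero hw]) hs (hc.mdifferentiableAt (by simp))).trans ?_
  refine (hT.mfderiv_normalComponent hι he hw hg.smooth hg.eventually _).trans ?_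
  exact normalDeriv_normalVector he.mem_maximalAtlas hw _

theorem inverseDirection_ne_zero
    (ht : addNormal (e x.proj) (-normalCoord k e x.proj) ∈ e.target)
    (hg' : IsGoodAt e U T s (chartRetraction k e x.proj)) : inverseDirection e i s x ≠ 0 := by
  by_cases hx : x.proj ∈ range ι
  · obtain ⟨w, hw⟩ := hx
    rw [inverseDirection_of_mem hι hT he hi hg hw.symm]
    exact unitDirection_ne_zero hi
  · intro h0
    have h1 := normalComponent_eq_smul_inverseDirection hι hT he hi hg ht hg'
    rw [h0, smul_zero] at h1
    have h2 : toNormal ι (s x.proj) = zeroSection ι (s x.proj).proj := by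
      rw [zeroSection_eq_toNormal, toNormal_eq_iff hι he hg.proj_mem_source]
      exact ⟨rfl, h1.trans (map_zero (normalDeriv k e (ι (s x.proj).proj))).symm⟩
    obtain ⟨h3, h4⟩ := hg.eventually.self_of_nhds
    rw [h2] at h3 h4
    exact hx ⟨_, (hT.map_zeroSection h3).symm.trans h4⟩

end InverseDirection

theorem contMDiffAt_inverseDirection {s : Y → RestrictedTangent ι} (hT : IsTubularMap ι V U T)
    (he : IsSliceChart ι e) {x : (blowUpStructure hι hclosed hboundary).Space}
    (hg : ∀ᶠ x' : (blowUpStructure hι hclosed hboundary).Space in 𝓝 x,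
      direction (ι := ι) e x' i ≠ 0 ∧ IsGoodAt e U T s (BlowUp.proj (ι := ι) x') ∧
      addNormal (e (BlowUp.proj (ι := ι) x')) (-normalCoord k e (BlowUp.proj (ι := ι) x'))
        ∈ e.target ∧ IsGoodAt e U T s (chartRetraction k e (BlowUp.proj (ι := ι) x'))) :
    ContMDiffAt (modelWithCornersEuclideanQuadrant d) 𝓘(ℝ, Normal k d) ∞
      (fun x : (blowUpStructure hι hclosed hboundary).Space =>
        inverseDirection (ι := ι) e i s x) x := by
  obtain ⟨hi, hgx, ht, hgx'⟩ := hg.self_of_nhds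
  set y : (blowUpStructure hι hclosed hboundary).Space → Y := BlowUp.proj (ι := ι) with hy_def
  have hproj : ContMDiffAt (modelWithCornersEuclideanQuadrant d) (𝓡∂ d) ∞ y x :=
    contMDiff_proj_blowUp hι hclosed hboundary x
  have hr := contMDiffAt_abs_normalCoord hι hclosed hboundary he hgx.mem_source hi
  by_cases hx : y x ∈ range ι
  · obtain ⟨w, hw⟩ := hx
    have hws : ι w ∈ e.source := hw ▸ hgx.mem_source
    have hu := contMDiffAt_unitDirection hι hclosed hboundary he hgx.mem_source hi
    set u : (blowUpStructure hι hclosed hboundary).Space → Normal k d :=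
      unitDirection (ι := ι) e i with hu_def
    have hret : chartRetraction k e (y x) = y x := by
      rw [← hw, chartRetraction_map he hws]
    have hS : ContMDiffAt (((𝓡∂ d).prod 𝓘(ℝ, Normal k d)).prod 𝓘(ℝ, ℝ)) (𝓡∂ d) ∞
        (fun z : (Y × Normal k d) × ℝ => normalShift e (chartRetraction k e z.1.1) (z.2 • z.1.2))
        ((y x, u x), 0) := by
      refine ContMDiffAt.comp (I' := (𝓡∂ d).prod 𝓘(ℝ, Normal k d))
        (g := fun p : Y × Normal k d => normalShift e p.1 p.2)
        (f := fun z : (Y × Normal k d) × ℝ => (chartRetraction k e z.1.1, z.2 • z.1.2)) _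
        (contMDiffAt_normalShift he.mem_maximalAtlas ?_ ?_) (ContMDiffAt.prodMk ?_ ?_)
      · simpa only [hret] using hgx.mem_source
      · simp only [hret, zero_smul, addNormal_zero]
        exact e.map_source hgx.mem_source
      · exact ContMDiffAt.comp (g := chartRetraction k e)
          (f := fun z : (Y × Normal k d) × ℝ => z.1.1)
          _ (contMDiffAt_normalShift_neg he.mem_maximalAtlas hgx.mem_source ht)
          (contMDiffAt_fst.comp _ contMDiffAt_fst)
      · exact contMDiffAt_snd.smul (contMDiffAt_snd.comp _ contMDiffAt_fst)
    have hS0 : normalShift e (chartRetraction k e (y x)) ((0 : ℝ) • u x) = y x := by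
      rw [hret, zero_smul, normalShift_zero hgx.mem_source]
    have hΦ : ContMDiffAt (𝓡∂ d) 𝓘(ℝ, Normal k d) ∞ (fun y => normalComponent e (s y)) (y x) :=
      ContMDiffAt.comp (g := normalComponent (ι := ι) e) (y x)
        (contMDiffAt_normalComponent he.mem_maximalAtlas hgx.proj_mem_source) hgx.smooth
    have hN : ContMDiffAt (((𝓡∂ d).prod 𝓘(ℝ, Normal k d)).prod 𝓘(ℝ, ℝ)) 𝓘(ℝ, Normal k d) ∞
        (fun z : (Y × Normal k d) × ℝ => normalComponent e
          (s (normalShift e (chartRetraction k e z.1.1) (z.2 • z.1.2)))) ((y x, u x), 0) :=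
      ContMDiffAt.comp (g := fun y => normalComponent e (s y)) _ (by rw [hS0]; exact hΦ) hS
    have hr0 : |normalCoord k e (y x) i| = 0 := by
      rw [← hw, he.normalCoord_eq_zero hws]
      simp
    refine ContMDiffAt.comp (f := fun x' => ((y x', u x'), |normalCoord k e (y x') i|)) x ?_
      ((hproj.prodMk hu).prodMk hr)
      (g := fun z : (Y × Normal k d) × ℝ => dslope (fun r => normalComponent e
          (s (normalShift e (chartRetraction k e z.1.1) (r • z.1.2)))) 0 z.2)
    rw [hr0]
    exact contMDiffAt_dslope hN
  · have hn : |normalCoord k e (y x) i| ≠ 0 := by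
      intro h
      have h1 := normalCoord_eq_abs_smul_unitDirection (x := x) he hgx.mem_source hi
      change normalCoord k e (y x) = |normalCoord k e (y x) i| • _ at h1
      rw [h, zero_smul, ← he.mem_range_iff _ hgx.mem_source] at h1
      exact hx h1
    have hΦ : ContMDiffAt (modelWithCornersEuclideanQuadrant d) 𝓘(ℝ, Normal k d) ∞
        (fun x => normalComponent e (s (y x))) x :=
      ContMDiffAt.comp (g := fun y => normalComponent e (s y)) x
        (ContMDiffAt.comp (g := normalComponent (ι := ι) e) (y x)
          (contMDiffAt_normalComponent he.mem_maximalAtlas hgx.proj_mem_source) hgx.smooth) hproj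
    refine ((hr.inv₀ hn).smul hΦ).congr_of_eventuallyEq ?_
    filter_upwards [hg, hr.continuousAt.eventually_ne hn] with x' ⟨h1, h2, h3, h4⟩ h5
    have h6 := normalComponent_eq_smul_inverseDirection hι hT he h1 h2 h3 h4
    change normalComponent e (s (y x')) = |normalCoord k e (y x') i| • _ at h6
    change _ = |normalCoord k e (y x') i|⁻¹ • normalComponent e (s (y x'))
    rw [h6, smul_smul, inv_mul_cancel₀ h5, one_smul]

/-- Every tubular map fits the structure of the blow-up. -/
theorem adapted_blowUp (hT : IsTubularMap ι V U T) :
    (blowUpStructure hι hclosed hboundary).Adapted U T := by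
  classical
  set A := blowUpStructure hι hclosed hboundary with hA
  have hproj : Continuous A.proj := (contMDiff_proj_blowUp hι hclosed hboundary).continuous
  refine ⟨fun m hm => ?_, hT.injOn_inducedMap, fun z hz => ?_⟩
  · let F : RestrictedTangent ι × ℝ → BlowUp ι := fun m' =>
      if h : m' ∈ cylinderDomain ι then inducedMap ι T (toHalfCylinder ι ⟨m', h⟩)
      else inducedMap ι T (toHalfCylinder ι m)
    have hF : ∀ m' : cylinderDomain ι, F m' = inducedMap ι T (toHalfCylinder ι m') :=
      fun m' => dif_pos m'.2
    exact ⟨F, fun m' _ => hF m', contMDiffWithinAt_blowUp_of_smoothLift hι hclosed hboundary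
      ⟨m.2, hm⟩ (hT.smoothLift_inducedMap hι hclosed hboundary hF m hm)⟩
  · obtain ⟨V₀, hV₀, s, hs, hsV⟩ := hT.diffeo.smooth_inverse z.toNormalBundle hz
    have hsU : ∀ y ∈ V₀, toNormal ι (s y) ∈ U ∧ T (toNormal ι (s y)) = y := fun y hy => by
      obtain ⟨_, h1, h2⟩ := hsV y hy
      exact ⟨h1, h2⟩
    have hzp : BlowUp.proj (inducedMap ι T z) = T z.toNormalBundle := hT.proj_inducedMap hz
    by_cases hr : T z.toNormalBundle ∈ range ι
    · obtain ⟨w, hw⟩ := hr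
      obtain ⟨e, he, hew⟩ := exists_isSliceChart hι hboundary w
      set x₀ : A.Space := inducedMap ι T z with hx₀
      have hx₀p : A.proj x₀ = ι w := hzp.trans hw.symm
      rw [← hw] at hV₀
      -- the local inverse of `T` has all required properties near `ι w`
      have hgood : ∀ᶠ y in 𝓝 (ι w), IsGoodAt e U T s y := by
        have h1 : ContinuousAt (fun y => ι (s y).proj) (ι w) :=
          ι.contMDiff.continuous.continuousAt.comp
            (contMDiff_restrictedTangent_proj.continuous.continuousAt.comp
              (hs.contMDiffAt hV₀).continuousAt)
        have h2 : ι (s (ι w)).proj ∈ e.source := by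
          obtain ⟨h3, h4⟩ := hsU _ (mem_of_mem_nhds hV₀)
          rw [(M5.normalComponent_eq_zero hι he hew (hT.eq_zeroSection h3 h4).1).1]
          exact hew
        filter_upwards [eventually_mem_nhds_iff.2 hV₀, e.open_source.mem_nhds hew,
          h1.eventually_mem (e.open_source.mem_nhds h2)] with y h3 h4 h5
        exact ⟨hs.contMDiffAt h3, mem_of_superset h3 hsU, h4, h5⟩
      have hret : ∀ᶠ y in 𝓝 (ι w), IsGoodAt e U T s (chartRetraction k e y) := by
        have h1 := (contMDiffAt_normalShift_neg (k := k) he.mem_maximalAtlas hew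
          (eventually_addNormal_neg_mem_target he hew).self_of_nhds.2).continuousAt.tendsto
        rw [show normalShift e (ι w) (-normalCoord k e (ι w)) = ι w from
          chartRetraction_map he hew] at h1
        exact h1.eventually hgood
      have hx₀s : A.proj x₀ ∈ e.source := hx₀p ▸ hew
      obtain ⟨i, hi⟩ := Function.ne_iff.1 (direction_ne_zero hι he (x := x₀) hx₀s)
      have hall : ∀ᶠ x' : A.Space in 𝓝 x₀,
          direction (ι := ι) e x' i ≠ 0 ∧ IsGoodAt e U T s (BlowUp.proj (ι := ι) x') ∧
          addNormal (e (BlowUp.proj (ι := ι) x')) (-normalCoord k e (BlowUp.proj (ι := ι) x'))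
            ∈ e.target ∧ IsGoodAt e U T s (chartRetraction k e (BlowUp.proj (ι := ι) x')) := by
        have ht : Tendsto A.proj (𝓝 x₀) (𝓝 (ι w)) := hx₀p ▸ hproj.continuousAt.tendsto
        filter_upwards [eventually_direction_ne_zero hι hclosed hboundary he hx₀s hi,
          ht.eventually hgood, ht.eventually (eventually_addNormal_neg_mem_target he hew),
          ht.eventually hret] with x' h1 h2 h3 h4 using ⟨h1, h2, h3.2, h4⟩
      refine ⟨_, eventually_eventually_nhds.2 hall, fun x =>
        (restrictedVector ι e (s (A.proj x)).proj (inverseDirection (ι := ι) e i s x),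
          |normalCoord k e (A.proj x) i|), fun x hx => ?_, fun x hx => ?_⟩
      · obtain ⟨h1, h2, h3, h4⟩ := hx.self_of_nhds
        refine ContMDiffAt.contMDiffWithinAt (ContMDiffAt.prodMk ?_
          (contMDiffAt_abs_normalCoord hι hclosed hboundary he h2.mem_source h1))
        refine ContMDiffAt.comp (I' := (𝓡∂ k).prod 𝓘(ℝ, Normal k d))
          (g := fun z : W × Normal k d => restrictedVector ι e z.1 z.2)
          (f := fun x : A.Space => ((s (A.proj x)).proj, inverseDirection (ι := ι) e i s x)) x
          (contMDiffAt_restrictedVector he.mem_maximalAtlas h2.proj_mem_source _)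
          (ContMDiffAt.prodMk ?_ (contMDiffAt_inverseDirection hι hclosed hboundary hT he hx))
        exact ContMDiffAt.comp (g := fun y => (s y).proj) x
          (contMDiff_restrictedTangent_proj.contMDiffAt.comp _ h2.smooth)
          (contMDiff_proj_blowUp hι hclosed hboundary).contMDiffAt
      · obtain ⟨h1, h2, h3, h4⟩ := hx.self_of_nhds
        set h := inverseDirection (ι := ι) e i s x with hh
        set w' := (s (A.proj x)).proj with hw'
        have hw's : ι w' ∈ e.source := h2.proj_mem_source
        have h5 : normalComponent e (restrictedVector ι e w' h) = h :=
          normalComponent_restrictedVector he.mem_maximalAtlas hw's h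
        have h6 : h ≠ 0 := inverseDirection_ne_zero hι hT he h1 h2 h3 h4
        have hD : ((restrictedVector ι e w' h, |normalCoord k e (A.proj x) i|) :
            RestrictedTangent ι × ℝ) ∈ cylinderDomain ι :=
          ⟨(normalClass_ne_zero_iff hι he hw's).2
            (show normalComponent e (restrictedVector ι e w' h) ≠ 0
            by rw [h5]; exact h6), abs_nonneg _⟩
        have h7 : toNormal ι (scale |normalCoord k e (A.proj x) i| (restrictedVector ι e w' h)) =
            toNormal ι (s (A.proj x)) := by
          refine (toNormal_eq_iff hι he (p := scale _ (restrictedVector ι e w' h))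
            (p' := s (A.proj x)) hw's).2 ⟨rfl, ?_⟩
          rw [normalComponent_scale, h5]
          exact (normalComponent_eq_smul_inverseDirection hι hT he h1 h2 h3 h4).symm
        obtain ⟨h8, h9⟩ := h2.eventually.self_of_nhds
        have h10 : T (toHalfCylinder ι ⟨_, hD⟩).toNormalBundle = A.proj x :=
          (congrArg T h7).trans h9
        refine ⟨hD, ?_, ?_⟩
        · have :
              toNormal ι (scale |normalCoord k e (A.proj x) i| (restrictedVector ι e w' h))
                ∈ U := by
            rw [h7]
            exact h8
          exact this
        · by_cases hxr : A.proj x ∈ range ι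
          · obtain ⟨w'', hw''⟩ := hxr
            have hww : w' = w'' := by
              have h2' : IsGoodAt e U T s (ι w'') := by
                rw [hw'']
                exact h2
              rw [hw', ← hw'']
              exact (h2'.normalComponent_eq_zero hT hι he).1
            have hxw : BlowUp.proj (ι := ι) x = ι w' := by
              rw [hww]
              exact hw''.symm
            have hray : IsRayOf (x : BlowUp ι) w' (normalVector e (ι w') h) := by
              refine isRayOf_normalVector hι he hw's h6 hxw ?_
              rw [hh, inverseDirection_of_mem hι hT he h1 h2 hxw]
              exact sameRay_unitDirection h1
            obtain ⟨h11, h12⟩ := hray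
            exact (inducedMap_of_mem (by rw [h10]; exact ⟨w'', hw''⟩)).trans h12.symm
          · have hxs : (x : BlowUp ι) ∉ sphereBundle ι := fun h => hxr (mem_sphereBundle_iff.1 h)
            exact eq_of_proj_eq hxs ((hT.proj_inducedMap (by
              change toNormal ι (scale |normalCoord k e (A.proj x) i|
                (restrictedVector ι e w' h)) ∈ U
              rw [h7]
              exact h8)).trans h10)
    · have hint : interior V₀ ∩ (range ι)ᶜ ∈ 𝓝 (T z.toNormalBundle) :=
        inter_mem (interior_mem_nhds.2 hV₀) (hclosed.isOpen_compl.mem_nhds hr)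
      refine ⟨A.proj ⁻¹' (interior V₀ ∩ (range ι)ᶜ), hproj.continuousAt.preimage_mem_nhds
        (by rw [show A.proj (inducedMap ι T z) = _ from hzp]; exact hint),
        fun x => (s (A.proj x), 1), fun x hx => ?_, fun x hx => ?_⟩
      · refine ContMDiffAt.contMDiffWithinAt (ContMDiffAt.prodMk ?_ contMDiffAt_const)
        exact ContMDiffAt.comp (g := s) x
          (hs.contMDiffAt (mem_interior_iff_mem_nhds.1 hx.1))
          (contMDiff_proj_blowUp hι hclosed hboundary).contMDiffAt
      · obtain ⟨h1, h2⟩ := hsU _ (interior_subset hx.1)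
        have hD : ((s (A.proj x), 1) : RestrictedTangent ι × ℝ) ∈ cylinderDomain ι := by
          refine ⟨fun h => hx.2 ?_, zero_le_one⟩
          have h3 : toNormal ι (s (A.proj x)) = zeroSection ι (s (A.proj x)).proj :=
            Sigma.mk.inj_iff.2 ⟨rfl, heq_of_eq h⟩
          rw [h3] at h1 h2
          exact ⟨_, (hT.map_zeroSection h1).symm.trans h2⟩
        have h7 : toNormal ι (scale 1 (s (A.proj x))) = toNormal ι (s (A.proj x)) := by
          rw [toNormal_scale, one_smul]
          rfl
        have h8 : toNormal ι (scale 1 (s (A.proj x))) ∈ U := by rw [h7]; exact h1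
        have hxs : (x : BlowUp ι) ∉ sphereBundle ι := fun h => hx.2 (mem_sphereBundle_iff.1 h)
        exact ⟨hD, h8, eq_of_proj_eq hxs ((hT.proj_inducedMap
          (c := toHalfCylinder ι ⟨_, hD⟩) h8).trans ((congrArg T h7).trans h2))⟩

end Inverse

/-! ### Uniqueness of the structure -/

section Diffeo

variable {E H E' H' E'' H'' M X X' Z : Type*}
    [NormedAddCommGroup E] [NormedSpace ℝ E] [TopologicalSpace H]
    [NormedAddCommGroup E'] [NormedSpace ℝ E'] [TopologicalSpace H']
    [NormedAddCommGroup E''] [NormedSpace ℝ E''] [TopologicalSpace H'']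
    [TopologicalSpace M] [ChartedSpace H M] [TopologicalSpace X] [ChartedSpace H' X]
    [TopologicalSpace X'] [ChartedSpace H'' X']
    {I : ModelWithCorners ℝ E H} {J : ModelWithCorners ℝ E' H'} {J' : ModelWithCorners ℝ E'' H''}

/-- A map between two structures that are parametrized by the same diffeomorphism is smooth. -/
theorem IsDiffeoOn.contMDiffAt_of_source {D : Set M} {q : D → Z} {f : Z → X} {f' : Z → X'}
    {U : Set Z} (hf : IsDiffeoOn I J q f U) (hf' : IsDiffeoOn I J' q f' U) {j : X → X'}
    (hj : ∀ z ∈ U, j (f z) = f' z) {z : Z} (hz : z ∈ U) : ContMDiffAt J J' ∞ j (f z) := by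
  obtain ⟨V, hV, s, hs, hsV⟩ := hf.smooth_inverse z hz
  have hzV := mem_of_mem_nhds hV
  obtain ⟨h1, h2, h3⟩ := hsV _ hzV
  obtain ⟨F, hF, hFs⟩ := hf'.smooth ⟨s (f z), h1⟩ h2
  refine ContMDiffWithinAt.contMDiffAt ?_ hV
  refine (hFs.comp (f z) (hs _ hzV) fun x hx => ?_).congr (fun x hx => ?_) ?_
  · obtain ⟨h4, h5, -⟩ := hsV x hx
    exact ⟨h4, h5⟩
  · obtain ⟨h4, h5, h6⟩ := hsV x hx
    exact (congrArg j h6).symm.trans ((hj _ h5).trans (hF ⟨s x, h4⟩ h5).symm)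
  · exact (congrArg j h3).symm.trans ((hj _ h2).trans (hF ⟨s (f z), h1⟩ h2).symm)

/-- A map between two structures that are mapped to `M` by the same diffeomorphism is smooth. -/
theorem IsDiffeoOn.contMDiffAt_of_target {U : Set X} {U' : Set X'} {p : X → M} {p' : X' → M}
    (hp : IsDiffeoOn J I (D := univ) (fun x => x.1) p U)
    (hp' : IsDiffeoOn J' I (D := univ) (fun x => x.1) p' U') (hU : IsOpen U) {j : X → X'}
    (hj : ∀ x ∈ U, j x ∈ U' ∧ p' (j x) = p x) {x : X} (hx : x ∈ U) : ContMDiffAt J J' ∞ j x := by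
  obtain ⟨F, hF, hFs⟩ := hp.smooth ⟨x, mem_univ x⟩ hx
  obtain ⟨V, hV, s, hs, hsV⟩ := hp'.smooth_inverse (j x) (hj x hx).1
  rw [(hj x hx).2] at hV
  have hF' : ∀ x' ∈ U, F x' = p x' := fun x' hx' => hF ⟨x', mem_univ x'⟩ hx'
  have hFx : ContMDiffAt J I ∞ F x := hFs.contMDiffAt (by
    filter_upwards [hU.mem_nhds hx] with x' hx' using ⟨mem_univ x', hx'⟩)
  have hV' : V ∈ 𝓝 (F x) := by rwa [hF' x hx]
  have hsF : ContMDiffAt I J' ∞ s (F x) := hs.contMDiffAt hV'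
  refine (hsF.comp x hFx).congr_of_eventuallyEq ?_
  filter_upwards [hU.mem_nhds hx, hFx.continuousAt.preimage_mem_nhds hV'] with x' h1 h2
  obtain ⟨_, h3, h4⟩ := hsV _ h2
  refine hp'.injOn (hj x' h1).1 h3 ?_
  rw [(hj x' h1).2]
  exact (h4.trans (hF' x' h1)).symm

end Diffeo

section Uniqueness

variable {k d : ℕ} [NeZero k] [NeZero d]
  {W : Type*} [TopologicalSpace W] [ChartedSpace (EuclideanHalfSpace k) W]
  {Y : Type*} [TopologicalSpace Y] [ChartedSpace (EuclideanHalfSpace d) Y]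
  [IsManifold (𝓡∂ d) ∞ Y] {ι : C^∞⟮𝓡∂ k, W; 𝓡∂ d, Y⟯}
  {e : OpenPartialHomeomorph Y (EuclideanHalfSpace d)}

/-- Off the sphere bundle both structures agree with that of `Y ∖ W`, and near a point of the sphere
bundle both are parametrized by the map induced by the same tubular map. -/
theorem contMDiff_id_of_adapted {A B : CornerStructure d (BlowUp ι)} (hA : A.ExtendsComplement)
    (hB : B.ExtendsComplement)
    (h : ∀ w, ∃ V U T, IsTubularMap ι V U T ∧ w ∈ V ∧ A.Adapted U T ∧ B.Adapted U T) :
    ContMDiff (modelWithCornersEuclideanQuadrant d) (modelWithCornersEuclideanQuadrant d) ∞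
      (fun x : A.Space => (show B.Space from x)) := by
  intro x
  by_cases hx : x ∈ A.sphere
  · obtain ⟨w, ρ, hxρ⟩ := hx
    obtain ⟨V, U, T, hT, hw, hAT, hBT⟩ := h w
    let c : HalfCylinder ι := ⟨w, ρ, 0, fun h => (h rfl).elim⟩
    have hc : c ∈ HalfCylinder.toNormalBundle ⁻¹' U := (hT.zero_mem_iff w).2 hw
    have hTc : T c.toNormalBundle ∈ range ι := ⟨w, (hT.map_zero w hw).symm⟩
    have hxc : x = (show A.Space from inducedMap ι T c) :=
      hxρ.trans (inducedMap_of_mem hTc).symm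
    rw [hxc]
    exact IsDiffeoOn.contMDiffAt_of_source hAT hBT (fun _ _ => rfl) hc
  · exact IsDiffeoOn.contMDiffAt_of_target hA.2 hB.2 hA.1 (fun x hx => ⟨hx, rfl⟩) hx

theorem same_of_adapted {A B : CornerStructure d (BlowUp ι)} (hA : A.ExtendsComplement)
    (hB : B.ExtendsComplement)
    (h : ∀ w, ∃ V U T, IsTubularMap ι V U T ∧ w ∈ V ∧ A.Adapted U T ∧ B.Adapted U T) :
    A.Same B := by
  refine ⟨contMDiff_id_of_adapted hA hB h, contMDiff_id_of_adapted hB hA fun w => ?_⟩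
  obtain ⟨V, U, T, hT, hw, h1, h2⟩ := h w
  exact ⟨V, U, T, hT, hw, h2, h1⟩

/-! ### Tubular maps in slice charts -/

/-- The normal coordinates of a normal vector. -/
def chartNormal (e : OpenPartialHomeomorph Y (EuclideanHalfSpace d)) (n : NormalBundle ι) :
    Normal k d :=
  normalDeriv k e (ι n.1) (Function.surjInv (Submodule.Quotient.mk_surjective _) n.2)

/-- The tubular map given by the linear structure of a slice chart. -/
def chartTubularMap (e : OpenPartialHomeomorph Y (EuclideanHalfSpace d)) (n : NormalBundle ι) : Y :=
  normalShift e (ι n.1) (chartNormal e n)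

/-- The domain of `chartTubularMap`. -/
def chartTubularDomain (ι : C^∞⟮𝓡∂ k, W; 𝓡∂ d, Y⟯)
    (e : OpenPartialHomeomorph Y (EuclideanHalfSpace d)) : Set (NormalBundle ι) :=
  {n | ι n.1 ∈ e.source ∧ addNormal (e (ι n.1)) (chartNormal e n) ∈ e.target}

theorem exists_toNormal_eq (n : NormalBundle ι) : ∃ p, toNormal ι p = n := by
  obtain ⟨w, n⟩ := n
  obtain ⟨v, rfl⟩ := Submodule.Quotient.mk_surjective _ n
  exact ⟨⟨w, v⟩, rfl⟩

theorem normalComponent_zero (w : W) :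
    normalComponent e (⟨w, 0⟩ : RestrictedTangent ι) = 0 := map_zero (normalDeriv k e (ι w))

variable (hι : IsSmoothEmbedding (𝓡∂ k) (𝓡∂ d) ∞ ι) (he : IsSliceChart ι e)
include hι he

theorem chartNormal_toNormal {p : RestrictedTangent ι} (hp : ι p.proj ∈ e.source) :
    chartNormal e (toNormal ι p) = normalComponent e p :=
  (normalClass_eq_iff hι he hp _ _).1
    (Function.surjInv_eq (Submodule.Quotient.mk_surjective _) (normalClass ι p.proj p.snd))

theorem chartTubularMap_toNormal {p : RestrictedTangent ι} (hp : ι p.proj ∈ e.source) :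
    chartTubularMap e (toNormal ι p) = normalShift e (ι p.proj) (normalComponent e p) := by
  rw [← chartNormal_toNormal hι he hp]
  rfl

theorem toNormal_mem_chartTubularDomain {p : RestrictedTangent ι} :
    toNormal ι p ∈ chartTubularDomain ι e ↔
      ι p.proj ∈ e.source ∧ addNormal (e (ι p.proj)) (normalComponent e p) ∈ e.target :=
  and_congr_right fun hp => by rw [chartNormal_toNormal hι he hp]; rfl

theorem zeroSection_mem_chartTubularDomain {w : W} :
    zeroSection ι w ∈ chartTubularDomain ι e ↔ ι w ∈ e.source := by
  rw [zeroSection_eq_toNormal, toNormal_mem_chartTubularDomain hι he, normalComponent_zero,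
    addNormal_zero]
  exact and_iff_left_of_imp fun h => e.map_source h

theorem chartTubularMap_zeroSection {w : W} (hw : ι w ∈ e.source) :
    chartTubularMap e (zeroSection ι w) = ι w := by
  rw [zeroSection_eq_toNormal, chartTubularMap_toNormal hι he hw, normalComponent_zero,
    normalShift_zero hw]

theorem isOpen_chartTubularDomain : IsOpen (toNormal ι ⁻¹' chartTubularDomain ι e) := by
  rw [isOpen_iff_mem_nhds]
  intro p hp
  have hp' := (toNormal_mem_chartTubularDomain hι he).1 hp
  have h1 : Continuous fun p : RestrictedTangent ι => ι p.proj :=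
    ι.contMDiff.continuous.comp contMDiff_restrictedTangent_proj.continuous
  have h2 : ContinuousAt (fun p : RestrictedTangent ι =>
      addNormal (e (ι p.proj)) (normalComponent e p)) p :=
    ContinuousAt.comp (g := fun z : EuclideanHalfSpace d × Normal k d => addNormal z.1 z.2)
      (contMDiff_addNormal (n := 0)).continuous.continuousAt
      (((e.continuousAt hp'.1).comp_of_eq h1.continuousAt rfl).prodMk
        (contMDiffAt_normalComponent he.mem_maximalAtlas hp'.1).continuousAt)
  filter_upwards [h1.continuousAt.eventually_mem (e.open_source.mem_nhds hp'.1),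
    h2.eventually_mem (e.open_target.mem_nhds hp'.2)] with p' h3 h4
  exact (toNormal_mem_chartTubularDomain hι he).2 ⟨h3, h4⟩

theorem isDiffeoOn_chartTubularMap :
    IsDiffeoOn ((𝓡∂ k).prod 𝓘(ℝ, EuclideanSpace ℝ (Fin d))) (𝓡∂ d)
      (D := univ) (fun p => toNormal ι p.1) (chartTubularMap e) (chartTubularDomain ι e) := by
  refine ⟨?_, ?_, ?_⟩
  · rintro ⟨p, _⟩ hp
    refine ⟨fun p => normalShift e (ι p.proj) (normalComponent e p), ?_, ?_⟩
    · rintro ⟨p', _⟩ hp'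
      exact (chartTubularMap_toNormal hι he ((toNormal_mem_chartTubularDomain hι he).1 hp').1).symm
    · have hp' := (toNormal_mem_chartTubularDomain hι he).1 hp
      refine ContMDiffAt.contMDiffWithinAt ?_
      refine ContMDiffAt.comp (I' := (𝓡∂ d).prod 𝓘(ℝ, Normal k d))
        (g := fun z : Y × Normal k d => normalShift e z.1 z.2)
        (f := fun p : RestrictedTangent ι => (ι p.proj, normalComponent e p)) p
        (contMDiffAt_normalShift he.mem_maximalAtlas hp'.1 hp'.2)
        (ContMDiffAt.prodMk ?_ (contMDiffAt_normalComponent he.mem_maximalAtlas hp'.1))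
      exact ι.contMDiff.contMDiffAt.comp p contMDiff_restrictedTangent_proj.contMDiffAt
  · intro n hn n' hn' h
    obtain ⟨p, rfl⟩ := exists_toNormal_eq n
    obtain ⟨p', rfl⟩ := exists_toNormal_eq n'
    rw [toNormal_mem_chartTubularDomain hι he] at hn hn'
    rw [chartTubularMap_toNormal hι he hn.1, chartTubularMap_toNormal hι he hn'.1] at h
    have h1 := e.symm.injOn hn.2 hn'.2 h
    have h2 : normalComponent e p = normalComponent e p' := by
      have := congrArg (normalPart k) h1
      rw [normalPart_addNormal, normalPart_addNormal] at this
      change normalCoord k e _ + _ = normalCoord k e _ + _ at this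
      rwa [he.normalCoord_eq_zero hn.1, he.normalCoord_eq_zero hn'.1, zero_add, zero_add] at this
    have h3 : e (ι p.proj) = e (ι p'.proj) := by
      rw [h2] at h1
      have := congrArg (fun z => addNormal z (-normalComponent e p')) h1
      simpa using this
    exact (toNormal_eq_iff hι he hn.1).2
      ⟨hι.isEmbedding.injective (e.injOn hn.1 hn'.1 h3), h2⟩
  · intro n hn
    obtain ⟨p, rfl⟩ := exists_toNormal_eq n
    have : Nonempty W := ⟨p.proj⟩
    rw [toNormal_mem_chartTubularDomain hι he] at hn
    rw [chartTubularMap_toNormal hι he hn.1]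
    have hy : normalShift e (ι p.proj) (normalComponent e p) ∈ e.source :=
      normalShift_mem_source hn.2
    have hn' : addNormal (e (normalShift e (ι p.proj) (normalComponent e p)))
        (-normalCoord k e (normalShift e (ι p.proj) (normalComponent e p))) ∈ e.target := by
      rw [normalCoord_normalShift hn.2, he.normalCoord_eq_zero hn.1, zero_add, normalShift,
        e.right_inv hn.2, addNormal_addNormal, add_neg_cancel, addNormal_zero]
      exact e.map_source hn.1
    refine ⟨{y | y ∈ e.source ∧ addNormal (e y) (-normalCoord k e y) ∈ e.target},
      (e.open_source.eventually_mem hy).and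
        ((continuousAt_addNormal_neg hy).eventually_mem (e.open_target.mem_nhds hn')),
      fun y => restrictedVector ι e (sliceRetraction ι e y) (normalCoord k e y),
      fun y hy => ?_, fun y hy => ⟨mem_univ _, ?_⟩⟩
    · have h1 : ι (sliceRetraction ι e y) ∈ e.source := by
        rw [map_sliceRetraction he hy.2]
        exact normalShift_mem_source hy.2
      refine ContMDiffAt.contMDiffWithinAt ?_
      exact ContMDiffAt.comp (I' := (𝓡∂ k).prod 𝓘(ℝ, Normal k d))
        (g := fun z : W × Normal k d => restrictedVector ι e z.1 z.2)
        (f := fun y => (sliceRetraction ι e y, normalCoord k e y)) y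
        (contMDiffAt_restrictedVector he.mem_maximalAtlas h1 _)
        ((contMDiffAt_sliceRetraction hι he hy.1 hy.2).prodMk
          (contMDiffAt_normalCoord he.mem_maximalAtlas hy.1))
    · have h0 := map_sliceRetraction he hy.2
      have h1 : ι (sliceRetraction ι e y) ∈ e.source := by
        rw [h0]
        exact normalShift_mem_source hy.2
      have h2 := normalComponent_restrictedVector (ι := ι) he.mem_maximalAtlas h1
        (normalCoord k e y)
      have h3 : addNormal (e (ι (sliceRetraction ι e y))) (normalCoord k e y) = e y := by
        rw [h0, normalShift, e.right_inv hy.2, addNormal_addNormal, neg_add_cancel, addNormal_zero]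
      constructor
      · refine (toNormal_mem_chartTubularDomain hι he).2 ⟨h1, ?_⟩
        rw [h2]
        change addNormal (e (ι (sliceRetraction ι e y))) _ ∈ _
        rw [h3]
        exact e.map_source hy.1
      · refine (chartTubularMap_toNormal hι he h1).trans ?_
        rw [h2]
        change e.symm (addNormal (e (ι (sliceRetraction ι e y))) _) = _
        rw [h3, e.left_inv hy.1]

/-- In a slice chart, adding the normal coordinates of a normal vector to its base point is a
tubular map. -/
theorem isTubularMap_chartTubularMap :
    IsTubularMap ι (ι ⁻¹' e.source) (chartTubularDomain ι e) (chartTubularMap e) where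
  isOpen := isOpen_chartTubularDomain hι he
  diffeo := isDiffeoOn_chartTubularMap hι he
  zero_mem_iff _ := zeroSection_mem_chartTubularDomain hι he
  mem_range_iff w := by
    constructor
    · rintro ⟨n, hn, h⟩
      obtain ⟨p, rfl⟩ := exists_toNormal_eq n
      rw [toNormal_mem_chartTubularDomain hι he] at hn
      rw [chartTubularMap_toNormal hι he hn.1] at h
      change ι w ∈ e.source
      rw [← h]
      exact normalShift_mem_source hn.2
    · intro hw
      exact ⟨zeroSection ι w, (zeroSection_mem_chartTubularDomain hι he).2 hw,
        chartTubularMap_zeroSection hι he hw⟩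
  map_zero _ hw := chartTubularMap_zeroSection hι he hw
  normal_deriv w hw v := by
    have hw : ι w ∈ e.source := hw
    have h1 : (fun t : ℝ => chartTubularMap e (⟨w, t • normalClass ι w v⟩ : NormalBundle ι)) =
        fun t : ℝ => normalShift e (ι w) (t • normalDeriv k e (ι w) v) := by
      funext t
      have h2 := chartTubularMap_toNormal hι he (p := scale t ⟨w, v⟩) hw
      rw [normalComponent_scale] at h2
      exact h2
    refine (normalClass_eq_iff hι he hw _ _).2 ?_
    rw [h1]
    exact normalDeriv_normalVector he.mem_maximalAtlas hw _

end Uniqueness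

/-! ### Faces of a manifold with corners -/

namespace CornerStructure

section Faces

variable {n : ℕ} {X : Type*} {A : CornerStructure n X} {m : ℕ} {F : Fin m → Set A.Space}

/-- The closed sets `F i` are the hypersurfaces of a system of corners: near each point `x`, those
that contain `x` are the zero sets of distinct coordinates of the chart at `x`, and these are the
only coordinates that vanish at `x`. -/
structure IsCornerSystem (A : CornerStructure n X) (F : Fin m → Set A.Space) : Prop where
  isClosed : ∀ i, IsClosed (F i)
  exists_coord : ∀ x, ∃ a : Fin m → Fin n, InjOn a {i | x ∈ F i} ∧
    (∀ j, extChartAt (modelWithCornersEuclideanQuadrant n) x x j = 0 ↔ ∃ i, x ∈ F i ∧ a i = j) ∧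
    ∀ i, x ∈ F i → ∀ᶠ y in 𝓝 x,
      (y ∈ F i ↔ extChartAt (modelWithCornersEuclideanQuadrant n) x y (a i) = 0)

theorem extChartAt_nonneg (x y : A.Space) (j : Fin n) :
    0 ≤ extChartAt (modelWithCornersEuclideanQuadrant n) x y j :=
  (chartAt (EuclideanQuadrant n) x y).2 j

theorem range_quadrant :
    range (modelWithCornersEuclideanQuadrant n) = {q | ∀ j, 0 ≤ q j} :=
  range_euclideanQuadrant n

theorem mem_boundary_iff_depth {x : A.Space} :
    x ∈ (modelWithCornersEuclideanQuadrant n).boundary A.Space ↔ A.depth x ≠ 0 := by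
  change ModelWithCorners.IsBoundaryPoint _ x ↔ _
  rw [ModelWithCorners.isBoundaryPoint_iff_not_isInteriorPoint, ModelWithCorners.IsInteriorPoint,
    range_quadrant, interior_euclideanQuadrant, mem_ofPred_eq, not_forall, depth, Ne,
    ncard_eq_zero, ← Ne, ← nonempty_iff_ne_empty]
  exact exists_congr fun j => ⟨fun h => le_antisymm (not_lt.1 h) (extChartAt_nonneg x x j),
    fun h => not_lt.2 (le_of_eq h)⟩

namespace IsCornerSystem

variable (hF : A.IsCornerSystem F)
include hF

theorem depth_eq (x : A.Space) : A.depth x = {i | x ∈ F i}.ncard := by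
  obtain ⟨a, ha, hz, -⟩ := hF.exists_coord x
  rw [depth, ← ha.ncard_image]
  congr 1
  ext j
  exact hz j

theorem depth_eq_one_iff {x : A.Space} {i : Fin m} (hx : x ∈ F i) :
    A.depth x = 1 ↔ ∀ j, x ∈ F j → j = i := by
  rw [hF.depth_eq, ncard_eq_one]
  constructor
  · rintro ⟨l, hl⟩ j hj
    have h1 : j ∈ ({l} : Set (Fin m)) := hl ▸ hj
    have h2 : i ∈ ({l} : Set (Fin m)) := hl ▸ hx
    exact h1.trans h2.symm
  · intro h
    exact ⟨i, Subset.antisymm (fun j hj => h j hj) (singleton_subset_iff.2 hx)⟩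

theorem exists_mem_of_depth {x : A.Space} (hx : A.depth x ≠ 0) : ∃ i, x ∈ F i := by
  rw [hF.depth_eq, Ne, ncard_eq_zero, ← Ne, ← nonempty_iff_ne_empty] at hx
  exact hx

theorem boundary_eq :
    (modelWithCornersEuclideanQuadrant n).boundary A.Space = ⋃ i, F i := by
  ext x
  rw [mem_boundary_iff_depth, mem_iUnion]
  refine ⟨hF.exists_mem_of_depth, ?_⟩
  rintro ⟨i, hi⟩
  rw [hF.depth_eq, Ne, ncard_eq_zero, ← Ne, ← nonempty_iff_ne_empty]
  exact ⟨i, hi⟩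

/-- Near a point `x` of `F i` the points of depth one of `F i` form a connected set with `x` in its
closure: in the chart at `x` they form a convex set. -/
theorem exists_nhds {x : A.Space} {i : Fin m} (hx : x ∈ F i) :
    ∃ N ∈ 𝓝 x, IsPreconnected (N ∩ (F i ∩ {y | A.depth y = 1})) ∧
      x ∈ closure (N ∩ (F i ∩ {y | A.depth y = 1})) := by
  obtain ⟨a, ha, hz, hn⟩ := hF.exists_coord x
  set I := modelWithCornersEuclideanQuadrant n
  set φ := extChartAt I x with hφ
  have h1 : ∀ᶠ y in 𝓝 x, (∀ l, x ∉ F l → y ∉ F l) ∧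
      (∀ l, x ∈ F l → (y ∈ F l ↔ φ y (a l) = 0)) ∧
      ∀ j, (∀ l, x ∈ F l → a l ≠ j) → 0 < φ y j := by
    refine (eventually_all.2 fun l => ?_).and ((eventually_all.2 fun l => ?_).and
      (eventually_all.2 fun j => ?_))
    · by_cases hl : x ∈ F l
      · exact .of_forall fun _ h => absurd hl h
      · filter_upwards [(hF.isClosed l).isOpen_compl.mem_nhds hl] with y hy _ using hy
    · by_cases hl : x ∈ F l
      · filter_upwards [hn l hl] with y hy _ using hy
      · exact .of_forall fun _ h => absurd h hl
    · by_cases hj : ∀ l, x ∈ F l → a l ≠ j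
      · have h2 : 0 < φ x j := lt_of_le_of_ne (extChartAt_nonneg x x j) fun h => by
          obtain ⟨l, hl, hlj⟩ := (hz j).1 h.symm
          exact hj l hl hlj
        have h3 : ContinuousAt (fun y => φ y j) x :=
          (PiLp.continuous_apply 2 _ j).continuousAt.comp (continuousAt_extChartAt x)
        filter_upwards [h3.eventually (lt_mem_nhds h2)] with y hy _ using hy
      · exact .of_forall fun _ h => absurd h hj
  rw [← map_extChartAt_symm_nhdsWithin_range (I := I) x, eventually_map] at h1
  obtain ⟨r, hr, hball⟩ := Metric.mem_nhdsWithin_iff.1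
    (h1.and (extChartAt_target_mem_nhdsWithin (I := I) x))
  set B := Metric.ball (φ x) r ∩ range I
  have hB : B ⊆ φ.target := fun q hq => (hball hq).2
  let Q : Set (EuclideanSpace ℝ (Fin n)) :=
    Metric.ball (φ x) r ∩ {q | q (a i) = 0 ∧ ∀ j, j ≠ a i → 0 < q j}
  have hQB : Q ⊆ B := fun q hq => ⟨hq.1, by
    rw [range_quadrant]
    intro j
    by_cases hj : j = a i
    · rw [hj, hq.2.1]
    · exact (hq.2.2 j hj).le⟩
  have hset : φ.symm '' B ∩ (F i ∩ {y | A.depth y = 1}) = φ.symm '' Q := by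
    ext y
    constructor
    · rintro ⟨⟨q, hq, rfl⟩, hyi, hy1⟩
      have hy1' := (hF.depth_eq_one_iff hyi).1 hy1
      obtain ⟨⟨h2, h3, h4⟩, -⟩ := hball hq
      have h5 := hB hq
      rw [φ.right_inv h5] at h3 h4
      refine ⟨q, ⟨hq.1, (h3 i hx).1 hyi, fun j hj => ?_⟩, rfl⟩
      by_cases hj' : ∀ l, x ∈ F l → a l ≠ j
      · exact h4 j hj'
      · push Not at hj'
        obtain ⟨l, hl, rfl⟩ := hj'
        have hq2 := hq.2
        rw [range_quadrant] at hq2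
        refine lt_of_le_of_ne (hq2 _) fun h => hj ?_
        rw [hy1' l ((h3 l hl).2 h.symm)]
    · rintro ⟨q, hq, rfl⟩
      obtain ⟨⟨h2, h3, h4⟩, -⟩ := hball (hQB hq)
      have h5 := hB (hQB hq)
      rw [φ.right_inv h5] at h3
      have hyi := (h3 i hx).2 hq.2.1
      refine ⟨⟨q, hQB hq, rfl⟩, hyi, (hF.depth_eq_one_iff hyi).2 fun l hl => ?_⟩
      by_cases hxl : x ∈ F l
      · by_contra hli
        exact (hq.2.2 (a l) fun h => hli (ha hxl hx h)).ne' ((h3 l hxl).1 hl)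
      · exact absurd hl (h2 l hxl)
  have hcont : ContinuousOn φ.symm B := (continuousOn_extChartAt_symm x).mono hB
  have hxB : φ x ∈ B := ⟨Metric.mem_ball_self hr, mem_range_self _⟩
  refine ⟨φ.symm '' B, ?_, ?_, ?_⟩
  · rw [← map_extChartAt_symm_nhdsWithin_range (I := I) x]
    refine image_mem_map ?_
    exact inter_mem (mem_nhdsWithin_of_mem_nhds (Metric.ball_mem_nhds _ hr)) self_mem_nhdsWithin
  · rw [hset]
    refine IsPreconnected.image (Convex.isPreconnected ?_) _ (hcont.mono hQB)
    refine (convex_ball _ _).inter ?_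
    intro p hp q hq s t hs ht hst
    refine ⟨by simp [hp.1, hq.1], fun j hj => ?_⟩
    have h2 := hp.2 j hj
    have h3 := hq.2 j hj
    simp only [PiLp.add_apply, PiLp.smul_apply, smul_eq_mul]
    rcases hs.lt_or_eq with h | h
    · have := mul_pos h h2
      have := mul_nonneg ht h3.le
      linarith
    · rw [← h, zero_mul, zero_add]
      exact mul_pos (by linarith) h3
  · rw [hset]
    have hcl : φ x ∈ closure Q := by
      let v : EuclideanSpace ℝ (Fin n) := WithLp.toLp 2 fun j => if j = a i then 0 else 1
      have hlim : Tendsto (fun t : ℝ => φ x + t • v) (𝓝[>] 0) (𝓝 (φ x)) := by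
        have : Continuous fun t : ℝ => φ x + t • v := by fun_prop
        have := this.tendsto 0
        simp only [zero_smul, add_zero] at this
        exact this.mono_left nhdsWithin_le_nhds
      refine mem_closure_of_tendsto hlim ?_
      filter_upwards [hlim.eventually_mem (Metric.ball_mem_nhds _ hr), self_mem_nhdsWithin]
        with t ht ht0
      have hz' : φ x (a i) = 0 := (hz _).2 ⟨i, hx, rfl⟩
      refine ⟨ht, by simp [hz', v], fun j hj => ?_⟩
      have h2 : 0 ≤ φ x j := extChartAt_nonneg x x j
      have h3 : (0 : ℝ) < t := ht0
      simp only [PiLp.add_apply, PiLp.smul_apply, smul_eq_mul, v, if_neg hj, mul_one]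
      linarith
    have := (hcont _ hxB).mono hQB |>.mem_closure_image hcl
    rwa [extChartAt_to_inv] at this

/-- A connected subset of the points of depth one is contained in each of the `F i` that it
meets. -/
theorem subset_of_isPreconnected {S : Set A.Space} (hS : IsPreconnected S)
    (h1 : S ⊆ {y | A.depth y = 1}) {y : A.Space} (hy : y ∈ S) {i : Fin m} (hyi : y ∈ F i) :
    S ⊆ F i := by
  have hcl : IsClosed (⋃ j ∈ {j | j ≠ i}, F j) :=
    (toFinite _).isClosed_biUnion fun j _ => hF.isClosed j
  have hcover : S ⊆ F i ∪ ⋃ j ∈ {j | j ≠ i}, F j := fun z hz => by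
    obtain ⟨j, hj⟩ := hF.exists_mem_of_depth (x := z) (by rw [h1 hz]; exact one_ne_zero)
    by_cases hji : j = i
    · exact .inl (hji ▸ hj)
    · exact .inr (mem_iUnion₂.2 ⟨j, hji, hj⟩)
  have hdisj : S ∩ (F i ∩ ⋃ j ∈ {j | j ≠ i}, F j) = ∅ := by
    refine eq_empty_of_forall_notMem fun z hz => ?_
    obtain ⟨j, hji, hj⟩ := mem_iUnion₂.1 hz.2.2
    exact hji ((hF.depth_eq_one_iff hz.2.1).1 (h1 hz.1) j hj)
  rcases isPreconnected_iff_subset_of_disjoint_closed.1 hS _ _ (hF.isClosed i) hcl hcover hdisj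
    with h | h
  · exact h
  · exact absurd (show y ∈ S ∩ (F i ∩ ⋃ j ∈ {j | j ≠ i}, F j) from ⟨hy, hyi, h hy⟩)
      (by rw [hdisj]; exact notMem_empty y)

theorem component_subset {y : A.Space} (hy : A.depth y = 1) {i : Fin m} (hyi : y ∈ F i) :
    connectedComponentIn {y | A.depth y = 1} y ⊆ F i :=
  hF.subset_of_isPreconnected isPreconnected_connectedComponentIn (connectedComponentIn_subset _ _)
    (mem_connectedComponentIn hy) hyi

/-- Each connected face lies in one of the `F i`. -/
theorem exists_superset {G : Set A.Space} (hG : A.IsConnectedFace G) : ∃ i, G ⊆ F i := by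
  obtain ⟨y, hy, rfl⟩ := hG
  obtain ⟨i, hi⟩ := hF.exists_mem_of_depth (x := y) (by rw [hy]; exact one_ne_zero)
  exact ⟨i, closure_minimal (hF.component_subset hy hi) (hF.isClosed i)⟩

theorem eq_of_subset {G : Set A.Space} (hG : A.IsConnectedFace G) {i j : Fin m} (hi : G ⊆ F i)
    (hj : G ⊆ F j) : i = j := by
  obtain ⟨y, hy, rfl⟩ := hG
  have hyG := subset_closure (mem_connectedComponentIn (F := {y | A.depth y = 1}) hy)
  exact (hF.depth_eq_one_iff (hj hyG)).1 hy i (hi hyG)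

theorem existsUnique_connectedFace {x : A.Space} {i : Fin m} (hx : x ∈ F i) :
    ∃! G, (A.IsConnectedFace G ∧ x ∈ G) ∧ G ⊆ F i := by
  obtain ⟨N, hN, hconn, hcl⟩ := hF.exists_nhds hx
  obtain ⟨y, hyN, hyi, hy⟩ := closure_nonempty_iff.1 ⟨x, hcl⟩
  have hsub := hconn.subset_connectedComponentIn ⟨hyN, hyi, hy⟩
    (show _ ⊆ {y | A.depth y = 1} from fun z hz => hz.2.2)
  refine ⟨closure (connectedComponentIn {y | A.depth y = 1} y),
    ⟨⟨⟨y, hy, rfl⟩, closure_mono hsub hcl⟩,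
      closure_minimal (hF.component_subset hy hyi) (hF.isClosed i)⟩, ?_⟩
  rintro _ ⟨⟨⟨z, hz, rfl⟩, hxz⟩, hzi⟩
  obtain ⟨z', hz'N, hz'⟩ := mem_closure_iff_nhds.1 hxz N hN
  have hz'1 := connectedComponentIn_subset _ _ hz'
  have := hsub ⟨hz'N, hzi (subset_closure hz'), hz'1⟩
  rw [connectedComponentIn_eq hz', connectedComponentIn_eq this]

theorem isManifoldWithFaces : A.IsManifoldWithFaces := by
  intro x
  rw [hF.depth_eq, (toFinite _).cast_ncard_eq]
  symm
  choose G hG _ using fun i : {i | x ∈ F i} => hF.existsUnique_connectedFace i.2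
  refine encard_congr (Equiv.ofBijective
    (fun i => (⟨G i, (hG i).1⟩ : {F : Set A.Space | A.IsConnectedFace F ∧ x ∈ F})) ⟨?_, ?_⟩)
  · intro i j h
    have h' : G i = G j := congrArg Subtype.val h
    exact Subtype.ext (hF.eq_of_subset (hG i).1.1 (hG i).2 (h' ▸ (hG j).2))
  · rintro ⟨K, hK⟩
    obtain ⟨i, hi⟩ := hF.exists_superset hK.1
    refine ⟨⟨i, hi hK.2⟩, Subtype.ext ?_⟩
    exact (hF.existsUnique_connectedFace (hi hK.2)).unique (hG _) ⟨hK, hi⟩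

theorem isFace (i : Fin m) : A.IsFace (F i) := by
  refine ⟨{G | A.IsConnectedFace G ∧ G ⊆ F i}, fun G hG => hG.1, ?_, ?_⟩
  · intro G hG K hK hne
    refine disjoint_left.2 fun x hx hx' => hne ?_
    exact (hF.existsUnique_connectedFace (hG.2 hx)).unique ⟨⟨hG.1, hx⟩, hG.2⟩ ⟨⟨hK.1, hx'⟩, hK.2⟩
  · refine Subset.antisymm (fun x hx => ?_) (sUnion_subset fun G hG => hG.2)
    obtain ⟨G, hG, -⟩ := hF.existsUnique_connectedFace hx
    exact ⟨G, ⟨hG.1.1, hG.2⟩, hG.1.2⟩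

/-- If no point has depth more than two, the intersection of two of the sets is a disjoint union of
components of the points of depth two of the first; these components are closed. -/
theorem isFaceOf_inter (h2 : ∀ x, A.depth x ≤ 2) {i j : Fin m} (hij : i ≠ j) :
    A.IsFaceOf (F i ∩ F j) (F i) := by
  have hdepth : ∀ {x i j}, i ≠ j → x ∈ F i → x ∈ F j → A.depth x = 2 ∧
      ∀ l, x ∈ F l → l = i ∨ l = j := by
    intro x i j hij hi hj
    have h3 : ({i, j} : Set (Fin m)) ⊆ {l | x ∈ F l} := by
      rintro l (rfl | rfl)
      exacts [hi, hj]
    have h4 := ncard_pair hij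
    have h5 := ncard_le_ncard h3
    have h6 := h2 x
    rw [hF.depth_eq] at h6 ⊢
    refine ⟨by omega, fun l hl => ?_⟩
    have := eq_of_subset_of_ncard_le h3 (by omega)
    exact (this ▸ hl : l ∈ ({i, j} : Set (Fin m)))
  have hex : ∀ {x i}, x ∈ F i → A.depth x = 2 → ∃ j, j ≠ i ∧ x ∈ F j := by
    intro x i hi hx
    rw [hF.depth_eq] at hx
    obtain ⟨l, hl, hli⟩ := exists_ne_of_one_lt_ncard (by omega : 1 < {i | x ∈ F i}.ncard) i
    exact ⟨l, hli, hl⟩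
  have hEcl : IsClosed (F i ∩ {y | A.depth y = 2}) := by
    have : F i ∩ {y | A.depth y = 2} = F i ∩ ⋃ j ∈ {j | j ≠ i}, F j := by
      ext x
      constructor
      · rintro ⟨h3, h4⟩
        obtain ⟨l, hli, hl⟩ := hex h3 h4
        exact ⟨h3, mem_iUnion₂.2 ⟨l, hli, hl⟩⟩
      · rintro ⟨h3, h4⟩
        obtain ⟨l, hli, hl⟩ := mem_iUnion₂.1 h4
        exact ⟨h3, (hdepth hli hl h3).1⟩
    rw [this]
    exact (hF.isClosed i).inter ((toFinite _).isClosed_biUnion fun j _ => hF.isClosed j)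
  set E := F i ∩ {y | A.depth y = 2}
  have hsub : ∀ x ∈ F i ∩ F j, connectedComponentIn E x ⊆ F i ∩ F j := by
    intro x hx
    have hxE : x ∈ E := ⟨hx.1, (hdepth hij hx.1 hx.2).1⟩
    have hcl : IsClosed (⋃ l ∈ {l | l ≠ i ∧ l ≠ j}, F l) :=
      (toFinite _).isClosed_biUnion fun j _ => hF.isClosed j
    have hcover : connectedComponentIn E x ⊆ F j ∪ ⋃ l ∈ {l | l ≠ i ∧ l ≠ j}, F l := by
      intro z hz
      have hzE := connectedComponentIn_subset _ _ hz
      obtain ⟨l, hli, hl⟩ := hex hzE.1 hzE.2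
      by_cases hlj : l = j
      · exact .inl (hlj ▸ hl)
      · exact .inr (mem_iUnion₂.2 ⟨l, ⟨hli, hlj⟩, hl⟩)
    have hdisj : connectedComponentIn E x ∩ (F j ∩ ⋃ l ∈ {l | l ≠ i ∧ l ≠ j}, F l) = ∅ := by
      refine eq_empty_of_forall_notMem fun z hz => ?_
      obtain ⟨l, hl', hl⟩ := mem_iUnion₂.1 hz.2.2
      have hzE := connectedComponentIn_subset _ _ hz.1
      rcases (hdepth hij hzE.1 hz.2.1).2 l hl with h | h
      exacts [hl'.1 h, hl'.2 h]
    have hxc := mem_connectedComponentIn hxE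
    rcases isPreconnected_iff_subset_of_disjoint_closed.1 isPreconnected_connectedComponentIn _ _
      (hF.isClosed j) hcl hcover hdisj with h | h
    · exact fun z hz => ⟨(connectedComponentIn_subset _ _ hz).1, h hz⟩
    · refine absurd (show x ∈ _ ∩ (F j ∩ ⋃ l ∈ {l | l ≠ i ∧ l ≠ j}, F l) from ⟨hxc, hx.2, h hxc⟩) ?_
      rw [hdisj]
      exact notMem_empty x
  have hclosure : ∀ x ∈ F i ∩ F j,
      closure (connectedComponentIn E x) = connectedComponentIn E x := by
    intro x hx
    have hxE : x ∈ E := ⟨hx.1, (hdepth hij hx.1 hx.2).1⟩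
    refine Subset.antisymm ?_ subset_closure
    exact isPreconnected_connectedComponentIn.closure.subset_connectedComponentIn
      (subset_closure (mem_connectedComponentIn hxE))
      (closure_minimal (connectedComponentIn_subset _ _) hEcl)
  refine ⟨(fun x => closure (connectedComponentIn E x)) '' (F i ∩ F j), ?_, ?_, ?_⟩
  · rintro _ ⟨x, hx, rfl⟩
    exact ⟨x, hx.1, (hdepth hij hx.1 hx.2).1, rfl⟩
  · rintro _ ⟨x, hx, rfl⟩ _ ⟨y, hy, rfl⟩ hne
    refine disjoint_left.2 fun z hz hz' => hne ?_
    simp only [id, hclosure x hx, hclosure y hy] at hz hz' ⊢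
    rw [connectedComponentIn_eq hz, connectedComponentIn_eq hz']
  · rw [sUnion_image]
    refine Subset.antisymm (fun x hx => mem_iUnion₂.2 ⟨x, hx, ?_⟩) (iUnion₂_subset fun x hx => ?_)
    · exact subset_closure (mem_connectedComponentIn ⟨hx.1, (hdepth hij hx.1 hx.2).1⟩)
    · exact (hclosure x hx).subset.trans (hsub x hx)

/-- A corner system without points of depth more than two has the properties of the faces of a
`⟨m⟩`-manifold. -/
theorem isAngleManifold (h2 : ∀ x, A.depth x ≤ 2) : A.IsAngleManifold F where
  withFaces := hF.isManifoldWithFaces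
  isFace := hF.isFace
  boundary := hF.boundary_eq
  inter i j hij := ⟨hF.isFaceOf_inter h2 hij,
    inter_comm (F i) (F j) ▸ hF.isFaceOf_inter h2 hij.symm⟩

end IsCornerSystem

end Faces

end CornerStructure

/-! ### Faces of the blow-up -/

section BlowUpFaces

variable {k d : ℕ} [NeZero k] [NeZero d]
  {W : Type*} [TopologicalSpace W] [ChartedSpace (EuclideanHalfSpace k) W]
  [IsManifold (𝓡∂ k) ∞ W]
  {Y : Type*} [TopologicalSpace Y] [ChartedSpace (EuclideanHalfSpace d) Y]
  [IsManifold (𝓡∂ d) ∞ Y] {ι : C^∞⟮𝓡∂ k, W; 𝓡∂ d, Y⟯}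

/-- In a chart of the blow-up, the coordinate with index zero defines the inverse image of the
boundary of `Y`, and another coordinate defines the sphere bundle. -/
theorem IsBlowUpChart.exists_coord {c : PartialEquiv (BlowUp ι) (EuclideanQuadrant d)}
    (hc : IsBlowUpChart c) {x : BlowUp ι} (hx : x ∈ c.source) : ∃ b : Fin d,
      (∀ y ∈ c.source, y.proj ∈ (𝓡∂ d).boundary Y ↔ (c y).1 0 = 0) ∧
      (x ∈ sphereBundle ι → b ≠ 0 ∧ ∀ y ∈ c.source, y ∈ sphereBundle ι ↔ (c y).1 b = 0) ∧
      ∀ j, (c x).1 j = 0 → j = 0 ∨ x ∈ sphereBundle ι ∧ j = b := by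
  rcases hc with ⟨e, i, σ, hc⟩ | ⟨e, hc⟩
  · have hsource : ∀ y ∈ c.source, y.proj ∈ e.source ∧ direction e y i ≠ 0 := by
      intro y hy
      rw [hc.source_eq] at hy
      exact ⟨hy.1, fun h => by simp [h] at hy⟩
    have hsphere : ∀ y ∈ c.source, y ∈ sphereBundle ι ↔ (c y).1 i = 0 := by
      intro y hy
      obtain ⟨h1, h2⟩ := hsource y hy
      rw [hc.apply_eq hy, sphereCoord_self, abs_eq_zero, mem_sphereBundle_iff,
        hc.slice.mem_range_iff _ h1]
      refine ⟨fun h => by rw [h]; rfl, fun h => ?_⟩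
      obtain ⟨t, -, ht⟩ := exists_normalCoord_eq_smul hc.slice h1
      rw [ht, Pi.smul_apply, smul_eq_mul] at h
      rw [ht, (mul_eq_zero.1 h).resolve_right h2, zero_smul]
    refine ⟨i, fun y hy => ?_, fun _ => ⟨fun h => ?_, hsphere⟩, fun j hj => ?_⟩
    · rw [hc.apply_eq hy, sphereCoord_zero]
      exact mem_boundary_iff_of_mem_maximalAtlas hc.slice.mem_maximalAtlas (hsource y hy).1
    · have := i.2
      rw [h] at this
      exact not_le_zero_index this
    · by_contra hne
      push Not at hne
      have hji : j ≠ i := by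
        rintro rfl
        exact hne.2 ((hsphere x hx).2 hj) rfl
      have := c.map_source hx
      rw [hc.target_eq] at this
      exact (this.1 j hne.1 hji).ne' hj
  · refine ⟨0, fun y hy => ?_, fun h => ?_, fun j hj => ?_⟩
    · rw [hc.apply_eq hy, complementCoord_zero]
      rw [hc.source_eq] at hy
      exact mem_boundary_iff_of_mem_maximalAtlas hc.mem_maximalAtlas hy
    · rw [hc.source_eq] at hx
      exact absurd (mem_sphereBundle_iff.1 h) (hc.disjoint _ hx)
    · by_contra hne
      have := c.map_source hx
      rw [hc.target_eq] at this
      exact (this.1 j (not_or.1 hne).1).ne' hj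

variable (hι : IsSmoothEmbedding (𝓡∂ k) (𝓡∂ d) ∞ ι) (hclosed : IsClosed (range ι))
  (hboundary : ι ⁻¹' (𝓡∂ d).boundary Y = (𝓡∂ k).boundary W)

theorem isCornerSystem_blowUp {m : ℕ} {P : Fin m → Set Y}
    (hP : IsBoundaryDecomposition (d := d) Y P) :
    (blowUpStructure hι hclosed hboundary).IsCornerSystem
      (Fin.snoc (α := fun _ => Set (blowUpStructure hι hclosed hboundary).Space)
        (fun i => (blowUpStructure hι hclosed hboundary).proj ⁻¹' P i)
        (blowUpStructure hι hclosed hboundary).sphere) := by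
  have hproj := (contMDiff_proj_blowUp hι hclosed hboundary).continuous
  refine ⟨fun i => ?_, fun x => ?_⟩
  · induction i using Fin.lastCases with
    | last => simpa using isClosed_sphere hι hclosed hboundary
    | cast i => simpa using (hP.isClosed i).preimage hproj
  · obtain ⟨b, h0, hb, hj⟩ := (isBlowUpChart_chartAt hι hclosed hboundary x).exists_coord
      (mem_chart_source _ x)
    have hP' : ∀ {y : Y}, y ∈ (𝓡∂ d).boundary Y ↔ ∃ i, y ∈ P i := by
      intro y
      rw [hP.union, mem_iUnion]
    refine ⟨Fin.snoc (α := fun _ => Fin d) (fun _ => 0) b, ?_, fun j => ?_, fun i hi => ?_⟩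
    · intro i hi i' hi' h
      induction i using Fin.lastCases with
      | last =>
        induction i' using Fin.lastCases with
        | last => rfl
        | cast i' =>
          rw [mem_ofPred_eq, Fin.snoc_last] at hi
          rw [Fin.snoc_last, Fin.snoc_castSucc] at h
          exact absurd h (hb hi).1
      | cast i =>
        induction i' using Fin.lastCases with
        | last =>
          rw [mem_ofPred_eq, Fin.snoc_last] at hi'
          rw [Fin.snoc_last, Fin.snoc_castSucc] at h
          exact absurd h.symm (hb hi').1
        | cast i' =>
          rw [mem_ofPred_eq, Fin.snoc_castSucc] at hi hi'
          by_contra hne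
          exact disjoint_left.1 (hP.disjoint fun h => hne (congrArg Fin.castSucc h)) hi hi'
    · constructor
      · intro h
        rcases hj j h with rfl | ⟨hs, rfl⟩
        · obtain ⟨i, hi⟩ := hP'.1 ((h0 x (mem_chart_source _ x)).2 h)
          exact ⟨i.castSucc, by rw [Fin.snoc_castSucc]; exact hi, Fin.snoc_castSucc ..⟩
        · exact ⟨Fin.last m, by rw [Fin.snoc_last]; exact hs, Fin.snoc_last ..⟩
      · rintro ⟨i, hi, rfl⟩
        induction i using Fin.lastCases with
        | last =>
          rw [Fin.snoc_last] at hi ⊢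
          exact ((hb hi).2 x (mem_chart_source _ x)).1 hi
        | cast i =>
          rw [Fin.snoc_castSucc] at hi ⊢
          exact (h0 x (mem_chart_source _ x)).1 (hP'.2 ⟨i, hi⟩)
    · have hsource := (chartAt (EuclideanQuadrant d) x).open_source.mem_nhds (mem_chart_source _ x)
      induction i using Fin.lastCases with
      | last =>
        rw [Fin.snoc_last] at hi
        filter_upwards [hsource] with y hy
        rw [Fin.snoc_last, Fin.snoc_last]
        exact (hb hi).2 y hy
      | cast i =>
        rw [Fin.snoc_castSucc] at hi
        have hcl : IsClosed (⋃ j ∈ {j | j ≠ i}, P j) :=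
          (toFinite _).isClosed_biUnion fun j _ => hP.isClosed j
        have hx : (blowUpStructure hι hclosed hboundary).proj x ∉ ⋃ j ∈ {j | j ≠ i}, P j := by
          intro h
          obtain ⟨j, hji, hj⟩ := mem_iUnion₂.1 h
          exact disjoint_left.1 (hP.disjoint hji) hj hi
        filter_upwards [hsource, hproj.continuousAt.eventually_mem (hcl.isOpen_compl.mem_nhds hx)]
          with y hy hy'
        rw [Fin.snoc_castSucc, Fin.snoc_castSucc]
        refine Iff.trans ⟨fun h => hP'.2 ⟨i, h⟩, fun h => ?_⟩ (h0 y hy)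
        obtain ⟨j, hj⟩ := hP'.1 h
        by_cases hji : j = i
        · exact hji ▸ hj
        · exact absurd (mem_iUnion₂.2 ⟨j, hji, hj⟩) hy'

theorem isBoundaryDecomposition_boundary :
    IsBoundaryDecomposition (d := d) Y (fun _ : Fin 1 => (𝓡∂ d).boundary Y) where
  isClosed _ := ModelWithCorners.isClosed_boundary (I := 𝓡∂ d) (M := Y) (n := ∞) (by simp)
  disjoint _ _ h := absurd (Subsingleton.elim _ _) h
  union := (iUnion_const _).symm

theorem snoc_eq_pair {α : Type*} (a b : α) :
    Fin.snoc (α := fun _ => α) (fun _ : Fin 1 => a) b = ![a, b] := by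
  ext i
  fin_cases i <;> rfl

theorem isCornerSystem_pair : (blowUpStructure hι hclosed hboundary).IsCornerSystem
    ![(blowUpStructure hι hclosed hboundary).proj ⁻¹' (𝓡∂ d).boundary Y,
      (blowUpStructure hι hclosed hboundary).sphere] :=
  snoc_eq_pair ((blowUpStructure hι hclosed hboundary).proj ⁻¹' (𝓡∂ d).boundary Y)
    (blowUpStructure hι hclosed hboundary).sphere ▸
      isCornerSystem_blowUp hι hclosed hboundary isBoundaryDecomposition_boundary

theorem depth_le_two (x : (blowUpStructure hι hclosed hboundary).Space) :
    (blowUpStructure hι hclosed hboundary).depth x ≤ 2 := by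
  rw [(isCornerSystem_pair hι hclosed hboundary).depth_eq x]
  exact (ncard_le_ncard (subset_univ _)).trans (by simp [ncard_univ])

theorem depth_eq_two_iff (x : (blowUpStructure hι hclosed hboundary).Space) :
    (blowUpStructure hι hclosed hboundary).depth x = 2 ↔
      x ∈ (blowUpStructure hι hclosed hboundary).proj ⁻¹' (𝓡∂ d).boundary Y ∩
        (blowUpStructure hι hclosed hboundary).sphere := by
  rw [(isCornerSystem_pair hι hclosed hboundary).depth_eq x]
  constructor
  · intro h
    have h1 := eq_of_subset_of_ncard_le (subset_univ
      {i : Fin 2 | x ∈ ![(blowUpStructure hι hclosed hboundary).proj ⁻¹' (𝓡∂ d).boundary Y,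
        (blowUpStructure hι hclosed hboundary).sphere] i}) (by rw [h]; simp [ncard_univ])
    have h2 : ∀ i : Fin 2, x ∈ ![(blowUpStructure hι hclosed hboundary).proj ⁻¹' (𝓡∂ d).boundary Y,
        (blowUpStructure hι hclosed hboundary).sphere] i := fun i =>
          h1.ge (mem_univ i)
    exact ⟨h2 0, h2 1⟩
  · intro h
    rw [eq_univ_of_forall (s := {i : Fin 2 | x ∈ ![_, _] i}) fun i => ?_]
    · simp [ncard_univ]
    · fin_cases i
      exacts [h.1, h.2]

end BlowUpFaces

/-! ### Lifts of diffeomorphisms and of circle actions -/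

section Lift

variable {k d : ℕ} [NeZero k] [NeZero d]
  {W : Type*} [TopologicalSpace W] [ChartedSpace (EuclideanHalfSpace k) W]
  [IsManifold (𝓡∂ k) ∞ W]
  {Y : Type*} [TopologicalSpace Y] [ChartedSpace (EuclideanHalfSpace d) Y]
  [IsManifold (𝓡∂ d) ∞ Y] {ι : C^∞⟮𝓡∂ k, W; 𝓡∂ d, Y⟯}

/-- The differential of a map that preserves `W` maps the tangent space of `W` to itself. -/
theorem normalClass_mfderiv_eq_zero (hι : IsSmoothEmbedding (𝓡∂ k) (𝓡∂ d) ∞ ι) {φ : Y → Y}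
    (hφ : ContMDiff (𝓡∂ d) (𝓡∂ d) ∞ φ) (hW : ∀ w, φ (ι w) ∈ range ι) {w w' : W}
    (hw : ι w' = φ (ι w)) {v : EuclideanSpace ℝ (Fin d)} (hv : normalClass ι w v = 0) :
    normalClass ι w' (mfderiv (𝓡∂ d) (𝓡∂ d) φ (ι w) v) = 0 := by
  choose f hf using hW
  obtain rfl : f w = w' := hι.isEmbedding.injective ((hf w).trans hw.symm)
  have hfs : ContMDiffAt (𝓡∂ k) (𝓡∂ k) ∞ f w := contMDiffAt_of_embedding hι <| by
    simp only [hf]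
    exact hφ.contMDiffAt.comp w ι.contMDiff.contMDiffAt
  obtain ⟨u, rfl⟩ := (Submodule.Quotient.mk_eq_zero _).1 hv
  refine (Submodule.Quotient.mk_eq_zero _).2
    ⟨mfderiv (𝓡∂ k) (𝓡∂ k) f w u, ?_⟩
  have hιd : ∀ w, MDifferentiableAt (𝓡∂ k) (𝓡∂ d) ι w := fun w => ι.mdifferentiableAt
  have h1 := DFunLike.congr_fun (mfderiv_comp w (hιd (f w)) (hfs.mdifferentiableAt (by simp))) u
  have h2 := DFunLike.congr_fun
    (mfderiv_comp w (hφ.mdifferentiableAt (x := ι w) (by simp)) (hιd w)) u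
  have h3 : (ι ∘ f) = φ ∘ ι := funext hf
  refine h1.symm.trans (Eq.trans ?_ h2)
  rw [h3]

/-- `x'` is the image of `x` under the map that the self-map `φ` of the pair `(Y, W)` induces on the
blow-up. -/
def IsLiftOf (φ : Y → Y) (x x' : BlowUp ι) : Prop :=
  x'.proj = φ x.proj ∧ ∀ w v w', IsRayOf x w v → ι w' = φ (ι w) →
    IsRayOf x' w' (mfderiv (𝓡∂ d) (𝓡∂ d) φ (ι w) v)

theorem IsRayOf.eq {x x' : BlowUp ι} {w : W} {v : EuclideanSpace ℝ (Fin d)} (h : IsRayOf x w v)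
    (h' : IsRayOf x' w v) : x = x' := by
  obtain ⟨_, rfl⟩ := h
  obtain ⟨_, rfl⟩ := h'
  rfl

theorem IsLiftOf.unique {φ : Y → Y} (hrange : ∀ y, φ y ∈ range ι ↔ y ∈ range ι)
    {x x' x'' : BlowUp ι} (h' : IsLiftOf φ x x') (h'' : IsLiftOf φ x x'') : x' = x'' := by
  by_cases hx : x ∈ sphereBundle ι
  · obtain ⟨w, v, hv⟩ := exists_isRayOf hx
    obtain ⟨w', hw'⟩ := (hrange (ι w)).2 ⟨w, rfl⟩
    exact (h'.2 w v w' hv hw').eq (h''.2 w v w' hv hw')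
  · refine eq_of_proj_eq ?_ (h'.1.trans h''.1.symm)
    rwa [mem_sphereBundle_iff, h''.1, hrange, ← mem_sphereBundle_iff]

theorem IsLiftOf.refl (hι : IsSmoothEmbedding (𝓡∂ k) (𝓡∂ d) ∞ ι) (x : BlowUp ι) :
    IsLiftOf id x x := by
  refine ⟨rfl, fun w v w' h hw => ?_⟩
  obtain rfl : w' = w := hι.isEmbedding.injective hw
  have h1 : (mfderiv (𝓡∂ d) (𝓡∂ d) id (ι w') v : EuclideanSpace ℝ (Fin d)) = v :=
    DFunLike.congr_fun (mfderiv_id (I := 𝓡∂ d) (x := ι w')) v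
  exact h1.symm ▸ h

theorem IsLiftOf.comp {φ ψ : Y → Y} (hφ : ContMDiff (𝓡∂ d) (𝓡∂ d) ∞ φ)
    (hψ : ContMDiff (𝓡∂ d) (𝓡∂ d) ∞ ψ) (hrange : ∀ y, ψ y ∈ range ι ↔ y ∈ range ι)
    {x x' x'' : BlowUp ι} (h : IsLiftOf ψ x x') (h' : IsLiftOf φ x' x'') :
    IsLiftOf (φ ∘ ψ) x x'' := by
  refine ⟨h'.1.trans (congrArg φ h.1), fun w v w'' hr hw => ?_⟩
  obtain ⟨w', hw'⟩ := (hrange (ι w)).2 ⟨w, rfl⟩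
  have h1 := h'.2 w' _ w'' (h.2 w v w' hr hw') (hw.trans (congrArg φ hw'.symm))
  have h2 : (mfderiv (𝓡∂ d) (𝓡∂ d) (φ ∘ ψ) (ι w) v : EuclideanSpace ℝ (Fin d)) =
      mfderiv (𝓡∂ d) (𝓡∂ d) φ (ψ (ι w)) (mfderiv (𝓡∂ d) (𝓡∂ d) ψ (ι w) v) :=
    DFunLike.congr_fun (mfderiv_comp (ι w) (hφ.mdifferentiableAt (by simp))
      (hψ.mdifferentiableAt (by simp))) v
  rw [h2, ← hw']
  exact h1

/-- A diffeomorphism `φ` that preserves `W` lifts to the blow-up. -/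
theorem exists_isLiftOf (hι : IsSmoothEmbedding (𝓡∂ k) (𝓡∂ d) ∞ ι) {φ ψ : Y → Y}
    (hφ : ContMDiff (𝓡∂ d) (𝓡∂ d) ∞ φ) (hψ : ContMDiff (𝓡∂ d) (𝓡∂ d) ∞ ψ)
    (hψφ : Function.LeftInverse ψ φ)
    (hrange : ∀ y, φ y ∈ range ι ↔ y ∈ range ι) (hrange' : ∀ y, ψ y ∈ range ι ↔ y ∈ range ι)
    (x : BlowUp ι) : ∃ x', IsLiftOf φ x x' := by
  cases x with
  | off y hy =>
    refine ⟨.off (φ y) fun h => hy ((hrange y).1 h), rfl, fun w v w' h => ?_⟩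
    obtain ⟨_, h⟩ := h
    cases h
  | sphere w ρ =>
    obtain ⟨w₀, v, hv⟩ := exists_isRayOf (x := .sphere w ρ) ⟨w, ρ, rfl⟩
    obtain rfl : w = w₀ := hι.isEmbedding.injective hv.proj_eq
    obtain ⟨w', hw'⟩ := (hrange (ι w)).2 ⟨w, rfl⟩
    have hback : ι w = ψ (ι w') := by rw [hw', hψφ]
    let D : EuclideanSpace ℝ (Fin d) →ₗ[ℝ] EuclideanSpace ℝ (Fin d) :=
      (mfderiv (𝓡∂ d) (𝓡∂ d) φ (ι w)).toLinearMap
    have hne : ∀ u : EuclideanSpace ℝ (Fin d), normalClass ι w u ≠ 0 →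
        normalClass ι w' (D u) ≠ 0 := by
      intro u hu h0
      have h1 := normalClass_mfderiv_eq_zero hι hψ (fun w => (hrange' _).2 ⟨w, rfl⟩) hback h0
      have h2 : (mfderiv (𝓡∂ d) (𝓡∂ d) ψ (φ (ι w)) (mfderiv (𝓡∂ d) (𝓡∂ d) φ (ι w) u) :
          EuclideanSpace ℝ (Fin d)) = u := by
        refine (DFunLike.congr_fun (mfderiv_comp (ι w) (hψ.mdifferentiableAt (by simp))
          (hφ.mdifferentiableAt (by simp))) u).symm.trans ?_
        rw [hψφ.comp_eq_id]
        exact DFunLike.congr_fun (mfderiv_id (I := 𝓡∂ d) (x := ι w)) u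
      rw [hw'] at h1
      exact hu ((congrArg (normalClass ι w) h2).symm.trans h1)
    -- the differential induces a linear map of normal spaces
    have hD : ∀ u, u ∈ (mfderiv (𝓡∂ k) (𝓡∂ d) ι w).range →
        D u ∈ (mfderiv (𝓡∂ k) (𝓡∂ d) ι w').range := fun u hu =>
      (Submodule.Quotient.mk_eq_zero _).1 (normalClass_mfderiv_eq_zero hι hφ
        (fun w => (hrange _).2 ⟨w, rfl⟩) hw' ((Submodule.Quotient.mk_eq_zero _).2 hu))
    let L : NormalSpace ι w →ₗ[ℝ] NormalSpace ι w' := Submodule.mapQ _ _ D hD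
    refine ⟨.sphere w' (rayOfNeZero ℝ _ (hne v hv.1)), hw', fun w₁ u w₁' hu hw₁ => ?_⟩
    obtain rfl : w = w₁ := hι.isEmbedding.injective hu.proj_eq
    obtain rfl : w' = w₁' := hι.isEmbedding.injective (hw'.trans hw₁.symm)
    refine ⟨hne u hu.1, ?_⟩
    obtain ⟨hu0, hu⟩ := hu
    obtain ⟨hv0, hv⟩ := hv
    have h1 : rayOfNeZero ℝ _ hv0 = rayOfNeZero ℝ _ hu0 := by
      have := hv.symm.trans hu
      injection this
    rw [ray_eq_iff] at h1
    congr 1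
    rw [ray_eq_iff]
    exact h1.map L

end Lift

section CircleAction

variable {k d : ℕ} [NeZero k] [NeZero d]
  {W : Type*} [TopologicalSpace W] [ChartedSpace (EuclideanHalfSpace k) W]
  [IsManifold (𝓡∂ k) ∞ W]
  {Y : Type*} [TopologicalSpace Y] [ChartedSpace (EuclideanHalfSpace d) Y]
  [IsManifold (𝓡∂ d) ∞ Y] {ι : C^∞⟮𝓡∂ k, W; 𝓡∂ d, Y⟯} [MulAction Circle Y]
  (hι : IsSmoothEmbedding (𝓡∂ k) (𝓡∂ d) ∞ ι)
  (hs : ContMDiff ((𝓡 1).prod (𝓡∂ d)) (𝓡∂ d) ∞ (fun z : Circle × Y => z.1 • z.2))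
  (hW : ∀ (g : Circle) (w : W), g • ι w ∈ range ι)

include hs in
theorem contMDiff_circle_smul (g : Circle) :
    ContMDiff (𝓡∂ d) (𝓡∂ d) ∞ (fun y : Y => g • y) :=
  hs.comp (contMDiff_const.prodMk contMDiff_id)

include hW in
theorem circle_smul_mem_range_iff (g : Circle) (y : Y) : g • y ∈ range ι ↔ y ∈ range ι := by
  constructor
  · rintro ⟨w, hw⟩
    rw [← inv_smul_smul g y, ← hw]
    exact hW _ _
  · rintro ⟨w, rfl⟩
    exact hW _ _

include hι hs hW in
theorem exists_circle_isLiftOf (g : Circle) (x : BlowUp ι) :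
    ∃ x', IsLiftOf (fun y : Y => g • y) x x' :=
  exists_isLiftOf hι (contMDiff_circle_smul hs g) (contMDiff_circle_smul hs g⁻¹)
    (inv_smul_smul g) (circle_smul_mem_range_iff hW g) (circle_smul_mem_range_iff hW g⁻¹) x

/-- The action of an element of the circle on the blow-up. -/
def circleLift (g : Circle) (x : BlowUp ι) : BlowUp ι :=
  (exists_circle_isLiftOf hι hs hW g x).choose

theorem isLiftOf_circleLift (g : Circle) (x : BlowUp ι) :
    IsLiftOf (fun y : Y => g • y) x (circleLift hι hs hW g x) :=
  (exists_circle_isLiftOf hι hs hW g x).choose_spec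

/-- The lift to the blow-up of a circle action on `Y` that preserves `W`. -/
abbrev circleAction : MulAction Circle (BlowUp ι) where
  smul := circleLift hι hs hW
  one_smul x := by
    refine (isLiftOf_circleLift hι hs hW 1 x).unique (circle_smul_mem_range_iff hW 1) ?_
    have h : (fun y : Y => (1 : Circle) • y) = id := funext (one_smul Circle)
    exact (congrArg (fun φ => IsLiftOf φ x x) h).mpr (IsLiftOf.refl hι x)
  mul_smul g g' x := by
    refine (isLiftOf_circleLift hι hs hW (g * g') x).unique
      (circle_smul_mem_range_iff hW (g * g')) ?_
    have h : (fun y : Y => (g * g') • y) = (fun y : Y => g • y) ∘ fun y : Y => g' • y :=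
      funext (mul_smul g g')
    exact (congrArg (fun φ => IsLiftOf φ x _) h).mpr
      ((isLiftOf_circleLift hι hs hW g' x).comp (contMDiff_circle_smul hs g)
        (contMDiff_circle_smul hs g') (circle_smul_mem_range_iff hW g')
        (isLiftOf_circleLift hι hs hW g _))

variable (hclosed : IsClosed (range ι))
  (hboundary : ι ⁻¹' (𝓡∂ d).boundary Y = (𝓡∂ k).boundary W)

theorem smoothLift_circleLift (z : Circle × (blowUpStructure hι hclosed hboundary).Space) :
    SmoothLift ((𝓡 1).prod (modelWithCornersEuclideanQuadrant d))
      (fun z : Circle × (blowUpStructure hι hclosed hboundary).Space =>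
        circleLift hι hs hW z.1 z.2) univ z := by
  have hproj : ∀ z : Circle × (blowUpStructure hι hclosed hboundary).Space,
      (circleLift hι hs hW z.1 z.2).proj = z.1 • BlowUp.proj (ι := ι) z.2 := fun z =>
    (isLiftOf_circleLift hι hs hW z.1 z.2).1
  have hrange := circle_smul_mem_range_iff hW
  have hid := (smoothLift_id hι hclosed hboundary z.2).comp
    (I' := (𝓡 1).prod (modelWithCornersEuclideanQuadrant d)) (t := univ) (m' := z)
    contMDiffWithinAt_snd (mapsTo_univ _ _)
  have hp : ContMDiffWithinAt ((𝓡 1).prod (modelWithCornersEuclideanQuadrant d)) (𝓡∂ d) ∞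
      (fun z : Circle × (blowUpStructure hι hclosed hboundary).Space =>
        (circleLift hι hs hW z.1 z.2).proj) univ z := by
    simp only [hproj]
    exact ContMDiffAt.comp_contMDiffWithinAt (g := fun z : Circle × Y => z.1 • z.2)
      (f := fun z : Circle × (blowUpStructure hι hclosed hboundary).Space =>
        (z.1, BlowUp.proj (ι := ι) z.2)) z hs.contMDiffAt
      (contMDiffWithinAt_fst.prodMk hid.proj)
  by_cases hx : BlowUp.proj (ι := ι) z.2 ∈ range ι
  · obtain ⟨w, hw⟩ := hx
    obtain ⟨w', hw'⟩ := hW z.1 w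
    obtain ⟨e, he, hew⟩ := exists_isSliceChart hι hboundary w
    obtain ⟨e', he', hew'⟩ := exists_isSliceChart hι hboundary w'
    have hy : BlowUp.proj (ι := ι) z.2 ∈ e.source := hw ▸ hew
    have hy' : (circleLift hι hs hW z.1 z.2).proj ∈ e'.source := by
      rw [hproj, ← hw, ← hw']
      exact hew'
    refine SmoothLift.of_hasSmoothDirection hι hclosed (mem_univ z) hp he' hy' ?_
    refine (hid.direction e he hy).map hι (mem_univ z) hid.proj
      (mem_sphereBundle_iff.2 ⟨w, hw⟩) he he' (G := fun p => p.1.1 • p.2) ?_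
      (fun z => (contMDiff_circle_smul hs z.1).mdifferentiable (by simp)) hy hy' hproj
      (fun z => hrange z.1) fun z => (isLiftOf_circleLift hι hs hW z.1 z.2).2
    exact ContMDiffAt.comp (g := fun z : Circle × Y => z.1 • z.2)
      (f := fun p : (Circle × (blowUpStructure hι hclosed hboundary).Space) × Y => (p.1.1, p.2)) _
      hs.contMDiffAt
      ((contMDiffAt_fst.comp _ contMDiffAt_fst).prodMk contMDiffAt_snd)
  · refine SmoothLift.of_notMem hι hclosed hp ?_
    rwa [mem_sphereBundle_iff, hproj, hrange]

theorem isLiftedAction_circleAction :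
    letI : MulAction Circle (blowUpStructure hι hclosed hboundary).Space := circleAction hι hs hW
    (blowUpStructure hι hclosed hboundary).IsLiftedAction := by
  let : MulAction Circle (blowUpStructure hι hclosed hboundary).Space := circleAction hι hs hW
  refine ⟨fun z => ?_, fun g x => (isLiftOf_circleLift hι hs hW g x).1, fun g w w' hw v hv => ?_⟩
  · exact contMDiffWithinAt_blowUp_of_smoothLift hι hclosed hboundary (mem_univ z)
      (smoothLift_circleLift hι hs hW hclosed hboundary z)
  · exact (isLiftOf_circleLift hι hs hW g (.sphere w (rayOfNeZero ℝ _ hv))).2 w v w' ⟨hv, rfl⟩ hw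

end CircleAction

end M5

end

theorem mainTheorem2
    {W : Type*} [TopologicalSpace W] [ChartedSpace (EuclideanHalfSpace 6) W]
    [IsManifold (𝓡∂ 6) ∞ W]
    {Y : Type*} [TopologicalSpace Y] [T2Space Y] [SecondCountableTopology Y]
    [ChartedSpace (EuclideanHalfSpace 11) Y] [IsManifold (𝓡∂ 11) ∞ Y]
    (ι : C^∞⟮𝓡∂ 6, W; 𝓡∂ 11, Y⟯)
    (hι : IsSmoothEmbedding (𝓡∂ 6) (𝓡∂ 11) ∞ ι)
    (hclosed : IsClosed (range ι))
    (hboundary : ι ⁻¹' (𝓡∂ 11).boundary Y = (𝓡∂ 6).boundary W) :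
    ∃ A : M5.CornerStructure 11 (M5.BlowUp ι),
      -- `A` is a manifold structure that extends the one of `Y ∖ W` and fits all tubular maps
      T2Space A.Space ∧ SecondCountableTopology A.Space ∧ A.ExtendsComplement ∧
      (∀ V U T, M5.IsTubularMap ι V U T → A.Adapted U T) ∧
      -- it is the only one
      (∀ B : M5.CornerStructure 11 (M5.BlowUp ι), B.ExtendsComplement →
        (∀ V U T, M5.IsTubularMap ι V U T → B.Adapted U T) → A.Same B) ∧
      -- and any single tubular map of `W` determines it
      (∀ U T, M5.IsTubularMap ι univ U T → ∀ B : M5.CornerStructure 11 (M5.BlowUp ι),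
        B.ExtendsComplement → B.Adapted U T → A.Same B) ∧
      -- the corners have codimension two
      (∀ x, A.depth x ≤ 2) ∧
      {x | A.depth x = 2} = A.proj ⁻¹' (𝓡∂ 11).boundary Y ∩ A.sphere ∧
      -- the faces
      A.IsAngleManifold ![A.proj ⁻¹' (𝓡∂ 11).boundary Y, A.sphere] ∧
      (∀ (m : ℕ) (P : Fin m → Set Y), M5.IsBoundaryDecomposition (d := 11) Y P →
        A.IsAngleManifold
          (Fin.snoc (α := fun _ => Set A.Space) (fun i => A.proj ⁻¹' P i) A.sphere)) ∧
      -- the case of a circle action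
      (∀ [MulAction Circle Y],
        ContMDiff ((𝓡 1).prod (𝓡∂ 11)) (𝓡∂ 11) ∞ (fun z : Circle × Y => z.1 • z.2) →
        (∀ (g : Circle) (w : W), g • ι w ∈ range ι) →
        ∃ _ : MulAction Circle A.Space, A.IsLiftedAction ∧
          (∀ (g : Circle), ∀ x ∈ A.sphere, g • x ∈ A.sphere) ∧
          ∀ (m : ℕ) (P : Fin m → Set Y), M5.IsBoundaryDecomposition (d := 11) Y P →
            (∀ (i : Fin m) (g : Circle), ∀ y ∈ P i, g • y ∈ P i) →
            ∀ (i : Fin m) (g : Circle), ∀ x ∈ A.proj ⁻¹' P i, g • x ∈ A.proj ⁻¹' P i) := by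
  refine ⟨M5.blowUpStructure hι hclosed hboundary, M5.t2Space_blowUp hι hclosed hboundary,
    M5.secondCountableTopology_blowUp hι hclosed hboundary,
    M5.extendsComplement_blowUp hι hclosed hboundary,
    fun V U T hT => M5.adapted_blowUp hι hclosed hboundary hT, fun B hB hBT => ?_,
    fun U T hT B hB hBT => ?_, M5.depth_le_two hι hclosed hboundary,
    ext (M5.depth_eq_two_iff hι hclosed hboundary),
    (M5.isCornerSystem_pair hι hclosed hboundary).isAngleManifold
      (M5.depth_le_two hι hclosed hboundary),
    fun m P hP => (M5.isCornerSystem_blowUp hι hclosed hboundary hP).isAngleManifold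
      (M5.depth_le_two hι hclosed hboundary), fun hs hW => ?_⟩
  · refine M5.same_of_adapted (M5.extendsComplement_blowUp hι hclosed hboundary) hB fun w => ?_
    obtain ⟨e, he, hw⟩ := M5.exists_isSliceChart hι hboundary w
    have hT := M5.isTubularMap_chartTubularMap hι he
    exact ⟨_, _, _, hT, hw, M5.adapted_blowUp hι hclosed hboundary hT, hBT _ _ _ hT⟩
  · exact M5.same_of_adapted (M5.extendsComplement_blowUp hι hclosed hboundary) hB fun w =>
      ⟨univ, U, T, hT, mem_univ w, M5.adapted_blowUp hι hclosed hboundary hT, hBT⟩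
  · have hA := M5.isLiftedAction_circleAction hι hs hW hclosed hboundary
    let _ : MulAction Circle (M5.blowUpStructure hι hclosed hboundary).Space :=
      M5.circleAction hι hs hW
    refine ⟨M5.circleAction hι hs hW, hA, fun g x hx => ?_, fun m P _ hP i g x hx => ?_⟩
    · refine M5.mem_sphereBundle_iff.2 ?_
      have h1 := (M5.circle_smul_mem_range_iff hW g _).2 (M5.mem_sphereBundle_iff.1 hx)
      exact (congrArg (· ∈ range ι) (hA.proj_smul g x)).mpr h1
    · exact (congrArg (· ∈ P i) (hA.proj_smul g x)).mpr (hP i g _ hx)
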